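/- **Setting.** A configuration is a locally finite set $\gamma\subset\mathbb R^2$; the set $\mathcal M$ of configurations carries the $\sigma$-algebra generated by the counts $\gamma\mapsto\#(\gamma\cap\Lambda)$, $\Lambda$ in the class $\mathcal B$ of bounded Borel sets. A set $T\subset\gamma$ of three non-collinear points is a Delaunay triangle of $\gamma$, $T\in \mathrm{Del}(\gamma)$, if its open circumscribed disc $B(T)$ contains no point of $\gamma$; $R(T)$ is the radius of $B(T)$, $l(T)$ the smallest side length and $\mathrm{Per}(T)$ the perimeter of $T$. Let $r>0$, let $\mathcal K\subset(0,\infty)$ be compact with $\alpha>r$ for all $\alpha\in\mathcal K$, and let $\Theta\subset\mathbb R$ be bounded and open. For $\alpha\ge0$, $\theta\in\Theta$, $\Lambda\in\mathcal B$, $\gamma\in\mathcal M$ put $$H_\Lambda^{\alpha,\theta}(\gamma)=\sum_{T\in \mathrm{Del}(\gamma),\ B(T)\cap\Lambda\neq\emptyset}\varphi(T),\qquad \varphi(T)=\begin{cases}+\infty & \text{if } R(T)\ge\alpha\text{ or } l(T)\le r,\\ \theta\,\mathrm{Per}(T)&\text{otherwise.}\end{cases}$$ Let $\mathcal M_\infty^{\alpha,\theta}$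 be the set of $\gamma$ with $H^{\alpha,\theta}_\Lambda(\gamma)<\infty$ for all $\Lambda\in\mathcal B$. A point $x\in\gamma$ is removable, $x\in\mathcal R^{\alpha,\theta}(\gamma)$, if $H^{\alpha,\theta}_\Lambda(\gamma\setminus\{x\})<\infty$ for some bounded Borel neighbourhood $\Lambda$ of $x$; for such $\Lambda$ the local energy is $h^{\alpha,\theta}(x,\gamma\setminus\{x\})=H^{\alpha,\theta}_\Lambda(\gamma)-H^{\alpha,\theta}_\Lambda(\gamma\setminus\{x\})$. Let $\pi_\Lambda$ be the law of the unit-rate Poisson process on $\Lambda$. $\mathcal G^{\alpha,\theta}$ is the set of stationary (translation invariant) Gibbs measures: probability measures $\mu$ on $\mathcal M$ such that for every $\Lambda\in\mathcal B$ and every measurable $f\ge0$ $$\int f\,d\mu=\int\frac1{Z_\Lambda(\gamma)}\int f(\gamma'_\Lambda\cup\gamma_{\Lambda^c})e^{-H^{\alpha,\theta}_\Lambda(\gamma'_\Lambda\cup\gamma_{\Lambda^c})}\pi_\Lambda(d\gamma')\,\mu(d\gamma),$$ where $Z_\Lambda(\gamma)=\int e^{-H^{\alpha,\theta}_\Lambda(\gamma'_\Lambda\cup\gamma_{\Lambda^c})}\pi_\Lambda(d\gamma')$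 lies in $(0,\infty)$ for $\mu$-a.e. $\gamma$. Below, $h^{\alpha,\theta}(x,\gamma)$ is considered for $x\notin\gamma$. **Proposition 5.** The following hold. * S1: $H_\Lambda^{\alpha,\theta}(\gamma)<\infty\iff H_\Lambda^{\alpha,\theta'}(\gamma)<\infty$ for all $\gamma\in\mathcal M$, $\Lambda\in\mathcal B$, $\alpha\ge0$, $\theta,\theta'\in\Theta$. * S2: if $0\le\alpha\le\alpha'$ and $H_\Lambda^{\alpha,\theta}(\gamma)<\infty$, then $H_\Lambda^{\alpha',\theta}(\gamma)<\infty$, for all $\gamma\in\mathcal M$, $\Lambda\in\mathcal B$, $\theta\in\Theta$. * S4: if $\gamma\in\mathcal M$, $\Lambda\in\mathcal B$, $\theta\in\Theta$, $\alpha'>0$ and $H_\Lambda^{\alpha',\theta}(\gamma)<\infty$, then $H_\Lambda^{\alpha,\theta}(\gamma)<\infty$ for some $0<\alpha<\alpha'$. * H2: for all $\alpha\ge0$, $\theta\in\Theta$, $x,y\in\mathbb R^2$, $\gamma\in\mathcal M$: $h^{\alpha,\theta}(x+y,\gamma+y)=h^{\alpha,\theta}(x,\gamma)$, the left side being defined whenever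 the right side is. * H3: there is $C\ge0$ such that $h^{\alpha,\theta}(x,\gamma)\ge -C$ for all $\alpha\in\mathcal K$, $\theta\in\Theta$, $\gamma\in\mathcal M_\infty^{\alpha,\theta}$ and $x\in\mathbb R^2\setminus\gamma$. Moreover, for all $\alpha^*\in\mathcal K$ and $\theta^*\in\Theta$: * S3: for every $0\le\alpha<\alpha^*$ there is $R_\alpha>0$ such that $\mu\big(H^{\alpha,\theta^*}_{B(0,R_\alpha)}=+\infty\big)>0$ for every $\mu\in\mathcal G^{\alpha^*,\theta^*}$; and for every $\mu\in\mathcal G^{\alpha^*,\theta^*}$: * H4: for all $\theta\in\Theta$, $h^{\alpha^*,\theta}(0,\cdot)\,e^{-h^{\alpha^*,\theta^*}(0,\cdot)}\in L^1(\mu)$, with $\infty e^{-\infty}=0$; * H5: for all $\theta\in\Theta\setminus\{\theta^*\}$, $\mu\big(h^{\alpha^*,\theta^*}(0,\cdot)\ne h^{\alpha^*,\theta}(0,\cdot)\big)>0$; * H6′: there are $\delta:\mathbb R\to\mathbb R$ with $\delta(x)\to0$ as $x\to0$ and $g\in L^1(\mu)$ such that for $\mu$-a.e. $\gamma\in\mathcal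 M_\infty^{\alpha^*,\theta^*}$ and all $0\le\alpha\le\alpha^*$, $\theta,\theta'\in\Theta$: if $0\in\mathcal R^{\alpha,\theta}(\gamma\cup\{0\})$ and $h^{\alpha,\theta}(0,\gamma)<\infty$, then $h^{\alpha^*,\theta'}(0,\gamma)<\infty$ and $$|h^{\alpha,\theta}(0,\gamma)-h^{\alpha^*,\theta'}(0,\gamma)|\le g(\gamma)\big[\delta(|\alpha-\alpha^*|)+\delta(|\theta-\theta'|)\big].$$ -/

import Mathlib

open MeasureTheory Filter Topology
open scoped ENNReal NNReal Nat

noncomputable section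

/-- The Euclidean plane. -/
abbrev Plane : Type := EuclideanSpace ℝ (Fin 2)

/-- Bounded Borel subsets of the plane. -/
def IsBoundedBorel (Λ : Set Plane) : Prop :=
  Bornology.IsBounded Λ ∧ MeasurableSet Λ

/-! ### Configurations -/

/-- Locally finite simple point configurations in the plane. A simple integer-valued measure that
is finite on bounded sets is identified with the locally finite set of its atoms. -/
@[ext]
structure Config where
  carrier : Set Plane
  locallyFinite : ∀ Λ : Set Plane, Bornology.IsBounded Λ → (carrier ∩ Λ).Finite

namespace Config

/-- The number `γ(Λ)` of points of `γ` in `Λ`. -/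
def count (γ : Config) (Λ : Set Plane) : ℕ := (γ.carrier ∩ Λ).ncard

/-- The σ-algebra generated by the sets `{γ | γ(Λ) = n}`, `Λ` bounded Borel. -/
instance : MeasurableSpace Config :=
  MeasurableSpace.generateFrom
    {A | ∃ (Λ : Set Plane) (n : ℕ), IsBoundedBorel Λ ∧ A = {γ : Config | γ.count Λ = n}}

/-- `γ + δ_x` (for `x` not a point of `γ`). -/
def addPoint (γ : Config) (x : Plane) : Config where
  carrier := insert x γ.carrier
  locallyFinite Λ hΛ := by
    refine ((γ.locallyFinite Λ hΛ).insert x).subset ?_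
    rintro y ⟨rfl | hy, hyΛ⟩
    · exact Set.mem_insert _ _
    · exact Set.mem_insert_of_mem _ ⟨hy, hyΛ⟩

/-- `γ - δ_x` (for `x` a point of `γ`). -/
def removePoint (γ : Config) (x : Plane) : Config where
  carrier := γ.carrier \ {x}
  locallyFinite Λ hΛ :=
    (γ.locallyFinite Λ hΛ).subset (Set.inter_subset_inter_left _ Set.sdiff_subset)

/-- The configuration `γ` translated by `y`. -/
def translate (y : Plane) (γ : Config) : Config where
  carrier := (fun z => z + y) '' γ.carrier
  locallyFinite Λ hΛ := by
    have hb : Bornology.IsBounded ((fun z => z - y) '' Λ) :=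
      (LipschitzWith.id.sub (LipschitzWith.const y)).isBounded_image hΛ
    refine ((γ.locallyFinite _ hb).image (fun z => z + y)).subset ?_
    rintro _ ⟨⟨z, hz, rfl⟩, hzΛ⟩
    exact ⟨z, ⟨hz, z + y, hzΛ, by simp⟩, rfl⟩

/-- `γ'_Λ + γ_{Λᶜ}`: the points of `γ'` in `Λ` and those of `γ` outside `Λ`. -/
def glue (Λ : Set Plane) (γ' γ : Config) : Config where
  carrier := (γ'.carrier ∩ Λ) ∪ (γ.carrier \ Λ)
  locallyFinite B hB := by
    refine ((γ'.locallyFinite B hB).union (γ.locallyFinite B hB)).subset ?_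
    rintro y ⟨⟨hy, _⟩ | ⟨hy, _⟩, hyB⟩
    · exact Or.inl ⟨hy, hyB⟩
    · exact Or.inr ⟨hy, hyB⟩

/-- The configuration made of finitely many points. -/
def ofTuple {n : ℕ} (x : Fin n → Plane) : Config where
  carrier := Set.range x
  locallyFinite _ _ := (Set.finite_range x).subset Set.inter_subset_left

open Classical in
theorem measurable_ofTuple (n : ℕ) : Measurable (ofTuple : (Fin n → Plane) → Config) := by
  refine measurable_generateFrom ?_
  rintro _ ⟨Λ, m, hΛ, rfl⟩
  have key : ∀ x : Fin n → Plane, (ofTuple x).count Λ =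
      ∑ i : Fin n, if x i ∈ Λ ∧ ∀ j, j < i → x j ≠ x i then 1 else 0 := by
    intro x
    rw [← Finset.card_filter, ← Finset.card_image_of_injOn (f := x), ← Set.ncard_coe_finset]
    · unfold count
      refine congrArg Set.ncard ?_
      ext y
      simp only [ofTuple, Set.mem_inter_iff, Set.mem_range, Finset.coe_image, Finset.coe_filter,
        Finset.mem_univ, true_and, Set.mem_image, Set.mem_ofPred_eq]
      constructor
      · rintro ⟨⟨i, rfl⟩, hi⟩
        have hne : (Finset.univ.filter fun j => x j = x i).Nonempty := ⟨i, by simp⟩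
        have hmem := Finset.min'_mem _ hne
        set k := (Finset.univ.filter fun j => x j = x i).min' hne with hk
        simp only [Finset.mem_filter, Finset.mem_univ, true_and] at hmem
        refine ⟨k, ⟨by rwa [hmem], fun j hj hxj => ?_⟩, hmem⟩
        exact absurd (Finset.min'_le _ j (by simp [hxj, hmem])) (not_le.2 (hk ▸ hj))
      · rintro ⟨i, ⟨hi, _⟩, rfl⟩
        exact ⟨⟨i, rfl⟩, hi⟩
    · intro i hi j hj hij
      simp only [Finset.coe_filter, Finset.mem_univ, true_and, Set.mem_ofPred_eq] at hi hj
      rcases lt_trichotomy i j with h | h | h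
      · exact absurd hij (hj.2 i h)
      · exact h
      · exact absurd hij.symm (hi.2 j h)
  have hset : (ofTuple : (Fin n → Plane) → Config) ⁻¹' {γ : Config | γ.count Λ = m} =
      {x | (∑ i : Fin n, if x i ∈ Λ ∧ ∀ j, j < i → x j ≠ x i then 1 else 0) = m} := by
    ext x
    simp only [Set.mem_preimage, Set.mem_ofPred_eq, key]
  rw [hset]
  refine measurableSet_eq_fun (Finset.measurable_sum _ fun i _ => ?_) measurable_const
  refine Measurable.ite ?_ measurable_const measurable_const
  refine (measurable_pi_apply i hΛ.2).inter ?_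
  have : {x : Fin n → Plane | ∀ j, j < i → x j ≠ x i} =
      ⋂ j, ⋂ (_ : j < i), {x : Fin n → Plane | x j = x i}ᶜ := by
    ext x; simp
  change MeasurableSet {x : Fin n → Plane | ∀ j, j < i → x j ≠ x i}
  rw [this]
  exact MeasurableSet.iInter fun j => MeasurableSet.iInter fun _ =>
    (measurableSet_eq_fun (measurable_pi_apply j) (measurable_pi_apply i)).compl

end Config

/-- The law `π_Λ` of the Poisson process on a bounded Borel set `Λ` with unit intensity: a Poisson
number `n` of points (with mean the area of `Λ`), independent and uniform in `Λ`. -/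
def poissonLaw (Λ : Set Plane) : Measure Config :=
  Measure.sum fun n : ℕ =>
    (ENNReal.ofReal (Real.exp (-(volume Λ).toReal)) / (n ! : ℝ≥0∞)) •
      (Measure.pi fun _ : Fin n => (volume : Measure Plane).restrict Λ).map Config.ofTuple

/-! ### Energies, removable points, local energy, Gibbs measures -/

/-- A family `(H_Λ)` of functions from configurations to `ℝ ∪ {+∞}`. -/
abbrev EnergyFamily : Type := Set Plane → Config → EReal

/-- The configurations of locally finite energy. -/
def finiteEnergyConfigs (H : EnergyFamily) : Set Config :=
  {γ | ∀ Λ, IsBoundedBorel Λ → H Λ γ < ⊤}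

/-- The set of removable points of `γ`. The window is a neighbourhood of the point: for the
one-point window `Λ = {x}` no open circumdisc of a Delaunay triangle of a configuration
containing `x` meets `Λ`, and the energy difference would ignore the triangles with vertex `x`. -/
def removablePoints (H : EnergyFamily) (γ : Config) : Set Plane :=
  {x | x ∈ γ.carrier ∧
    ∃ Λ, IsBoundedBorel Λ ∧ Λ ∈ 𝓝 x ∧ H Λ (γ.removePoint x) < ⊤}

open Classical in
/-- The local energy `h(x, γ) = H_Λ(γ + δ_x) - H_Λ(γ)`, where `x` is not a point of `γ` and `Λ` is
a bounded Borel neighbourhood of `x` with `H_Λ(γ) < +∞`. It is meaningful when `x` is removable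
from `γ + δ_x`. -/
def localEnergy (H : EnergyFamily) (x : Plane) (γ : Config) : EReal :=
  if h : ∃ Λ, IsBoundedBorel Λ ∧ Λ ∈ 𝓝 x ∧ H Λ γ < ⊤ then
    H h.choose (γ.addPoint x) - H h.choose γ
  else 0

/-- The normalization constant `Z_Λ(γ_{Λᶜ})`. -/
def partitionFunction (H : EnergyFamily) (Λ : Set Plane) (γ : Config) : ℝ≥0∞ :=
  ∫⁻ γ', EReal.exp (-H Λ (Config.glue Λ γ' γ)) ∂poissonLaw Λ

/-- The Gibbs kernel `Ξ_Λ(f, γ)`. -/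
def gibbsKernel (H : EnergyFamily) (Λ : Set Plane) (f : Config → ℝ≥0∞) (γ : Config) : ℝ≥0∞ :=
  (partitionFunction H Λ γ)⁻¹ *
    ∫⁻ γ', f (Config.glue Λ γ' γ) * EReal.exp (-H Λ (Config.glue Λ γ' γ)) ∂poissonLaw Λ

/-- Stationary Gibbs measures: translation invariant probability measures that satisfy the
DLR equations. -/
structure IsStationaryGibbs (H : EnergyFamily) (μ : Measure Config) : Prop where
  isProbabilityMeasure : IsProbabilityMeasure μ
  stationary : ∀ y : Plane, MeasurePreserving (Config.translate y) μ μ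
  partitionFunction_pos_lt_top : ∀ Λ, IsBoundedBorel Λ →
    ∀ᵐ γ ∂μ, 0 < partitionFunction H Λ γ ∧ partitionFunction H Λ γ < ⊤
  dlr : ∀ Λ, IsBoundedBorel Λ → ∀ f : Config → ℝ≥0∞, Measurable f →
    ∫⁻ γ, f γ ∂μ = ∫⁻ γ, gibbsKernel H Λ f γ ∂μ

/-! ### The assumptions on a parametric family `H α θ` of energies

`α` is the hardcore parameter, `θ` the smooth one; `a₀, t₀` are the true parameters. -/

/-- The finiteness of the energy does not depend on `θ`. -/
def AssumptionS1 (Θ : Set ℝ) (H : ℝ → ℝ → EnergyFamily) : Prop :=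
  ∀ (γ : Config) (α : ℝ), 0 ≤ α → ∀ θ ∈ Θ, ∀ θ' ∈ Θ, ∀ Λ, IsBoundedBorel Λ →
    (H α θ Λ γ < ⊤ ↔ H α θ' Λ γ < ⊤)

/-- Monotonicity of the support in `α`. -/
def AssumptionS2 (Θ : Set ℝ) (H : ℝ → ℝ → EnergyFamily) : Prop :=
  ∀ (γ : Config) (α α' : ℝ), 0 ≤ α → 0 ≤ α' → ∀ θ ∈ Θ, ∀ Λ, IsBoundedBorel Λ →
    α ≤ α' → H α θ Λ γ < ⊤ → H α' θ Λ γ < ⊤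

/-- An underestimated support is detected in a fixed ball with positive probability. -/
def AssumptionS3 (H : ℝ → ℝ → EnergyFamily) (a₀ t₀ : ℝ) : Prop :=
  ∀ α, 0 ≤ α → α < a₀ → ∃ R : ℝ, 0 < R ∧
    ∀ μ : Measure Config, IsStationaryGibbs (H a₀ t₀) μ →
      0 < μ {γ | H α t₀ (Metric.ball 0 R) γ = ⊤}

/-- Left continuity of the support in `α`. -/
def AssumptionS4 (Θ : Set ℝ) (H : ℝ → ℝ → EnergyFamily) : Prop :=
  ∀ (γ : Config) (Λ : Set Plane), IsBoundedBorel Λ → ∀ θ ∈ Θ, ∀ α' : ℝ, 0 < α' →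
    H α' θ Λ γ < ⊤ → ∃ α, 0 < α ∧ α < α' ∧ H α θ Λ γ < ⊤

/-- Translation invariance of the local energy, wherever it is defined. -/
def AssumptionH2 (Θ : Set ℝ) (H : ℝ → ℝ → EnergyFamily) : Prop :=
  ∀ α : ℝ, 0 ≤ α → ∀ θ ∈ Θ, ∀ (x y : Plane) (γ : Config), x ∉ γ.carrier →
    x ∈ removablePoints (H α θ) (γ.addPoint x) →
      x + y ∈ removablePoints (H α θ) ((γ.translate y).addPoint (x + y)) ∧
      localEnergy (H α θ) (x + y) (γ.translate y) = localEnergy (H α θ) x γ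

/-- Local stability, uniformly in the parameters. -/
def AssumptionH3 (K Θ : Set ℝ) (H : ℝ → ℝ → EnergyFamily) : Prop :=
  ∃ C : ℝ, 0 ≤ C ∧ ∀ α ∈ K, ∀ θ ∈ Θ, ∀ γ ∈ finiteEnergyConfigs (H α θ), ∀ x ∉ γ.carrier,
    ((-C : ℝ) : EReal) ≤ localEnergy (H α θ) x γ

/-- The function `h^{a₀,θ}(0,·) exp(-h^{a₀,t₀}(0,·))`. In `EReal`, `∞ * exp(-∞) = ∞ * 0 = 0`. -/
def weightedLocalEnergy (H : ℝ → ℝ → EnergyFamily) (a₀ t₀ θ : ℝ) (γ : Config) : EReal :=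
  localEnergy (H a₀ θ) 0 γ * (EReal.exp (-localEnergy (H a₀ t₀) 0 γ) : EReal)

/-- Integrability of `h^{a₀,θ}(0,·) exp(-h^{a₀,t₀}(0,·))`. -/
def AssumptionH4 (Θ : Set ℝ) (H : ℝ → ℝ → EnergyFamily) (a₀ t₀ : ℝ) (μ : Measure Config) : Prop :=
  ∀ θ ∈ Θ, (∀ᵐ γ ∂μ, weightedLocalEnergy H a₀ t₀ θ γ ≠ ⊤ ∧ weightedLocalEnergy H a₀ t₀ θ γ ≠ ⊥) ∧
    Integrable (fun γ => (weightedLocalEnergy H a₀ t₀ θ γ).toReal) μ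

/-- Identifiability of the smooth parameter. -/
def AssumptionH5 (Θ : Set ℝ) (H : ℝ → ℝ → EnergyFamily) (a₀ t₀ : ℝ) (μ : Measure Config) : Prop :=
  ∀ θ ∈ Θ, θ ≠ t₀ →
    0 < μ {γ | γ ∈ finiteEnergyConfigs (H a₀ t₀) ∧ (0 : Plane) ∉ γ.carrier ∧
      localEnergy (H a₀ t₀) 0 γ ≠ localEnergy (H a₀ θ) 0 γ}

/-- Continuity of the local energy in `(α, θ)` at `α = a₀`. -/
def AssumptionH6' (Θ : Set ℝ) (H : ℝ → ℝ → EnergyFamily) (a₀ t₀ : ℝ) (μ : Measure Config) :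
    Prop :=
  ∃ (δ : ℝ → ℝ) (g : Config → ℝ), Tendsto δ (𝓝 0) (𝓝 0) ∧ Integrable g μ ∧
    ∀ᵐ γ ∂μ, γ ∈ finiteEnergyConfigs (H a₀ t₀) → (0 : Plane) ∉ γ.carrier →
      ∀ α, 0 ≤ α → α ≤ a₀ → ∀ θ ∈ Θ, ∀ θ' ∈ Θ,
        (0 : Plane) ∈ removablePoints (H α θ) (γ.addPoint 0) →
        localEnergy (H α θ) 0 γ < ⊤ →
          localEnergy (H a₀ θ') 0 γ < ⊤ ∧
          |(localEnergy (H α θ) 0 γ).toReal - (localEnergy (H a₀ θ') 0 γ).toReal| ≤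
            g γ * (δ |α - a₀| + δ |θ - θ'|)

/-! ### The hardcore Delaunay tessellation model -/

/-- The circumscribed circle of `T`; it is unique when `T` consists of three non-collinear
points. -/
def circumcircle (T : Finset Plane) : EuclideanGeometry.Sphere Plane :=
  @Classical.epsilon _ ⟨⟨0, 0⟩⟩
    fun s : EuclideanGeometry.Sphere Plane => (T : Set Plane) ⊆ (s : Set Plane)

/-- The radius `R(T)`. -/
def circumradius (T : Finset Plane) : ℝ := (circumcircle T).radius

/-- The open circumscribed disc `B(T)`. -/
def circumdisc (T : Finset Plane) : Set Plane :=
  Metric.ball (circumcircle T).center (circumradius T)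

/-- `T` is a Delaunay triangle of `γ`. -/
def IsDelaunay (γ : Config) (T : Finset Plane) : Prop :=
  (T : Set Plane) ⊆ γ.carrier ∧ T.card = 3 ∧ ¬ Collinear ℝ (T : Set Plane) ∧
    Disjoint (circumdisc T) γ.carrier

open Classical in
/-- The smallest length `l(T)` of the sides of `T`. -/
def minSide (T : Finset Plane) : ℝ :=
  ⨅ e : {e : Plane × Plane // e ∈ T.offDiag}, dist e.1.1 e.1.2

open Classical in
/-- The perimeter of `T` (each side occurs twice among the ordered pairs). -/
def perimeter (T : Finset Plane) : ℝ :=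
  (∑ e ∈ T.offDiag, dist e.1 e.2) / 2

open Classical in
/-- The contribution `φ(T)` of a triangle to the energy. -/
def trianglePotential (r α θ : ℝ) (T : Finset Plane) : EReal :=
  if α ≤ circumradius T ∨ minSide T ≤ r then ⊤ else ((θ * perimeter T : ℝ) : EReal)

/-- The energy `H_Λ^{α,θ}(γ)`: the sum of `φ(T)` over the Delaunay triangles `T` of `γ` with
`B(T) ∩ Λ ≠ ∅`. Among the terms there are only finitely many different from `+∞`. -/
def delaunayEnergy (r α θ : ℝ) : EnergyFamily := fun Λ γ =>
  ∑' T : {T : Finset Plane // IsDelaunay γ T ∧ (circumdisc T ∩ Λ).Nonempty},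
    trianglePotential r α θ T.1

end

noncomputable section

/-! ### Planar geometry in coordinates -/

namespace Plane

/-! The energy in a bounded window is finite exactly when every contributing Delaunay triangle is
admissible, that is, has circumradius below `α` and sides longer than `r`
(`delaunayEnergy_lt_top_iff`). Only finitely many triangles then contribute, and the energy is `θ`
times their total perimeter. S1, S2 and S4 follow at once. When a point `x` is inserted, the
triangles away from `x` cancel, so the local energy is `θ * F` if the new triangles are admissible
and `⊤` otherwise. Here `F = perimeterVariation γ x` is purely geometric: it involves neither the
window nor `α` nor `θ`. H2 follows by carrying triangles along the translation.

H3, H4 and H6′ need a uniform bound on `|F|` (`exists_perimeterVariation_le`). The disc with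
diameter from `p` to its nearest neighbour is empty, so it can be grown to the circumdisc of a
Delaunay triangle with that segment as a side. Hence the lower bound on sides separates all points
of `γ` (`lt_dist_of_delaunay`). Triangles created or destroyed at `x` have their vertices in a fixed
ball around `x`, so their number is bounded.

S3 and H5 need an event of positive probability for every stationary Gibbs measure
(`exists_isolatedTriple_event`): three points surround the origin, nearly equilateral with
circumradius close to some `ρ < a₀`, and the remaining points stay away. Their triangle is Delaunay,
its disc contains the origin, and its radius can be forced above any given `α < a₀`; this is S3.
Inserting the origin replaces it by admissible triangles of strictly larger total perimeter, so `F >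
0` and `θ` is identified; this is H5.

For the probability, stationarity makes almost every configuration meet every half-plane. With
finite energy this yields pairwise distances above `r` and a point within distance `a₀` of every
location. Inside a large ball such a configuration can be replaced by one containing the desired
triple, with both properties kept. Both properties are strict, so they survive small displacements
on the scale of the ball. This gives a set of positive Poisson measure on which the energy is
finite, and the DLR equation transfers positivity to the Gibbs measure
(`IsStationaryGibbs.measure_pos`). -/

theorem dist_sq (a b : Plane) : dist a b ^ 2 = (a 0 - b 0) ^ 2 + (a 1 - b 1) ^ 2 := by
  rw [EuclideanSpace.dist_eq, Real.sq_sqrt (by positivity), Fin.sum_univ_two, Real.dist_eq,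
    Real.dist_eq, sq_abs, sq_abs]

theorem norm_sq (a : Plane) : ‖a‖ ^ 2 = a 0 ^ 2 + a 1 ^ 2 := by
  rw [← dist_zero_right, dist_sq]; simp

theorem inner_eq (a b : Plane) : inner ℝ a b = a 0 * b 0 + a 1 * b 1 := by
  simp [PiLp.inner_apply, Fin.sum_univ_two, mul_comm]

theorem dist_eq_dist_iff {a b c d : Plane} : dist a b = dist c d ↔
    (a 0 - b 0) ^ 2 + (a 1 - b 1) ^ 2 = (c 0 - d 0) ^ 2 + (c 1 - d 1) ^ 2 := by
  rw [← dist_sq, ← dist_sq, sq_eq_sq₀ dist_nonneg dist_nonneg]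

theorem ext_iff {a b : Plane} : a = b ↔ a 0 = b 0 ∧ a 1 = b 1 := by
  constructor
  · rintro rfl; exact ⟨rfl, rfl⟩
  · rintro ⟨h0, h1⟩
    ext i
    fin_cases i
    · exact h0
    · exact h1

/-- Twice the signed area of the triangle `abc`. -/
def det (a b c : Plane) : ℝ := (b 0 - a 0) * (c 1 - a 1) - (b 1 - a 1) * (c 0 - a 0)

theorem collinear_iff_det (a b c : Plane) : Collinear ℝ {a, b, c} ↔ det a b c = 0 := by
  rw [collinear_iff_of_mem (p₀ := a) (by simp)]
  constructor
  · rintro ⟨v, hv⟩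
    obtain ⟨s, hs⟩ := hv b (by simp)
    obtain ⟨t, ht⟩ := hv c (by simp)
    rw [hs, ht]
    simp [det]
    ring
  · intro h
    unfold det at h
    by_cases hb : b = a
    · subst hb
      refine ⟨c - b, ?_⟩
      rintro p (rfl | rfl | rfl)
      · exact ⟨0, by simp⟩
      · exact ⟨0, by simp⟩
      · exact ⟨1, by simp⟩
    · refine ⟨b - a, ?_⟩
      rintro p (rfl | rfl | rfl)
      · exact ⟨0, by simp⟩
      · exact ⟨1, by simp⟩
      · by_cases h0 : b 0 - a 0 = 0
        · have h1 : b 1 - a 1 ≠ 0 := fun h1 =>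
            hb (ext_iff.2 ⟨sub_eq_zero.1 h0, sub_eq_zero.1 h1⟩)
          refine ⟨(p 1 - a 1) / (b 1 - a 1), ext_iff.2 ⟨?_, ?_⟩⟩
          · have : p 0 - a 0 = 0 := by
              rw [h0] at h; simpa [h1] using h
            simp only [vadd_eq_add, PiLp.add_apply, PiLp.smul_apply, PiLp.sub_apply, smul_eq_mul,
              h0]
            linarith
          · simp only [vadd_eq_add, PiLp.add_apply, PiLp.smul_apply, PiLp.sub_apply, smul_eq_mul]
            field_simp; ring
        · refine ⟨(p 0 - a 0) / (b 0 - a 0), ext_iff.2 ⟨?_, ?_⟩⟩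
          · simp only [vadd_eq_add, PiLp.add_apply, PiLp.smul_apply, PiLp.sub_apply, smul_eq_mul]
            field_simp; ring
          · simp only [vadd_eq_add, PiLp.add_apply, PiLp.smul_apply, PiLp.sub_apply, smul_eq_mul]
            field_simp; linarith

/-- The point equidistant from `a`, `b`, `c`. -/
def circumcenter (a b c : Plane) : Plane :=
  !₂[a 0 + ((c 1 - a 1) * ((b 0 - a 0) ^ 2 + (b 1 - a 1) ^ 2) -
        (b 1 - a 1) * ((c 0 - a 0) ^ 2 + (c 1 - a 1) ^ 2)) / (2 * det a b c),
     a 1 + ((b 0 - a 0) * ((c 0 - a 0) ^ 2 + (c 1 - a 1) ^ 2) -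
        (c 0 - a 0) * ((b 0 - a 0) ^ 2 + (b 1 - a 1) ^ 2)) / (2 * det a b c)]

theorem dist_circumcenter {a b c : Plane} (h : det a b c ≠ 0) :
    dist b (circumcenter a b c) = dist a (circumcenter a b c) ∧
      dist c (circumcenter a b c) = dist a (circumcenter a b c) := by
  simp only [dist_eq_dist_iff, circumcenter]
  have h' := h
  unfold det at h'
  simp only [Matrix.cons_val_zero, Matrix.cons_val_one]
  generalize hd : det a b c = d at *
  unfold det at hd
  constructor
  · field_simp
    subst hd
    ring
  · field_simp
    subst hd
    ring

/-- Subtracting the squared distances leaves two linear equations for `o` with determinant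
proportional to `det a b c`; this is Cramer's rule. -/
theorem eq_circumcenter {a b c o : Plane} (h : det a b c ≠ 0) (hb : dist b o = dist a o)
    (hc : dist c o = dist a o) : o = circumcenter a b c := by
  rw [dist_eq_dist_iff] at hb hc
  rw [ext_iff]
  simp only [circumcenter, PiLp.toLp_apply, Matrix.cons_val_zero, Matrix.cons_val_one]
  generalize hd : det a b c = d at *
  unfold det at hd
  constructor
  · field_simp
    subst hd
    linear_combination (-(c 1 - a 1)) * hb + (b 1 - a 1) * hc
  · field_simp
    subst hd
    linear_combination (-(b 0 - a 0)) * hc + (c 0 - a 0) * hb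

end Plane

/-! ### Delaunay triangles in explicit form: circumdisc, perimeter, sides. -/

open Plane

/-- Existence makes the chosen sphere pass through the three points, and uniqueness of the
equidistant point identifies it. The choice operator is not unfolded elsewhere. -/
theorem circumcircle_triple {a b c : Plane} (h : det a b c ≠ 0) :
    circumcircle {a, b, c} = ⟨circumcenter a b c, dist a (circumcenter a b c)⟩ := by
  have hex : ∃ s : EuclideanGeometry.Sphere Plane,
      ((({a, b, c} : Finset Plane)) : Set Plane) ⊆ (s : Set Plane) := by
    refine ⟨⟨circumcenter a b c, dist a (circumcenter a b c)⟩, ?_⟩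
    intro p hp
    simp only [Finset.coe_insert, Finset.coe_singleton, Set.mem_insert_iff,
      Set.mem_singleton_iff] at hp
    change dist p (circumcenter a b c) = dist a (circumcenter a b c)
    rcases hp with rfl | rfl | rfl
    · rfl
    · exact (dist_circumcenter h).1
    · exact (dist_circumcenter h).2
  have hs := @Classical.epsilon_spec_aux _ ⟨⟨0, 0⟩⟩ (fun s : EuclideanGeometry.Sphere Plane =>
      ((({a, b, c} : Finset Plane)) : Set Plane) ⊆ (s : Set Plane)) hex
  change ((({a, b, c} : Finset Plane)) : Set Plane) ⊆ (circumcircle {a, b, c} : Set Plane) at hs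
  have hm : ∀ p ∈ ({a, b, c} : Finset Plane),
      dist p (circumcircle {a, b, c}).center = (circumcircle {a, b, c}).radius := fun p hp =>
    EuclideanGeometry.mem_sphere.1 (hs hp)
  have ha := hm a (by simp)
  have hb := hm b (by simp)
  have hc := hm c (by simp)
  have ho := eq_circumcenter h (hb.trans ha.symm) (hc.trans ha.symm)
  ext1
  · exact ho
  · rw [← ha, ← ho]

theorem coe_triple (a b c : Plane) :
    ((({a, b, c} : Finset Plane)) : Set Plane) = {a, b, c} := by simp

theorem det_ne_zero_of_not_collinear {a b c : Plane}
    (h : ¬ Collinear ℝ ((({a, b, c} : Finset Plane)) : Set Plane)) : det a b c ≠ 0 := by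
  rwa [coe_triple, collinear_iff_det] at h

theorem Plane.ne_of_det_ne_zero {a b c : Plane} (h : det a b c ≠ 0) : a ≠ b ∧ a ≠ c ∧ b ≠ c := by
  refine ⟨?_, ?_, ?_⟩ <;> rintro rfl <;> apply h <;> unfold det <;> ring

/-- An explicit description of the Delaunay triangles. -/
structure IsEmptyTriangle (γ : Config) (a b c o : Plane) : Prop where
  det_ne : det a b c ≠ 0
  mem_a : a ∈ γ.carrier
  mem_b : b ∈ γ.carrier
  mem_c : c ∈ γ.carrier
  dist_b : dist b o = dist a o
  dist_c : dist c o = dist a o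
  le_dist : ∀ z ∈ γ.carrier, dist a o ≤ dist z o

namespace IsEmptyTriangle

variable {γ : Config} {a b c o : Plane}

theorem circumcircle_eq (h : IsEmptyTriangle γ a b c o) :
    circumcircle {a, b, c} = ⟨o, dist a o⟩ := by
  rw [circumcircle_triple h.det_ne, ← eq_circumcenter h.det_ne h.dist_b h.dist_c]

theorem circumradius_eq (h : IsEmptyTriangle γ a b c o) : circumradius {a, b, c} = dist a o := by
  rw [circumradius, h.circumcircle_eq]

theorem circumdisc_eq (h : IsEmptyTriangle γ a b c o) :
    circumdisc {a, b, c} = Metric.ball o (dist a o) := by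
  rw [circumdisc, h.circumradius_eq, h.circumcircle_eq]

theorem isDelaunay (h : IsEmptyTriangle γ a b c o) : IsDelaunay γ {a, b, c} := by
  obtain ⟨h1, h2, h3⟩ := ne_of_det_ne_zero h.det_ne
  refine ⟨?_, Finset.card_eq_three.2 ⟨a, b, c, h1, h2, h3, rfl⟩, ?_, ?_⟩
  · rw [coe_triple]
    rintro p (rfl | rfl | rfl)
    exacts [h.mem_a, h.mem_b, h.mem_c]
  · rw [coe_triple, collinear_iff_det]; exact h.det_ne
  · rw [h.circumdisc_eq, Set.disjoint_left]
    intro z hz hzγ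
    exact absurd (Metric.mem_ball.1 hz) (not_lt.2 (h.le_dist z hzγ))

theorem radius_pos (h : IsEmptyTriangle γ a b c o) : 0 < dist a o := by
  rcases (dist_nonneg (x := a) (y := o)).lt_or_eq with h0 | h0
  · exact h0
  · exfalso
    have ha : a = o := dist_eq_zero.1 h0.symm
    have hb : b = o := dist_eq_zero.1 (h.dist_b.trans h0.symm)
    exact (ne_of_det_ne_zero h.det_ne).1 (ha.trans hb.symm)

end IsEmptyTriangle

theorem IsDelaunay.isEmptyTriangle {γ : Config} {a b c : Plane}
    (h : IsDelaunay γ {a, b, c}) : IsEmptyTriangle γ a b c (circumcenter a b c) := by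
  obtain ⟨h1, h2, h3, h4⟩ := h
  have hd := det_ne_zero_of_not_collinear h3
  rw [coe_triple] at h1
  refine ⟨hd, h1 (by simp), h1 (by simp), h1 (by simp), (dist_circumcenter hd).1,
    (dist_circumcenter hd).2, fun z hz => ?_⟩
  rw [Set.disjoint_right] at h4
  have := h4 hz
  rw [circumdisc, circumradius, circumcircle_triple hd, Metric.mem_ball, not_lt] at this
  exact this

theorem IsDelaunay.exists_triple {γ : Config} {T : Finset Plane} (h : IsDelaunay γ T) :
    ∃ a b c o, T = {a, b, c} ∧ IsEmptyTriangle γ a b c o := by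
  obtain ⟨a, b, c, -, -, -, rfl⟩ := Finset.card_eq_three.1 h.2.1
  exact ⟨a, b, c, _, rfl, h.isEmptyTriangle⟩

theorem IsDelaunay.exists_triple_of_mem {γ : Config} {T : Finset Plane} (h : IsDelaunay γ T)
    {x : Plane} (hx : x ∈ T) : ∃ b c o, T = {x, b, c} ∧ IsEmptyTriangle γ x b c o := by
  obtain ⟨a, b, c, -, -, -, rfl⟩ := Finset.card_eq_three.1 h.2.1
  simp only [Finset.mem_insert, Finset.mem_singleton] at hx
  rcases hx with rfl | rfl | rfl
  · exact ⟨b, c, _, rfl, h.isEmptyTriangle⟩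
  · have : ({a, x, c} : Finset Plane) = {x, a, c} := Finset.insert_comm _ _ _
    rw [this] at h ⊢
    exact ⟨a, c, _, rfl, h.isEmptyTriangle⟩
  · have : ({a, b, x} : Finset Plane) = {x, a, b} := by
      rw [Finset.insert_comm x a, Finset.pair_comm x b]
    rw [this] at h ⊢
    exact ⟨a, b, _, rfl, h.isEmptyTriangle⟩

theorem IsDelaunay.circumradius_pos {γ : Config} {T : Finset Plane} (h : IsDelaunay γ T) :
    0 < circumradius T := by
  obtain ⟨a, b, c, o, rfl, ht⟩ := h.exists_triple
  rw [ht.circumradius_eq]; exact ht.radius_pos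

theorem IsDelaunay.dist_center {γ : Config} {T : Finset Plane} (h : IsDelaunay γ T) {p : Plane}
    (hp : p ∈ T) : dist p (circumcircle T).center = circumradius T := by
  obtain ⟨b, c, o, rfl, ht⟩ := h.exists_triple_of_mem hp
  rw [ht.circumradius_eq, ht.circumcircle_eq]

theorem IsDelaunay.dist_le {γ : Config} {T : Finset Plane} (h : IsDelaunay γ T) {p q : Plane}
    (hp : p ∈ T) (hq : q ∈ T) : dist p q ≤ 2 * circumradius T := by
  have := dist_triangle_right p q (circumcircle T).center
  rw [h.dist_center hp, h.dist_center hq] at this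
  linarith

open Classical in
theorem perimeter_nonneg (T : Finset Plane) : 0 ≤ perimeter T := by
  unfold perimeter
  have : 0 ≤ ∑ e ∈ T.offDiag, dist e.1 e.2 := Finset.sum_nonneg fun _ _ => dist_nonneg
  linarith

theorem IsDelaunay.perimeter_le {γ : Config} {T : Finset Plane} (h : IsDelaunay γ T) :
    perimeter T ≤ 6 * circumradius T := by
  classical
  have h1 : ∑ e ∈ T.offDiag, dist e.1 e.2 ≤ T.offDiag.card • (2 * circumradius T) := by
    refine Finset.sum_le_card_nsmul _ _ _ fun e he => ?_
    rw [Finset.mem_offDiag] at he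
    exact h.dist_le he.1 he.2.1
  have h2 : T.offDiag.card = 6 := by rw [Finset.offDiag_card, h.2.1]
  rw [h2, nsmul_eq_mul] at h1
  have : perimeter T = (∑ e ∈ T.offDiag, dist e.1 e.2) / 2 := by
    unfold perimeter; congr!
  rw [this]
  push_cast at h1
  linarith

theorem perimeter_triple {a b c : Plane} (h1 : a ≠ b) (h2 : a ≠ c) (h3 : b ≠ c) :
    perimeter {a, b, c} = dist a b + dist b c + dist a c := by
  classical
  have : perimeter {a, b, c} = (∑ e ∈ ({a, b, c} : Finset Plane).offDiag, dist e.1 e.2) / 2 := by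
    unfold perimeter; congr!
  have hoff : ({a, b, c} : Finset Plane).offDiag =
      {(a, b), (b, a), (b, c), (c, b), (a, c), (c, a)} := by
    ext ⟨p, q⟩
    simp only [Finset.mem_offDiag, Finset.mem_insert, Finset.mem_singleton, Prod.mk.injEq]
    constructor
    · rintro ⟨rfl | rfl | rfl, rfl | rfl | rfl, h⟩ <;> simp_all
    · rintro (⟨rfl, rfl⟩ | ⟨rfl, rfl⟩ | ⟨rfl, rfl⟩ | ⟨rfl, rfl⟩ | ⟨rfl, rfl⟩ | ⟨rfl, rfl⟩) <;>
        simp_all [eq_comm]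
  rw [this, hoff, Finset.sum_insert (by simp_all [eq_comm]), Finset.sum_insert (by simp_all [eq_comm]),
    Finset.sum_insert (by simp_all [eq_comm]), Finset.sum_insert (by simp_all [eq_comm]),
    Finset.sum_insert (by simp_all [eq_comm]), Finset.sum_singleton]
  simp only [dist_comm b a, dist_comm c b, dist_comm c a]
  ring

/-- Three vertices make the index type finite and nonempty, so the infimum is attained. Over an
empty type the real infimum would be `0`. -/
theorem lt_minSide_iff {r : ℝ} {T : Finset Plane} (hT : T.card = 3) :
    r < minSide T ↔ ∀ p ∈ T, ∀ q ∈ T, p ≠ q → r < dist p q := by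
  classical
  obtain ⟨a, b, c, h1, h2, h3, rfl⟩ := Finset.card_eq_three.1 hT
  set T : Finset Plane := {a, b, c} with hT
  have hfin : Finite {e : Plane × Plane // e ∈ T.offDiag} := inferInstance
  have hne : Nonempty {e : Plane × Plane // e ∈ T.offDiag} :=
    ⟨⟨(a, b), by simp [hT, h1]⟩⟩
  have hms : minSide T = ⨅ e : {e : Plane × Plane // e ∈ T.offDiag}, dist e.1.1 e.1.2 := by
    unfold minSide; congr!
  rw [hms]
  constructor
  · intro h p hp q hq hpq
    exact h.trans_le (ciInf_le (f := fun e : {e : Plane × Plane // e ∈ T.offDiag} =>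
      dist e.1.1 e.1.2) (Set.finite_range _).bddBelow
      ⟨(p, q), Finset.mem_offDiag.2 ⟨hp, hq, hpq⟩⟩)
  · intro h
    obtain ⟨e, he⟩ := exists_eq_ciInf_of_finite
      (f := fun e : {e : Plane × Plane // e ∈ T.offDiag} => dist e.1.1 e.1.2)
    rw [← he]
    have := Finset.mem_offDiag.1 e.2
    exact h _ this.1 _ this.2.1 this.2.2

theorem finite_delaunay (γ : Config) (α : ℝ) {Λ : Set Plane} (hΛ : Bornology.IsBounded Λ) :
    {T | IsDelaunay γ T ∧ circumradius T < α ∧ (circumdisc T ∩ Λ).Nonempty}.Finite := by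
  obtain ⟨M, hM⟩ := hΛ.subset_closedBall 0
  -- A vertex of a triangle of radius less than `α` is within `2 * α` of any point of its disc, in
  -- particular of a point of `Λ`.
  have hf := γ.locallyFinite (Metric.closedBall 0 (M + 2 * α)) Metric.isBounded_closedBall
  refine hf.toFinset.powerset.finite_toSet.subset ?_
  rintro T ⟨hT, hR, z, hz, hzΛ⟩
  simp only [Finset.coe_powerset, Set.mem_preimage, Set.mem_powerset_iff]
  intro p hp
  rw [Set.Finite.coe_toFinset]
  refine ⟨hT.1 hp, ?_⟩
  have h1 := hT.dist_center hp
  have h2 : dist z (circumcircle T).center < circumradius T := hz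
  have h3 : dist z 0 ≤ M := hM hzΛ
  have h4 := dist_triangle4 p (circumcircle T).center z 0
  rw [dist_comm _ z] at h4
  rw [Metric.mem_closedBall]
  linarith

/-! ### Translations -/

theorem Config.mem_translate {γ : Config} {y z : Plane} :
    z ∈ (γ.translate y).carrier ↔ z - y ∈ γ.carrier := by
  constructor
  · rintro ⟨w, hw, rfl⟩; simpa using hw
  · intro h; exact ⟨z - y, h, by simp⟩

theorem Config.translate_neg_translate (γ : Config) (y : Plane) :
    (γ.translate y).translate (-y) = γ := by
  ext z
  simp [Config.mem_translate]

theorem IsEmptyTriangle.translate {γ : Config} {a b c o : Plane} (h : IsEmptyTriangle γ a b c o)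
    (y : Plane) : IsEmptyTriangle (γ.translate y) (a + y) (b + y) (c + y) (o + y) where
  det_ne := by
    have : det (a + y) (b + y) (c + y) = det a b c := by simp [det]
    rw [this]; exact h.det_ne
  mem_a := by simpa [Config.mem_translate] using h.mem_a
  mem_b := by simpa [Config.mem_translate] using h.mem_b
  mem_c := by simpa [Config.mem_translate] using h.mem_c
  dist_b := by simpa using h.dist_b
  dist_c := by simpa using h.dist_c
  le_dist := by
    intro z hz
    have := h.le_dist _ (Config.mem_translate.1 hz)
    have h2 : dist (z - y) o = dist z (o + y) := by
      rw [← dist_add_right _ _ y, sub_add_cancel]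
    rwa [dist_add_right, ← h2]

theorem map_triple (a b c y : Plane) :
    ({a, b, c} : Finset Plane).map (addRightEmbedding y) = {a + y, b + y, c + y} := by
  simp [Finset.map_insert]

theorem IsDelaunay.translate {γ : Config} {T : Finset Plane} (h : IsDelaunay γ T) (y : Plane) :
    IsDelaunay (γ.translate y) (T.map (addRightEmbedding y)) ∧
      circumradius (T.map (addRightEmbedding y)) = circumradius T ∧
      circumdisc (T.map (addRightEmbedding y)) = (fun z => z - y) ⁻¹' circumdisc T ∧
      perimeter (T.map (addRightEmbedding y)) = perimeter T ∧
      ∀ r, r < minSide (T.map (addRightEmbedding y)) ↔ r < minSide T := by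
  have hcard := h.2.1
  obtain ⟨a, b, c, o, rfl, ht⟩ := h.exists_triple
  obtain ⟨h1, h2, h3⟩ := ne_of_det_ne_zero ht.det_ne
  have ht' := ht.translate y
  rw [map_triple]
  refine ⟨ht'.isDelaunay, ?_, ?_, ?_, ?_⟩
  · rw [ht.circumradius_eq, ht'.circumradius_eq, dist_add_right]
  · rw [ht.circumdisc_eq, ht'.circumdisc_eq, dist_add_right]
    ext z
    have h2 : dist (z - y) o = dist z (o + y) := by
      rw [← dist_add_right _ _ y, sub_add_cancel]
    simp [h2]
  · rw [perimeter_triple h1 h2 h3, perimeter_triple (by simpa) (by simpa) (by simpa)]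
    simp
  · intro r
    rw [lt_minSide_iff ht'.isDelaunay.2.1, lt_minSide_iff hcard]
    simp

end

noncomputable section

open Plane

/-! ### Energies -/

/-- The Delaunay triangles that contribute to the energy in `Λ`. -/
def delaunayTriangles (γ : Config) (Λ : Set Plane) : Set (Finset Plane) :=
  {T | IsDelaunay γ T ∧ (circumdisc T ∩ Λ).Nonempty}

/-- The triangles with finite potential. -/
def IsAdmissible (r α : ℝ) (T : Finset Plane) : Prop :=
  circumradius T < α ∧ r < minSide T

theorem IsAdmissible.mono {r α α' : ℝ} (h : α ≤ α') {T : Finset Plane} (hT : IsAdmissible r α T) :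
    IsAdmissible r α' T := ⟨hT.1.trans_le h, hT.2⟩

theorem trianglePotential_of_admissible {r α θ : ℝ} {T : Finset Plane} (h : IsAdmissible r α T) :
    trianglePotential r α θ T = ((θ * perimeter T : ℝ) : EReal) := by
  unfold trianglePotential
  rw [if_neg]
  rw [not_or, not_le, not_le]
  exact h

theorem trianglePotential_of_not_admissible {r α θ : ℝ} {T : Finset Plane}
    (h : ¬ IsAdmissible r α T) : trianglePotential r α θ T = ⊤ := by
  unfold trianglePotential
  rw [if_pos]
  rwa [IsAdmissible, not_and_or, not_lt, not_lt] at h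

theorem trianglePotential_ne_bot (r α θ : ℝ) (T : Finset Plane) :
    trianglePotential r α θ T ≠ ⊥ := by
  by_cases h : IsAdmissible r α T
  · rw [trianglePotential_of_admissible h]; exact EReal.coe_ne_bot _
  · rw [trianglePotential_of_not_admissible h]; exact top_ne_bot

theorem EReal.finset_sum_ne_bot {ι : Type*} {f : ι → EReal} (hf : ∀ i, f i ≠ ⊥) (s : Finset ι) :
    ∑ i ∈ s, f i ≠ ⊥ := by
  classical
  induction s using Finset.induction_on with
  | empty => simp
  | insert a s ha ih =>
    rw [Finset.sum_insert ha]
    rw [Ne, EReal.add_eq_bot_iff, not_or]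
    exact ⟨hf a, ih⟩

/-- Without terms `⊥`, each finite partial sum containing `i` equals `⊤`, so the net of partial sums
is eventually constant. -/
theorem EReal.tsum_eq_top {ι : Type*} {f : ι → EReal} (hf : ∀ i, f i ≠ ⊥) {i : ι} (hi : f i = ⊤) :
    ∑' i, f i = ⊤ := by
  classical
  refine HasSum.tsum_eq ?_
  refine tendsto_const_nhds.congr' ?_
  filter_upwards [eventually_ge_atTop ({i} : Finset ι)] with s hs
  rw [← Finset.add_sum_erase s f (hs (Finset.mem_singleton_self i)), hi,
    EReal.top_add_of_ne_bot (EReal.finset_sum_ne_bot hf _)]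

theorem EReal.coe_finset_sum {ι : Type*} (f : ι → ℝ) (s : Finset ι) :
    ((∑ i ∈ s, f i : ℝ) : EReal) = ∑ i ∈ s, (f i : EReal) := by
  classical
  induction s using Finset.induction_on with
  | empty => simp
  | insert a s ha ih => rw [Finset.sum_insert ha, Finset.sum_insert ha, EReal.coe_add, ih]

theorem finite_delaunayTriangles {r α : ℝ} {γ : Config} {Λ : Set Plane}
    (hΛ : Bornology.IsBounded Λ) (h : ∀ T ∈ delaunayTriangles γ Λ, IsAdmissible r α T) :
    (delaunayTriangles γ Λ).Finite :=
  (finite_delaunay γ α hΛ).subset fun T hT => ⟨hT.1, (h T hT).1, hT.2⟩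

theorem delaunayEnergy_eq_top {r α θ : ℝ} {γ : Config} {Λ : Set Plane} {T : Finset Plane}
    (hT : T ∈ delaunayTriangles γ Λ) (h : ¬ IsAdmissible r α T) :
    delaunayEnergy r α θ Λ γ = ⊤ :=
  EReal.tsum_eq_top (fun _ => trianglePotential_ne_bot _ _ _ _) (i := ⟨T, hT⟩)
    (trianglePotential_of_not_admissible h)

/-- Admissibility bounds the radii and hence leaves finitely many triangles. The formula separates
`θ` from the geometry. -/
theorem delaunayEnergy_eq {r α θ : ℝ} {γ : Config} {Λ : Set Plane}
    (hΛ : Bornology.IsBounded Λ) (h : ∀ T ∈ delaunayTriangles γ Λ, IsAdmissible r α T) :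
    delaunayEnergy r α θ Λ γ =
      ((θ * ∑ᶠ T ∈ delaunayTriangles γ Λ, perimeter T : ℝ) : EReal) := by
  have hfin := finite_delaunayTriangles hΛ h
  have : Fintype (delaunayTriangles γ Λ) := hfin.fintype
  change ∑' T : delaunayTriangles γ Λ, trianglePotential r α θ T.1 = _
  rw [tsum_fintype, finsum_mem_eq_finite_toFinset_sum _ hfin, Finset.mul_sum, EReal.coe_finset_sum]
  rw [← Finset.sum_coe_sort hfin.toFinset]
  let e : delaunayTriangles γ Λ ≃ hfin.toFinset :=
    Equiv.subtypeEquivRight fun T => hfin.mem_toFinset.symm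
  exact Fintype.sum_equiv e (fun T => trianglePotential r α θ T.1)
    (fun T => ((θ * perimeter T.1 : ℝ) : EReal))
    fun T => trianglePotential_of_admissible (h T.1 T.2)

/-- The right-hand side is free of `θ`, monotone in `α`, and when it holds it concerns finitely many
triangles: these three facts are S1, S2 and S4. -/
theorem delaunayEnergy_lt_top_iff {r α θ : ℝ} {γ : Config} {Λ : Set Plane}
    (hΛ : Bornology.IsBounded Λ) :
    delaunayEnergy r α θ Λ γ < ⊤ ↔ ∀ T ∈ delaunayTriangles γ Λ, IsAdmissible r α T := by
  constructor
  · intro h T hT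
    by_contra hn
    exact h.ne (delaunayEnergy_eq_top hT hn)
  · intro h
    rw [delaunayEnergy_eq hΛ h]
    exact EReal.coe_lt_top _

theorem assumptionS1_delaunayEnergy (r : ℝ) (Θ : Set ℝ) : AssumptionS1 Θ (delaunayEnergy r) := by
  intro γ α _ θ _ θ' _ Λ hΛ
  rw [delaunayEnergy_lt_top_iff hΛ.1, delaunayEnergy_lt_top_iff hΛ.1]

theorem assumptionS2_delaunayEnergy (r : ℝ) (Θ : Set ℝ) : AssumptionS2 Θ (delaunayEnergy r) := by
  intro γ α α' _ _ θ _ Λ hΛ hαα'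
  rw [delaunayEnergy_lt_top_iff hΛ.1, delaunayEnergy_lt_top_iff hΛ.1]
  exact fun h T hT => (h T hT).mono hαα'

theorem assumptionS4_delaunayEnergy (r : ℝ) (Θ : Set ℝ) : AssumptionS4 Θ (delaunayEnergy r) := by
  intro γ Λ hΛ θ _ α' hα' h
  rw [delaunayEnergy_lt_top_iff hΛ.1] at h
  have hfin := finite_delaunayTriangles hΛ.1 h
  obtain ⟨m, hm, hm'⟩ : ∃ m < α', ∀ T ∈ delaunayTriangles γ Λ, circumradius T ≤ m := by
    rcases (delaunayTriangles γ Λ).eq_empty_or_nonempty with he | hne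
    · exact ⟨0, hα', by simp [he]⟩
    · obtain ⟨T, hT, hmax⟩ := Set.exists_max_image _ circumradius hfin hne
      exact ⟨circumradius T, (h T hT).1, hmax⟩
  -- Any `α` strictly between the largest radius and `α'` works; the maximum with `0` keeps it
  -- positive.
  have hlt : max m 0 < α' := max_lt hm hα'
  obtain ⟨α, h1, h2⟩ := exists_between hlt
  refine ⟨α, (le_max_right _ _).trans_lt h1, h2, ?_⟩
  rw [delaunayEnergy_lt_top_iff hΛ.1]
  exact fun T hT => ⟨(hm' T hT).trans_lt ((le_max_left _ _).trans_lt h1), (h T hT).2⟩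

/-! ### The local energy -/

/-- The Delaunay triangles created by the insertion of `x`. -/
def newTriangles (γ : Config) (x : Plane) : Set (Finset Plane) :=
  {T | IsDelaunay (γ.addPoint x) T ∧ x ∈ T}

/-- The Delaunay triangles destroyed by the insertion of `x`. -/
def oldTriangles (γ : Config) (x : Plane) : Set (Finset Plane) :=
  {T | IsDelaunay γ T ∧ x ∈ circumdisc T}

/-- The variation of the total perimeter when `x` is inserted. -/
def perimeterVariation (γ : Config) (x : Plane) : ℝ :=
  ∑ᶠ T ∈ newTriangles γ x, perimeter T - ∑ᶠ T ∈ oldTriangles γ x, perimeter T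

theorem IsDelaunay.mem_or_of_addPoint {γ : Config} {x : Plane} {T : Finset Plane}
    (h : IsDelaunay (γ.addPoint x) T) : x ∈ T ∨ (IsDelaunay γ T ∧ x ∉ circumdisc T) := by
  refine or_iff_not_imp_left.2 fun hx => ⟨⟨?_, h.2.1, h.2.2.1, ?_⟩, ?_⟩
  · intro z hz
    exact (h.1 hz).resolve_left fun hzx => hx (by rw [← hzx]; exact hz)
  · exact h.2.2.2.mono_right (Set.subset_insert _ _)
  · exact Set.disjoint_right.1 h.2.2.2 (Set.mem_insert _ _)

theorem IsDelaunay.addPoint {γ : Config} {x : Plane} {T : Finset Plane}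
    (h : IsDelaunay γ T) (hx : x ∉ circumdisc T) : IsDelaunay (γ.addPoint x) T := by
  refine ⟨h.1.trans (Set.subset_insert _ _), h.2.1, h.2.2.1, ?_⟩
  exact Set.disjoint_insert_right.2 ⟨hx, h.2.2.2⟩

/-- The vertex `x` lies only on the boundary of the open disc, hence in its closure. This is why
windows have to be neighbourhoods of `x`. -/
theorem IsDelaunay.circumdisc_inter_nonempty {γ : Config} {T : Finset Plane} (h : IsDelaunay γ T)
    {x : Plane} (hx : x ∈ T) {Λ : Set Plane} (hΛ : Λ ∈ 𝓝 x) : (circumdisc T ∩ Λ).Nonempty := by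
  have hcl : x ∈ closure (circumdisc T) := by
    rw [circumdisc, closure_ball _ h.circumradius_pos.ne', Metric.mem_closedBall, h.dist_center hx]
  rw [Set.inter_comm]
  exact mem_closure_iff_nhds.1 hcl Λ hΛ

/-- A triangle without vertex `x` survives exactly when its disc misses `x`. Removing `{T | x ∈ T}`
has an effect only if `x` already belongs to `γ`. -/
theorem delaunayTriangles_addPoint {γ : Config} {x : Plane} {Λ : Set Plane} (hΛ : Λ ∈ 𝓝 x) :
    delaunayTriangles (γ.addPoint x) Λ =
      newTriangles γ x ∪ (delaunayTriangles γ Λ \ oldTriangles γ x) \ {T | x ∈ T} := by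
  ext T
  constructor
  · rintro ⟨hT, hne⟩
    by_cases hx : x ∈ T
    · exact Or.inl ⟨hT, hx⟩
    · have := hT.mem_or_of_addPoint.resolve_left hx
      exact Or.inr ⟨⟨⟨this.1, hne⟩, fun h => this.2 h.2⟩, hx⟩
  · rintro (⟨hT, hx⟩ | ⟨⟨⟨hT, hne⟩, ho⟩, -⟩)
    · exact ⟨hT, hT.circumdisc_inter_nonempty hx hΛ⟩
    · exact ⟨hT.addPoint fun h => ho ⟨hT, h⟩, hne⟩

theorem oldTriangles_subset {γ : Config} {x : Plane} {Λ : Set Plane} (hΛ : Λ ∈ 𝓝 x) :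
    oldTriangles γ x ⊆ delaunayTriangles γ Λ :=
  fun _ hT => ⟨hT.1, x, hT.2, mem_of_mem_nhds hΛ⟩

theorem newTriangles_subset {γ : Config} {x : Plane} {Λ : Set Plane} (hΛ : Λ ∈ 𝓝 x) :
    newTriangles γ x ⊆ delaunayTriangles (γ.addPoint x) Λ := by
  rw [delaunayTriangles_addPoint hΛ]; exact Set.subset_union_left

section
variable {r α θ : ℝ} {γ : Config} {x : Plane} {Λ : Set Plane}

theorem forall_admissible_addPoint (hΛ : Λ ∈ 𝓝 x)
    (h : ∀ T ∈ delaunayTriangles γ Λ, IsAdmissible r α T)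
    (hnew : ∀ T ∈ newTriangles γ x, IsAdmissible r α T) :
    ∀ T ∈ delaunayTriangles (γ.addPoint x) Λ, IsAdmissible r α T := by
  rw [delaunayTriangles_addPoint hΛ]
  rintro T (hT | hT)
  · exact hnew T hT
  · exact h T hT.1.1

/-- The surviving triangles cancel, and what remains no longer mentions `Λ`. -/
theorem finsum_addPoint_sub (hx : x ∉ γ.carrier) (hΛb : Bornology.IsBounded Λ)
    (hΛ : Λ ∈ 𝓝 x) (h : ∀ T ∈ delaunayTriangles γ Λ, IsAdmissible r α T)
    (hnew : ∀ T ∈ newTriangles γ x, IsAdmissible r α T) :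
    ∑ᶠ T ∈ delaunayTriangles (γ.addPoint x) Λ, perimeter T -
      ∑ᶠ T ∈ delaunayTriangles γ Λ, perimeter T = perimeterVariation γ x := by
  have hf := finite_delaunayTriangles hΛb h
  have hf' := finite_delaunayTriangles hΛb (forall_admissible_addPoint hΛ h hnew)
  have hmem : (delaunayTriangles γ Λ \ oldTriangles γ x) \ {T | x ∈ T} =
      delaunayTriangles γ Λ \ oldTriangles γ x :=
    sdiff_eq_left.2 (Set.disjoint_left.2 fun T hT hT' => hx (hT.1.1.1 hT'))
  have hdisj : Disjoint (newTriangles γ x) (delaunayTriangles γ Λ \ oldTriangles γ x) :=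
    Set.disjoint_left.2 fun T hT hT' => hx (hT'.1.1.1 hT.2)
  have e1 : delaunayTriangles (γ.addPoint x) Λ =
      newTriangles γ x ∪ (delaunayTriangles γ Λ \ oldTriangles γ x) := by
    rw [delaunayTriangles_addPoint hΛ, hmem]
  rw [e1, finsum_mem_union hdisj (hf'.subset (newTriangles_subset hΛ)) hf.sdiff,
    ← finsum_mem_inter_add_sdiff (oldTriangles γ x) hf,
    Set.inter_eq_self_of_subset_right (oldTriangles_subset hΛ), perimeterVariation]
  ring

theorem delaunayEnergy_addPoint_sub (hx : x ∉ γ.carrier) (hΛb : Bornology.IsBounded Λ)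
    (hΛ : Λ ∈ 𝓝 x) (h : delaunayEnergy r α θ Λ γ < ⊤)
    (hnew : ∀ T ∈ newTriangles γ x, IsAdmissible r α T) :
    delaunayEnergy r α θ Λ (γ.addPoint x) - delaunayEnergy r α θ Λ γ =
      ((θ * perimeterVariation γ x : ℝ) : EReal) := by
  rw [delaunayEnergy_lt_top_iff hΛb] at h
  rw [delaunayEnergy_eq hΛb h, delaunayEnergy_eq hΛb (forall_admissible_addPoint hΛ h hnew),
    ← EReal.coe_sub, ← mul_sub, finsum_addPoint_sub hx hΛb hΛ h hnew]

theorem delaunayEnergy_addPoint_sub_eq_top (hΛb : Bornology.IsBounded Λ)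
    (hΛ : Λ ∈ 𝓝 x) (h : delaunayEnergy r α θ Λ γ < ⊤)
    (hnew : ¬ ∀ T ∈ newTriangles γ x, IsAdmissible r α T) :
    delaunayEnergy r α θ Λ (γ.addPoint x) - delaunayEnergy r α θ Λ γ = ⊤ := by
  rw [delaunayEnergy_lt_top_iff hΛb] at h
  push Not at hnew
  obtain ⟨T, hT, hT'⟩ := hnew
  rw [delaunayEnergy_eq hΛb h, delaunayEnergy_eq_top (newTriangles_subset hΛ hT) hT']
  exact EReal.top_sub_coe _

/-- The local energy does not depend on the window. -/
theorem localEnergy_eq_sub (hx : x ∉ γ.carrier) (hΛb : IsBoundedBorel Λ) (hΛ : Λ ∈ 𝓝 x)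
    (h : delaunayEnergy r α θ Λ γ < ⊤) :
    localEnergy (delaunayEnergy r α θ) x γ =
      delaunayEnergy r α θ Λ (γ.addPoint x) - delaunayEnergy r α θ Λ γ := by
  have hex : ∃ Λ, IsBoundedBorel Λ ∧ Λ ∈ 𝓝 x ∧ delaunayEnergy r α θ Λ γ < ⊤ := ⟨Λ, hΛb, hΛ, h⟩
  rw [localEnergy, dif_pos hex]
  obtain ⟨h1, h2, h3⟩ := hex.choose_spec
  by_cases hnew : ∀ T ∈ newTriangles γ x, IsAdmissible r α T
  · rw [delaunayEnergy_addPoint_sub hx h1.1 h2 h3 hnew,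
      delaunayEnergy_addPoint_sub hx hΛb.1 hΛ h hnew]
  · rw [delaunayEnergy_addPoint_sub_eq_top h1.1 h2 h3 hnew,
      delaunayEnergy_addPoint_sub_eq_top hΛb.1 hΛ h hnew]

theorem localEnergy_of_admissible (hx : x ∉ γ.carrier) (hΛb : IsBoundedBorel Λ) (hΛ : Λ ∈ 𝓝 x)
    (h : delaunayEnergy r α θ Λ γ < ⊤)
    (hnew : ∀ T ∈ newTriangles γ x, IsAdmissible r α T) :
    localEnergy (delaunayEnergy r α θ) x γ = ((θ * perimeterVariation γ x : ℝ) : EReal) := by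
  rw [localEnergy_eq_sub hx hΛb hΛ h, delaunayEnergy_addPoint_sub hx hΛb.1 hΛ h hnew]

theorem localEnergy_of_not_admissible (hx : x ∉ γ.carrier) (hΛb : IsBoundedBorel Λ)
    (hΛ : Λ ∈ 𝓝 x) (h : delaunayEnergy r α θ Λ γ < ⊤)
    (hnew : ¬ ∀ T ∈ newTriangles γ x, IsAdmissible r α T) :
    localEnergy (delaunayEnergy r α θ) x γ = ⊤ := by
  rw [localEnergy_eq_sub hx hΛb hΛ h, delaunayEnergy_addPoint_sub_eq_top hΛb.1 hΛ h hnew]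

end

/-! ### Removable points and translation invariance. -/

theorem Config.removePoint_addPoint {γ : Config} {x : Plane} (hx : x ∉ γ.carrier) :
    (γ.addPoint x).removePoint x = γ := by
  ext z
  simp only [Config.removePoint, Config.addPoint, Set.mem_sdiff, Set.mem_insert_iff,
    Set.mem_singleton_iff]
  constructor
  · rintro ⟨h | h, hz⟩
    · exact absurd h hz
    · exact h
  · intro h
    exact ⟨Or.inr h, fun hz => hx (hz ▸ h)⟩

theorem mem_removablePoints_addPoint {H : EnergyFamily} {γ : Config} {x : Plane}
    (hx : x ∉ γ.carrier) : x ∈ removablePoints H (γ.addPoint x) ↔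
      ∃ Λ, IsBoundedBorel Λ ∧ Λ ∈ 𝓝 x ∧ H Λ γ < ⊤ := by
  rw [removablePoints, Set.mem_ofPred_eq, Config.removePoint_addPoint hx]
  exact and_iff_right (Set.mem_insert _ _)

theorem Config.translate_addPoint (γ : Config) (x y : Plane) :
    (γ.translate y).addPoint (x + y) = (γ.addPoint x).translate y := by
  ext z
  rw [mem_translate]
  simp only [addPoint, Set.mem_insert_iff, mem_translate, sub_eq_iff_eq_add]

theorem image_mem_delaunayTriangles {γ : Config} {Λ : Set Plane} {T : Finset Plane}
    (hT : T ∈ delaunayTriangles γ Λ) (y : Plane) :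
    T.map (addRightEmbedding y) ∈ delaunayTriangles (γ.translate y) ((fun z => z - y) ⁻¹' Λ) := by
  have h := hT.1.translate y
  refine ⟨h.1, ?_⟩
  rw [h.2.2.1]
  obtain ⟨z, hz, hz'⟩ := hT.2
  exact ⟨z + y, by simpa using hz, by simpa using hz'⟩

theorem delaunayEnergy_translate (r α θ : ℝ) (γ : Config) (Λ : Set Plane) (y : Plane) :
    delaunayEnergy r α θ ((fun z => z - y) ⁻¹' Λ) (γ.translate y) = delaunayEnergy r α θ Λ γ := by
  have hback : ∀ (y : Plane) (T : Finset Plane),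
      (T.map (addRightEmbedding y)).map (addRightEmbedding (-y)) = T := by
    intro y T
    rw [Finset.map_map]
    convert Finset.map_refl using 2
    ext z : 1
    simp
  let e : delaunayTriangles γ Λ ≃ delaunayTriangles (γ.translate y) ((fun z => z - y) ⁻¹' Λ) :=
    { toFun := fun T => ⟨_, image_mem_delaunayTriangles T.2 y⟩
      invFun := fun T => ⟨T.1.map (addRightEmbedding (-y)), by
        have := image_mem_delaunayTriangles T.2 (-y)
        rw [Config.translate_neg_translate] at this
        convert this using 2
        ext z
        simp⟩
      left_inv := fun T => Subtype.ext (hback y T.1)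
      right_inv := fun T => Subtype.ext (by simpa using hback (-y) T.1) }
  change ∑' T : delaunayTriangles (γ.translate y) ((fun z => z - y) ⁻¹' Λ),
    trianglePotential r α θ T.1 = ∑' T : delaunayTriangles γ Λ, trianglePotential r α θ T.1
  rw [← e.tsum_eq]
  refine tsum_congr fun T => ?_
  change trianglePotential r α θ (T.1.map (addRightEmbedding y)) = _
  obtain ⟨-, h1, -, h2, h3⟩ := T.2.1.translate y
  have hadm : IsAdmissible r α (T.1.map (addRightEmbedding y)) ↔ IsAdmissible r α T.1 := by
    rw [IsAdmissible, IsAdmissible, h1, h3]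
  by_cases h : IsAdmissible r α T.1
  · rw [trianglePotential_of_admissible h, trianglePotential_of_admissible (hadm.2 h), h2]
  · rw [trianglePotential_of_not_admissible h,
      trianglePotential_of_not_admissible (fun h' => h (hadm.1 h'))]

theorem assumptionH2_delaunayEnergy (r : ℝ) (Θ : Set ℝ) : AssumptionH2 Θ (delaunayEnergy r) := by
  intro α _ θ _ x y γ hx hrem
  rw [mem_removablePoints_addPoint hx] at hrem
  obtain ⟨Λ, hΛ, hΛx, hfin⟩ := hrem
  have hxy : x + y ∉ (γ.translate y).carrier := by rwa [Config.mem_translate, add_sub_cancel_right]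
  have hcont : Continuous fun z : Plane => z - y := by fun_prop
  have hΛ' : IsBoundedBorel ((fun z => z - y) ⁻¹' Λ) := by
    refine ⟨?_, hcont.measurable hΛ.2⟩
    have := (LipschitzWith.id.add (LipschitzWith.const y)).isBounded_image hΛ.1
    refine this.subset fun z hz => ⟨z - y, hz, by simp⟩
  have hnhds : (fun z => z - y) ⁻¹' Λ ∈ 𝓝 (x + y) :=
    hcont.continuousAt.preimage_mem_nhds (by simpa using hΛx)
  have hfin' : delaunayEnergy r α θ ((fun z => z - y) ⁻¹' Λ) (γ.translate y) < ⊤ := by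
    rwa [delaunayEnergy_translate]
  refine ⟨(mem_removablePoints_addPoint hxy).2 ⟨_, hΛ', hnhds, hfin'⟩, ?_⟩
  rw [localEnergy_eq_sub hxy hΛ' hnhds hfin', localEnergy_eq_sub hx hΛ hΛx hfin,
    Config.translate_addPoint, delaunayEnergy_translate, delaunayEnergy_translate]

end

noncomputable section

open Plane

/-! ### Growing empty discs -/

/-- Along a line of centres the difference of two squared distances is affine in `t`, so the time at
which the circle through `p` reaches `z` solves a linear equation. -/
theorem Plane.dist_sq_sub_dist_sq (p z o e : Plane) (t : ℝ) :
    dist z (o + t • e) ^ 2 - dist p (o + t • e) ^ 2 =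
      (dist z o ^ 2 - dist p o ^ 2) - 2 * t * inner ℝ e (z - p) := by
  simp only [dist_sq, inner_eq, PiLp.add_apply, PiLp.smul_apply, PiLp.sub_apply, smul_eq_mul]
  ring

/-- An empty disc with `p` on its boundary can be moved in the direction `e`, keeping `p` on the
boundary, until it hits a further point. -/
theorem exists_grown_disc {γ : Config} {p o e z₀ : Plane}
    (hmin : ∀ z ∈ γ.carrier, dist p o ≤ dist z o) (hz₀ : z₀ ∈ γ.carrier)
    (hpos : 0 < inner ℝ e (z₀ - p)) :
    ∃ t : ℝ, 0 ≤ t ∧ ∃ s ∈ γ.carrier, 0 < inner ℝ e (s - p) ∧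
      dist s (o + t • e) = dist p (o + t • e) ∧
      ∀ z ∈ γ.carrier, dist p (o + t • e) ≤ dist z (o + t • e) := by
  -- For `z` in the open half-plane ahead of `p`, `f z` is the time at which the moving circle
  -- reaches `z`.
  set f : Plane → ℝ := fun z => (dist z o ^ 2 - dist p o ^ 2) / (2 * inner ℝ e (z - p)) with hf
  have hnum : ∀ z ∈ γ.carrier, 0 ≤ dist z o ^ 2 - dist p o ^ 2 := fun z hz =>
    sub_nonneg.2 (pow_le_pow_left₀ dist_nonneg (hmin z hz) 2)
  have hle : ∀ z t, 0 < inner ℝ e (z - p) →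
      (f z ≤ t ↔ dist z (o + t • e) ^ 2 ≤ dist p (o + t • e) ^ 2) := by
    intro z t hz
    rw [← sub_nonpos (a := dist z (o + t • e) ^ 2), dist_sq_sub_dist_sq, hf]
    simp only
    rw [div_le_iff₀ (by positivity), sub_nonpos]
    constructor <;> intro h <;> linarith
  have hle' : ∀ z t, 0 < inner ℝ e (z - p) →
      (t ≤ f z ↔ dist p (o + t • e) ^ 2 ≤ dist z (o + t • e) ^ 2) := by
    intro z t hz
    rw [← sub_nonneg (a := dist z (o + t • e) ^ 2), dist_sq_sub_dist_sq, hf]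
    simp only
    rw [le_div_iff₀ (by positivity), sub_nonneg]
    constructor <;> intro h <;> linarith
  set A : Set Plane := {z | z ∈ γ.carrier ∧ 0 < inner ℝ e (z - p) ∧ f z ≤ f z₀} with hA
  -- Points reached no later than `z₀` lie in the closed disc of time `f z₀`, so there are finitely
  -- many and a first one exists.
  have hAfin : A.Finite := by
    refine (γ.locallyFinite (Metric.closedBall (o + f z₀ • e) (dist p (o + f z₀ • e)))
      Metric.isBounded_closedBall).subset ?_
    rintro z ⟨hz, hz1, hz2⟩
    exact ⟨hz, (sq_le_sq₀ dist_nonneg dist_nonneg).1 ((hle z _ hz1).1 hz2)⟩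
  obtain ⟨s, ⟨hs, hs1, hs2⟩, hsmin⟩ := Set.exists_min_image A f hAfin ⟨z₀, hz₀, hpos, le_rfl⟩
  have ht : 0 ≤ f s := div_nonneg (hnum s hs) (by positivity)
  refine ⟨f s, ht, s, hs, hs1, ?_, fun z hz => ?_⟩
  · exact (sq_eq_sq₀ dist_nonneg dist_nonneg).1
      (le_antisymm ((hle s _ hs1).1 le_rfl) ((hle' s _ hs1).1 le_rfl))
  · rw [← sq_le_sq₀ dist_nonneg dist_nonneg]
    -- Points not ahead of `p` are never reached; those ahead of it are reached no earlier than `s`.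
    rcases le_or_gt (inner ℝ e (z - p)) 0 with hz1 | hz1
    · rw [← sub_nonneg, dist_sq_sub_dist_sq]
      have := hnum z hz
      have := mul_nonneg ht (neg_nonneg.2 hz1)
      linarith
    · rw [← hle' z _ hz1]
      rcases le_total (f z) (f z₀) with h | h
      · exact hsmin z ⟨hz, hz1, h⟩
      · exact hs2.trans h

/-- The normal vector `(q - p)` rotated by a right angle. -/
def Plane.normal (p q : Plane) : Plane := !₂[-(q 1 - p 1), q 0 - p 0]

theorem Plane.inner_normal (p q z : Plane) : inner ℝ (normal p q) (z - p) = det p q z := by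
  simp [inner_eq, normal, det]; ring

/-- An empty disc through two points of `γ` gives rise to a Delaunay triangle. -/
theorem exists_isEmptyTriangle {γ : Config} {p q o : Plane} (hp : p ∈ γ.carrier)
    (hq : q ∈ γ.carrier) (hpq : dist q o = dist p o)
    (hmin : ∀ z ∈ γ.carrier, dist p o ≤ dist z o) {k : ℝ} {z₀ : Plane} (hz₀ : z₀ ∈ γ.carrier)
    (hpos : 0 < k * det p q z₀) :
    ∃ t : ℝ, 0 ≤ t ∧ ∃ s, IsEmptyTriangle γ p q s (o + t • k • normal p q) := by
  have hin : ∀ z, inner ℝ (k • normal p q) (z - p) = k * det p q z := fun z => by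
    rw [real_inner_smul_left, inner_normal]
  obtain ⟨t, ht, s, hs, hs1, hs2, hs3⟩ :=
    exists_grown_disc (e := k • normal p q) hmin hz₀ (by rwa [hin])
  refine ⟨t, ht, s, ⟨?_, hp, hq, hs, ?_, hs2, hs3⟩⟩
  · intro h
    rw [hin, h, mul_zero] at hs1
    exact lt_irrefl _ hs1
  -- The centre moves orthogonally to `q - p`, so `q` stays on the boundary together with `p`.
  · rw [← sq_eq_sq₀ dist_nonneg dist_nonneg, ← sub_eq_zero, dist_sq_sub_dist_sq, hin, hpq]
    simp [det]
    right; right; ring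

/-- Hard core repulsion: a lower bound for the sides of the Delaunay triangles bounds all
distances between points. -/
theorem lt_dist_of_delaunay {γ : Config} {r : ℝ} (h : ∀ T, IsDelaunay γ T → r < minSide T)
    (hne : ∀ p ∈ γ.carrier, ∀ q ∈ γ.carrier, p ≠ q → ∃ z ∈ γ.carrier, det p q z ≠ 0)
    {p q : Plane} (hp : p ∈ γ.carrier) (hq : q ∈ γ.carrier) (hpq : p ≠ q) : r < dist p q := by
  set A := (γ.carrier \ {p}) ∩ Metric.closedBall p (dist q p) with hA
  have hAfin : A.Finite := (γ.locallyFinite _ (Metric.isBounded_closedBall (x := p)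
    (r := dist q p))).subset (Set.inter_subset_inter_left _ Set.sdiff_subset)
  obtain ⟨q', ⟨⟨hq', hne'⟩, hball⟩, hmin⟩ := Set.exists_min_image A (fun z => dist z p) hAfin
    ⟨q, ⟨hq, fun h => hpq h.symm⟩, Metric.mem_closedBall.2 le_rfl⟩
  have hmin' : ∀ z ∈ γ.carrier, z ≠ p → dist q' p ≤ dist z p := by
    intro z hz hzp
    rcases le_total (dist z p) (dist q p) with h1 | h1
    · exact hmin z ⟨⟨hz, hzp⟩, h1⟩
    · exact (Metric.mem_closedBall.1 hball).trans h1
  have hpq' : p ≠ q' := fun h => hne' h.symm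
  suffices hs : r < dist p q' by
    refine hs.trans_le ?_
    rw [dist_comm p q', dist_comm p q]
    exact hmin' q hq hpq.symm
  -- The disc with diameter from `p` to its nearest neighbour `q'` is empty: any other `z` is at
  -- distance at least `dist q' p` from `p`, hence at least half of that from the midpoint. Thus `p`
  -- and `q'` span a side of a Delaunay triangle.
  set o : Plane := midpoint ℝ p q' with ho
  have h1 : dist q' o = dist p o := by simp [ho]
  have h2 : dist p o = dist q' p / 2 := by
    rw [ho, dist_left_midpoint, dist_comm p q']; norm_num; ring
  have h3 : ∀ z ∈ γ.carrier, dist p o ≤ dist z o := by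
    intro z hz
    by_cases hzp : z = p
    · rw [hzp]
    · have := hmin' z hz hzp
      have := dist_triangle_right z p o
      linarith
  obtain ⟨z₀, hz₀, hdet⟩ := hne p hp q' hq' hpq'
  have hk : 0 < det p q' z₀ * det p q' z₀ := mul_self_pos.2 hdet
  obtain ⟨t, -, s, hs⟩ := exists_isEmptyTriangle hp hq' h1 h3 hz₀ hk
  have hD := hs.isDelaunay
  exact (lt_minSide_iff hD.2.1).1 (h _ hD) p (by simp) q' (by simp) hpq'

/-- If all points of `γ` were on the line through `p` and `q`, the vertices of the triangle would be
collinear. -/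
theorem exists_det_ne_zero_of_isEmptyTriangle {γ : Config} {a b c o : Plane}
    (h : IsEmptyTriangle γ a b c o) : ∀ p ∈ γ.carrier, ∀ q ∈ γ.carrier, p ≠ q →
      ∃ z ∈ γ.carrier, det p q z ≠ 0 := by
  intro p _ q _ hpq
  by_contra hcon
  push Not at hcon
  have ha := hcon a h.mem_a
  have hb := hcon b h.mem_b
  have hc := hcon c h.mem_c
  apply h.det_ne
  have key0 : (q 0 - p 0) * det a b c = 0 := by
    unfold det at *
    linear_combination (c 0 - b 0) * ha + (a 0 - c 0) * hb + (b 0 - a 0) * hc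
  have key1 : (q 1 - p 1) * det a b c = 0 := by
    unfold det at *
    linear_combination (c 1 - b 1) * ha + (a 1 - c 1) * hb + (b 1 - a 1) * hc
  by_contra hd
  exact hpq (ext_iff.2 ⟨by linarith [(mul_eq_zero.1 key0).resolve_right hd],
    by linarith [(mul_eq_zero.1 key1).resolve_right hd]⟩)

/-- Every open half-plane contains a point of `γ`. -/
def MeetsHalfPlanes (γ : Config) : Prop :=
  ∀ e p : Plane, e ≠ 0 → ∃ z ∈ γ.carrier, 0 < inner ℝ e (z - p)

theorem Plane.normal_ne_zero {p q : Plane} (h : p ≠ q) : normal p q ≠ 0 := by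
  intro h0
  rw [ext_iff] at h0
  simp [normal, sub_eq_zero] at h0
  exact h (ext_iff.2 ⟨h0.2.symm, by linarith [h0.1]⟩)

theorem MeetsHalfPlanes.exists_det_ne_zero {γ : Config} (h : MeetsHalfPlanes γ) :
    ∀ p ∈ γ.carrier, ∀ q ∈ γ.carrier, p ≠ q → ∃ z ∈ γ.carrier, det p q z ≠ 0 := by
  intro p _ q _ hpq
  obtain ⟨z, hz, hpos⟩ := h (normal p q) p (normal_ne_zero hpq)
  rw [inner_normal] at hpos
  exact ⟨z, hz, hpos.ne'⟩

theorem MeetsHalfPlanes.nonempty {γ : Config} (h : MeetsHalfPlanes γ) : γ.carrier.Nonempty := by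
  obtain ⟨z, hz, -⟩ := h !₂[1, 0] 0 (by
    intro h0; have := congrArg (fun v : Plane => v 0) h0; simp at this)
  exact ⟨z, hz⟩

theorem Config.exists_nearest {γ : Config} (h : γ.carrier.Nonempty) (c : Plane) :
    ∃ p ∈ γ.carrier, ∀ z ∈ γ.carrier, dist p c ≤ dist z c := by
  obtain ⟨q, hq⟩ := h
  obtain ⟨p, hp, hmin⟩ := Set.exists_min_image _ (fun z => dist z c)
    (γ.locallyFinite (Metric.closedBall c (dist q c)) Metric.isBounded_closedBall)
    ⟨q, hq, Metric.mem_closedBall.2 le_rfl⟩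
  refine ⟨p, hp.1, fun z hz => ?_⟩
  rcases le_total (dist z c) (dist q c) with h1 | h1
  · exact hmin z ⟨hz, h1⟩
  · exact (Metric.mem_closedBall.1 hp.2).trans h1

/-- Moving the centre in a direction that does not point back towards `p` cannot shrink a disc with
`p` on its boundary. -/
theorem Plane.dist_le_dist_add_smul {p o e : Plane} {t : ℝ} (ht : 0 ≤ t)
    (h : 0 ≤ inner ℝ e (o - p)) : dist p o ≤ dist p (o + t • e) := by
  rw [← sq_le_sq₀ dist_nonneg dist_nonneg]
  simp only [dist_sq, inner_eq, PiLp.add_apply, PiLp.smul_apply, PiLp.sub_apply,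
    smul_eq_mul] at *
  nlinarith [mul_nonneg ht h, sq_nonneg (t * e 0), sq_nonneg (t * e 1)]

/-- Upper bounds for the circumradii control the size of empty discs. -/
theorem exists_dist_lt_of_circumradius_lt {γ : Config} {α : ℝ} (hα : 0 < α)
    (hγ : MeetsHalfPlanes γ) (h : ∀ T, IsDelaunay γ T → circumradius T < α) (c : Plane) :
    ∃ z ∈ γ.carrier, dist z c < α := by
  obtain ⟨p, hp, hmin⟩ := Config.exists_nearest hγ.nonempty c
  refine ⟨p, hp, ?_⟩
  by_contra! hcon
  have hpc : c - p ≠ 0 := by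
    intro h0
    rw [sub_eq_zero.1 h0, dist_self] at hcon
    linarith
  -- An empty disc of radius at least `α` is grown twice, first away from `p` until it hits a second
  -- point `q`.
  obtain ⟨z₀, hz₀, hpos⟩ := hγ (c - p) p hpc
  obtain ⟨t, ht, q, hq, hq1, hq2, hq3⟩ := exists_grown_disc hmin hz₀ hpos
  set o := c + t • (c - p) with ho
  have h1 : dist p c ≤ dist p o := dist_le_dist_add_smul ht real_inner_self_nonneg
  have hpq : p ≠ q := by
    rintro rfl
    simp at hq1
  -- The sign `k` orients the second growth so that the radius does not decrease. The resulting
  -- Delaunay triangle has radius at least `dist p c ≥ α`, a contradiction.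
  have hk : ∃ k : ℝ, k ≠ 0 ∧ 0 ≤ inner ℝ (k • normal p q) (o - p) := by
    rcases le_total 0 (inner ℝ (normal p q) (o - p)) with h0 | h0
    · exact ⟨1, one_ne_zero, by simpa using h0⟩
    · exact ⟨-1, by norm_num, by simpa using h0⟩
  obtain ⟨k, hk0, hk⟩ := hk
  obtain ⟨z₁, hz₁, hpos₁⟩ := hγ (k • normal p q) p (smul_ne_zero hk0 (normal_ne_zero hpq))
  rw [real_inner_smul_left, inner_normal] at hpos₁
  obtain ⟨u, hu, s, hs⟩ := exists_isEmptyTriangle hp hq hq2 hq3 hz₁ hpos₁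
  have h2 := h _ hs.isDelaunay
  rw [hs.circumradius_eq] at h2
  have h3 : dist p o ≤ _ := dist_le_dist_add_smul hu hk
  linarith

end

noncomputable section

open Plane

/-! ### Bounds for the local energy -/

/-- A ball of radius `A` is covered by finitely many balls of radius `r / 2`, and each of them
contains at most one point of a separated set. -/
theorem exists_card_le_of_separated {r : ℝ} (hr : 0 < r) (A : ℝ) :
    ∃ N : ℕ, ∀ (x : Plane) (V : Finset Plane), (∀ p ∈ V, dist p x ≤ A) →
      (∀ p ∈ V, ∀ q ∈ V, p ≠ q → r < dist p q) → V.card ≤ N := by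
  obtain ⟨t, -, htf, ht⟩ := (isCompact_closedBall (0 : Plane) A).finite_cover_balls (half_pos hr)
  refine ⟨htf.toFinset.card, fun x V hV hsep => ?_⟩
  have hex : ∀ p ∈ V, ∃ c ∈ t, dist (p - x) c < r / 2 := by
    intro p hp
    have h1 : p - x ∈ Metric.closedBall (0 : Plane) A := by
      rw [Metric.mem_closedBall, dist_zero_right, ← dist_eq_norm]; exact hV p hp
    simpa using ht h1
  choose! f hf hf' using hex
  refine Finset.card_le_card_of_injOn f (fun p hp => htf.mem_toFinset.2 (hf p hp)) ?_
  intro p hp q hq hpq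
  by_contra hne
  have h1 := hsep p hp q hq hne
  have h2 := hf' p hp
  have h3 := hf' q hq
  rw [← hpq] at h3
  have h4 := dist_triangle_right (p - x) (q - x) (f p)
  rw [dist_sub_right] at h4
  linarith

/-- The vertices are `r`-separated and lie within `2 * A` of `x`, so at most `N` points are
available. This leaves at most `2 ^ N` triangles, each of perimeter at most `6 * A`. -/
theorem exists_sum_perimeter_le {r : ℝ} (hr : 0 < r) {A : ℝ} (hA : 0 ≤ A) :
    ∃ C : ℝ, 0 ≤ C ∧ ∀ (γ : Config) (x : Plane) (S : Set (Finset Plane)),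
      (∀ T, IsDelaunay γ T → r < minSide T) →
      (∀ T ∈ S, IsDelaunay γ T ∧ circumradius T ≤ A ∧
        dist x (circumcircle T).center ≤ circumradius T) →
      0 ≤ ∑ᶠ T ∈ S, perimeter T ∧ ∑ᶠ T ∈ S, perimeter T ≤ C := by
  classical
  obtain ⟨N, hN⟩ := exists_card_le_of_separated hr (2 * A)
  refine ⟨2 ^ N * (6 * A), by positivity, fun γ x S hγ hS => ?_⟩
  have hV := γ.locallyFinite (Metric.closedBall x (2 * A)) Metric.isBounded_closedBall
  have hsub : ∀ T ∈ S, T ⊆ hV.toFinset := by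
    intro T hT p hp
    obtain ⟨h1, h2, h3⟩ := hS T hT
    rw [hV.mem_toFinset]
    refine ⟨h1.1 hp, ?_⟩
    have h4 := dist_triangle_right p x (circumcircle T).center
    rw [h1.dist_center hp] at h4
    rw [Metric.mem_closedBall]
    linarith
  have hSfin : S.Finite := hV.toFinset.powerset.finite_toSet.subset fun T hT => by
    simpa using hsub T hT
  rw [finsum_mem_eq_finite_toFinset_sum _ hSfin]
  refine ⟨Finset.sum_nonneg fun T _ => perimeter_nonneg T, ?_⟩
  have hper : ∑ T ∈ hSfin.toFinset, perimeter T ≤ hSfin.toFinset.card • (6 * A) := by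
    refine Finset.sum_le_card_nsmul _ _ _ fun T hT => ?_
    obtain ⟨h1, h2, -⟩ := hS T (hSfin.mem_toFinset.1 hT)
    have := h1.perimeter_le
    linarith
  refine hper.trans ?_
  rw [nsmul_eq_mul]
  refine mul_le_mul_of_nonneg_right ?_ (by positivity)
  -- The separation of `γ` requires points off every line; a triangle of `S` provides them. A
  -- collinear `γ` falls under the empty case.
  rcases S.eq_empty_or_nonempty with rfl | ⟨T, hT⟩
  · simp
  · obtain ⟨a, b, c, o, rfl, ht⟩ := (hS T hT).1.exists_triple
    have hcard : hV.toFinset.card ≤ N := by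
      refine hN x _ (fun p hp => ((hV.mem_toFinset.1 hp).2)) fun p hp q hq hpq => ?_
      exact lt_dist_of_delaunay hγ (exists_det_ne_zero_of_isEmptyTriangle ht)
        (hV.mem_toFinset.1 hp).1 (hV.mem_toFinset.1 hq).1 hpq
    have h1 : hSfin.toFinset.card ≤ 2 ^ hV.toFinset.card := by
      rw [← Finset.card_powerset]
      exact Finset.card_le_card fun T hT =>
        Finset.mem_powerset.2 (hsub T (hSfin.mem_toFinset.1 hT))
    have h2 : (2 : ℕ) ^ hV.toFinset.card ≤ 2 ^ N := Nat.pow_le_pow_right (by norm_num) hcard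
    exact_mod_cast h1.trans h2

theorem mem_finiteEnergyConfigs_iff {r α θ : ℝ} {γ : Config} :
    γ ∈ finiteEnergyConfigs (delaunayEnergy r α θ) ↔
      ∀ T, IsDelaunay γ T → IsAdmissible r α T := by
  constructor
  · intro h T hT
    -- The window `circumdisc T` is made to see `T`.
    have hb : IsBoundedBorel (circumdisc T) := ⟨Metric.isBounded_ball, measurableSet_ball⟩
    refine (delaunayEnergy_lt_top_iff hb.1).1 (h _ hb) T ⟨hT, ?_⟩
    rw [Set.inter_self]
    exact ⟨_, Metric.mem_ball_self hT.circumradius_pos⟩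
  · intro h Λ hΛ
    exact (delaunayEnergy_lt_top_iff hΛ.1).2 fun T hT => h T hT.1

/-- The perimeters created and those destroyed both sum to a number in `[0, C]`. One bound `A`
serves all parameters `α ≤ A`, which makes the estimate uniform. -/
theorem exists_perimeterVariation_le {r : ℝ} (hr : 0 < r) {A : ℝ} (hA : 0 ≤ A) :
    ∃ C : ℝ, 0 ≤ C ∧ ∀ (γ : Config) (x : Plane),
      (∀ T, IsDelaunay γ T → IsAdmissible r A T) →
      (∀ T ∈ newTriangles γ x, IsAdmissible r A T) → |perimeterVariation γ x| ≤ C := by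
  obtain ⟨C, hC, h⟩ := exists_sum_perimeter_le hr hA
  refine ⟨C, hC, fun γ x hγ hnew => ?_⟩
  have h1 := h γ x (oldTriangles γ x) (fun T hT => (hγ T hT).2)
    fun T hT => ⟨hT.1, (hγ T hT.1).1.le, (Metric.mem_ball.1 hT.2).le⟩
  have h2 := h (γ.addPoint x) x (newTriangles γ x)
    (fun T hT => by
      rcases hT.mem_or_of_addPoint with hx | ⟨hT', -⟩
      · exact (hnew T ⟨hT, hx⟩).2
      · exact (hγ T hT').2)
    fun T hT => ⟨hT.1, (hnew T hT).1.le, (hT.1.dist_center hT.2).le⟩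
  rw [perimeterVariation, abs_le]
  constructor <;> linarith [h1.1, h1.2, h2.1, h2.2]

/-! ### Local stability and continuity in the parameters. -/

theorem isBoundedBorel_ball (x : Plane) (R : ℝ) : IsBoundedBorel (Metric.ball x R) :=
  ⟨Metric.isBounded_ball, measurableSet_ball⟩

theorem assumptionH3_delaunayEnergy {r : ℝ} (hr : 0 < r) {K : Set ℝ} (hK : IsCompact K)
    {Θ : Set ℝ} (hΘ : Bornology.IsBounded Θ) : AssumptionH3 K Θ (delaunayEnergy r) := by
  obtain ⟨A, hA⟩ := hK.bddAbove
  obtain ⟨M, hM⟩ := hΘ.exists_norm_le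
  obtain ⟨C, hC, h⟩ := exists_perimeterVariation_le hr (le_max_right A 0)
  -- The absolute value covers an empty `Θ`, for which `M` may be negative.
  refine ⟨|M| * C, by positivity, fun α hα θ hθ γ hγ x hx => ?_⟩
  have hfin := hγ _ (isBoundedBorel_ball x 1)
  have hball := Metric.ball_mem_nhds x one_pos
  by_cases hnew : ∀ T ∈ newTriangles γ x, IsAdmissible r α T
  · rw [localEnergy_of_admissible hx (isBoundedBorel_ball x 1) hball hfin hnew,
      EReal.coe_le_coe_iff]
    have hαA : α ≤ max A 0 := (hA hα).trans (le_max_left _ _)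
    have h1 := h γ x (fun T hT => (mem_finiteEnergyConfigs_iff.1 hγ T hT).mono hαA)
      fun T hT => (hnew T hT).mono hαA
    have h2 : |θ| ≤ |M| := (hM θ hθ).trans (le_abs_self M)
    have h3 : |θ * perimeterVariation γ x| ≤ |M| * C := by
      rw [abs_mul]; exact mul_le_mul h2 h1 (abs_nonneg _) (abs_nonneg _)
    exact (abs_le.1 h3).1
  · rw [localEnergy_of_not_admissible hx (isBoundedBorel_ball x 1) hball hfin hnew]
    exact le_top

/-- Finiteness of the local energy at `α` makes the new triangles `α`-admissible, hence
`a₀`-admissible. Both local energies are then multiples of the same bounded variation and differ by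
at most `C * |θ - θ'|`; the value of `α` plays no further role. -/
theorem assumptionH6'_delaunayEnergy {r : ℝ} (hr : 0 < r) {Θ : Set ℝ} {a₀ t₀ : ℝ} (ha₀ : 0 ≤ a₀)
    (μ : Measure Config) [IsFiniteMeasure μ] : AssumptionH6' Θ (delaunayEnergy r) a₀ t₀ μ := by
  obtain ⟨C, hC, h⟩ := exists_perimeterVariation_le hr ha₀
  refine ⟨fun x => |x|, fun _ => C, ?_, integrable_const C, ae_of_all _ ?_⟩
  · simpa using (continuous_abs (G := ℝ)).tendsto 0
  intro γ hγ h0 α _ hα θ _ θ' _ hrem hlt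
  rw [mem_removablePoints_addPoint h0] at hrem
  obtain ⟨Λ, hΛ, hΛ0, hfin⟩ := hrem
  have hnew : ∀ T ∈ newTriangles γ 0, IsAdmissible r α T := by
    by_contra hn
    exact hlt.ne (localEnergy_of_not_admissible h0 hΛ hΛ0 hfin hn)
  have hnew' : ∀ T ∈ newTriangles γ 0, IsAdmissible r a₀ T := fun T hT => (hnew T hT).mono hα
  rw [mem_finiteEnergyConfigs_iff] at hγ
  have hfin' : delaunayEnergy r a₀ θ' Λ γ < ⊤ :=
    (delaunayEnergy_lt_top_iff hΛ.1).2 fun T hT => hγ T hT.1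
  rw [localEnergy_of_admissible h0 hΛ hΛ0 hfin hnew,
    localEnergy_of_admissible h0 hΛ hΛ0 hfin' hnew', EReal.toReal_coe, EReal.toReal_coe,
    ← sub_mul, abs_mul]
  refine ⟨EReal.coe_lt_top _, ?_⟩
  have h1 := h γ 0 hγ hnew'
  have h2 := mul_le_mul_of_nonneg_left h1 (abs_nonneg (θ - θ'))
  have h3 := mul_nonneg hC (abs_nonneg (α - a₀))
  simp only [abs_abs]
  linarith

end

noncomputable section

open Plane ProbabilityTheory

/-! ### Measurability -/

namespace Config

theorem countable_carrier (γ : Config) : γ.carrier.Countable := by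
  have : γ.carrier = ⋃ n : ℕ, γ.carrier ∩ Metric.ball 0 n := by
    rw [← Set.inter_iUnion, Metric.iUnion_ball_nat, Set.inter_univ]
  rw [this]
  exact Set.countable_iUnion fun n => (γ.locallyFinite _ Metric.isBounded_ball).countable

theorem measurable_count {Λ : Set Plane} (hΛ : IsBoundedBorel Λ) :
    Measurable fun γ : Config => γ.count Λ := by
  refine measurable_to_countable' fun n => ?_
  exact MeasurableSpace.measurableSet_generateFrom ⟨Λ, n, hΛ, rfl⟩

theorem measurable_of_count {X : Type*} [MeasurableSpace X] {f : X → Config}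
    (h : ∀ Λ, IsBoundedBorel Λ → Measurable fun x => (f x).count Λ) : Measurable f := by
  refine measurable_generateFrom ?_
  rintro _ ⟨Λ, n, hΛ, rfl⟩
  exact h Λ hΛ (measurableSet_singleton n)

/-- The counting measure on the points of `γ`. -/
def pointMeasure (γ : Config) : Measure Plane := Measure.count.restrict γ.carrier

theorem pointMeasure_apply (γ : Config) {Λ : Set Plane} (hΛ : IsBoundedBorel Λ) :
    γ.pointMeasure Λ = γ.count Λ := by
  have hfin := γ.locallyFinite Λ hΛ.1
  rw [pointMeasure, Measure.restrict_apply hΛ.2, Set.inter_comm,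
    Measure.count_apply_finite _ hfin, count, Set.ncard_eq_toFinset_card _ hfin]

theorem pointMeasure_eq_zero_iff (γ : Config) {Λ : Set Plane} (hΛ : MeasurableSet Λ) :
    γ.pointMeasure Λ = 0 ↔ Disjoint Λ γ.carrier := by
  rw [pointMeasure, Measure.restrict_apply hΛ, Measure.count_eq_zero_iff,
    Set.disjoint_iff_inter_eq_empty]

theorem lintegral_pointMeasure (γ : Config) (f : Plane → ℝ≥0∞) :
    ∫⁻ p, f p ∂γ.pointMeasure = ∑' p, γ.carrier.indicator f p := by
  rw [pointMeasure, lintegral_countable _ γ.countable_carrier, ← tsum_subtype]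
  simp

theorem measurable_pointMeasure : Measurable pointMeasure := by
  refine Measure.measurable_of_measurable_coe _ fun A hA => ?_
  have hb : ∀ n : ℕ, IsBoundedBorel (A ∩ Metric.ball 0 n) := fun n =>
    ⟨Metric.isBounded_ball.subset Set.inter_subset_right, hA.inter measurableSet_ball⟩
  have heq : ∀ γ : Config, γ.pointMeasure A = ⨆ n : ℕ, (γ.count (A ∩ Metric.ball 0 n) : ℝ≥0∞) := by
    intro γ
    have hA' : A = ⋃ n : ℕ, A ∩ Metric.ball 0 n := by
      rw [← Set.inter_iUnion, Metric.iUnion_ball_nat, Set.inter_univ]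
    have hmono : Monotone fun n : ℕ => A ∩ Metric.ball (0 : Plane) n := fun m n hmn =>
      Set.inter_subset_inter_right _ (Metric.ball_subset_ball (by exact_mod_cast hmn))
    conv_lhs => rw [hA']
    rw [hmono.measure_iUnion]
    exact iSup_congr fun n => γ.pointMeasure_apply (hb n)
  simp_rw [heq]
  refine Measurable.iSup fun n => ?_
  exact (measurable_from_top (f := fun n : ℕ => (n : ℝ≥0∞))).comp (measurable_count (hb n))

/-- The counting measures of configurations, as a kernel. -/
def pointKernel : Kernel Config Plane := ⟨pointMeasure, measurable_pointMeasure⟩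

/-- An annulus around the origin. -/
def annulus (n : ℕ) : Set Plane := {p | ⌊‖p‖⌋₊ = n}

theorem isBoundedBorel_annulus (n : ℕ) : IsBoundedBorel (annulus n) := by
  constructor
  · refine (Metric.isBounded_ball (x := (0 : Plane)) (r := n + 1)).subset fun p hp => ?_
    rw [mem_ball_zero_iff, ← (show ⌊‖p‖⌋₊ = n from hp)]
    exact Nat.lt_floor_add_one _
  · exact (Nat.measurable_floor.comp measurable_norm) (measurableSet_singleton n)

/-- The number of points in an annulus is not bounded over all configurations, so the kernel is
split by annulus and by the count `n` there; each piece has mass at most `n`. This makes integrals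
over the points of `γ` measurable in parameters. -/
instance : IsSFiniteKernel pointKernel := by
  have hs : ∀ i : ℕ × ℕ, MeasurableSet {γ : Config | γ.count (annulus i.1) = i.2} := fun i =>
    measurable_count (isBoundedBorel_annulus i.1) (measurableSet_singleton i.2)
  classical
  let k : ℕ × ℕ → Kernel Config Plane := fun i =>
    Kernel.piecewise (hs i) (Kernel.restrict pointKernel (isBoundedBorel_annulus i.1).2) 0
  have hk : ∀ i γ A, MeasurableSet A → k i γ A =
      if γ.count (annulus i.1) = i.2 then γ.pointMeasure (A ∩ annulus i.1) else 0 := by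
    intro i γ A hA
    simp only [k, Kernel.piecewise_apply, Set.mem_ofPred_eq]
    split_ifs
    · rw [Kernel.restrict_apply' _ _ _ hA]; rfl
    · simp
  have hfin : ∀ i, IsFiniteKernel (k i) := by
    intro i
    refine ⟨⟨i.2, by simp, fun γ => ?_⟩⟩
    rw [hk i γ _ MeasurableSet.univ]
    split_ifs with h
    · rw [Set.univ_inter, pointMeasure_apply _ (isBoundedBorel_annulus _), h]
    · simp
  have hsum : pointKernel = Kernel.sum k := by
    ext γ A hA
    rw [Kernel.sum_apply' _ _ hA, ENNReal.tsum_prod']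
    have h1 : ∀ n, ∑' m, k (n, m) γ A = γ.pointMeasure (A ∩ annulus n) := by
      intro n
      rw [tsum_eq_single (γ.count (annulus n))]
      · rw [hk _ _ _ hA, if_pos rfl]
      · intro m hm
        rw [hk _ _ _ hA, if_neg hm.symm]
    simp_rw [h1]
    have hA' : A = ⋃ n : ℕ, A ∩ annulus n := by
      rw [← Set.inter_iUnion]
      exact (Set.inter_eq_left.2 fun p _ => Set.mem_iUnion.2 ⟨⌊‖p‖⌋₊, (rfl : _ = _)⟩).symm
    change γ.pointMeasure A = _
    conv_lhs => rw [hA']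
    rw [measure_iUnion]
    · intro m n hmn
      refine Set.disjoint_left.2 fun p hp hp' => hmn ?_
      exact (show ⌊‖p‖⌋₊ = m from hp.2).symm.trans hp'.2
    · exact fun n => hA.inter (isBoundedBorel_annulus n).2
  rw [hsum]
  exact Kernel.isSFiniteKernel_sum

theorem measurable_lintegral_pointMeasure {X : Type*} [MeasurableSpace X] {g : X → Config}
    (hg : Measurable g) {f : X × Plane → ℝ≥0∞} (hf : Measurable f) :
    Measurable fun x => ∫⁻ p, f (x, p) ∂(g x).pointMeasure :=
  hf.lintegral_kernel_prod_right' (κ := pointKernel.comap g hg)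

end Config

end

noncomputable section

open Plane ProbabilityTheory

/-! ### Sums over Delaunay triangles -/

theorem Plane.measurable_coord (i : Fin 2) : Measurable fun p : Plane => p i := by fun_prop

theorem Plane.measurable_det {X : Type*} [MeasurableSpace X] {a b c : X → Plane}
    (ha : Measurable a) (hb : Measurable b) (hc : Measurable c) :
    Measurable fun x => det (a x) (b x) (c x) := by
  unfold det
  fun_prop

theorem Plane.measurable_mk {X : Type*} [MeasurableSpace X] {f g : X → ℝ} (hf : Measurable f)
    (hg : Measurable g) : Measurable fun x => (!₂[f x, g x] : Plane) := by
  refine (WithLp.measurable_toLp 2 (Fin 2 → ℝ)).comp ?_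
  refine measurable_pi_lambda _ fun i => ?_
  fin_cases i
  · exact hf
  · exact hg

theorem Plane.measurable_circumcenter {X : Type*} [MeasurableSpace X] {a b c : X → Plane}
    (ha : Measurable a) (hb : Measurable b) (hc : Measurable c) :
    Measurable fun x => circumcenter (a x) (b x) (c x) := by
  have hd := measurable_det ha hb hc
  unfold circumcenter
  refine measurable_mk ?_ ?_ <;> fun_prop

theorem Finset.triple_eq_triple_iff {ι : Type*} [DecidableEq ι] {p q s : ι} (hpq : p ≠ q)
    (hps : p ≠ s) (hqs : q ≠ s) (a b c : ι) : ({p, q, s} : Finset ι) = {a, b, c} ↔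
      (a, b, c) ∈
        ({(p, q, s), (p, s, q), (q, p, s), (q, s, p), (s, p, q), (s, q, p)} : Finset (ι × ι × ι)) := by
  simp only [Finset.mem_insert, Finset.mem_singleton, Prod.mk.injEq]
  constructor
  · intro heq
    have ha : a = p ∨ a = q ∨ a = s := by
      have : a ∈ ({p, q, s} : Finset ι) := by rw [heq]; simp
      simpa using this
    have hb : b = p ∨ b = q ∨ b = s := by
      have : b ∈ ({p, q, s} : Finset ι) := by rw [heq]; simp
      simpa using this
    have hc : c = p ∨ c = q ∨ c = s := by
      have : c ∈ ({p, q, s} : Finset ι) := by rw [heq]; simp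
      simpa using this
    have hp : p = a ∨ p = b ∨ p = c := by
      have : p ∈ ({a, b, c} : Finset ι) := by rw [← heq]; simp
      simpa using this
    have hq : q = a ∨ q = b ∨ q = c := by
      have : q ∈ ({a, b, c} : Finset ι) := by rw [← heq]; simp
      simpa using this
    have hs : s = a ∨ s = b ∨ s = c := by
      have : s ∈ ({a, b, c} : Finset ι) := by rw [← heq]; simp
      simpa using this
    clear heq
    rcases ha with h1 | h1 | h1 <;> rcases hb with h2 | h2 | h2 <;> simp_all [eq_comm]
  · rintro (⟨rfl, rfl, rfl⟩ | ⟨rfl, rfl, rfl⟩ | ⟨rfl, rfl, rfl⟩ | ⟨rfl, rfl, rfl⟩ |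
      ⟨rfl, rfl, rfl⟩ | ⟨rfl, rfl, rfl⟩) <;> ext z <;> simp <;> tauto

/-- Each set of three points is counted six times when ordered triples are summed. -/
theorem tsum_triple {F : Finset Plane → ℝ≥0∞} (hF : ∀ T, F T ≠ 0 → T.card = 3) :
    ∑' a, ∑' b, ∑' c, F {a, b, c} = 6 * ∑' T, F T := by
  classical
  have h1 : ∀ a b c, F {a, b, c} =
      ∑' T : Finset Plane, if T = {a, b, c} then F T else 0 := fun a b c => by
    rw [tsum_ite_eq]
  have h2 : ∀ T : Finset Plane, ∑' x : Plane × Plane × Plane,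
      (if T = {x.1, x.2.1, x.2.2} then F T else 0) = 6 * F T := by
    intro T
    by_cases hT : F T = 0
    · simp [hT]
    obtain ⟨p, q, s, hpq, hps, hqs, rfl⟩ := Finset.card_eq_three.1 (hF T hT)
    rw [tsum_eq_sum (s := {(p, q, s), (p, s, q), (q, p, s), (q, s, p), (s, p, q), (s, q, p)})]
    · have hcard : ({(p, q, s), (p, s, q), (q, p, s), (q, s, p), (s, p, q), (s, q, p)} :
          Finset (Plane × Plane × Plane)).card = 6 := by
        simp [hpq, hps, hqs, hpq.symm, hps.symm, hqs.symm]
      rw [Finset.sum_eq_card_nsmul (b := F {p, q, s}), hcard, nsmul_eq_mul, Nat.cast_ofNat]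
      refine fun x hx => if_pos ?_
      exact (Finset.triple_eq_triple_iff hpq hps hqs _ _ _).2 hx
    · exact fun x hx => if_neg fun heq =>
        hx ((Finset.triple_eq_triple_iff hpq hps hqs _ _ _).1 heq)
  calc ∑' a, ∑' b, ∑' c, F {a, b, c}
      = ∑' x : Plane × Plane × Plane, F {x.1, x.2.1, x.2.2} := by
        rw [ENNReal.tsum_prod']
        exact tsum_congr fun a => (ENNReal.tsum_prod' (f := fun x : Plane × Plane =>
          F {a, x.1, x.2})).symm
    _ = ∑' x : Plane × Plane × Plane, ∑' T : Finset Plane,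
          if T = {x.1, x.2.1, x.2.2} then F T else 0 := tsum_congr fun x => h1 _ _ _
    _ = 6 * ∑' T, F T := by
        rw [ENNReal.tsum_comm, ← ENNReal.tsum_mul_left]
        exact tsum_congr h2

/-- The sum of `w` over the Delaunay triangles that contribute to the energy in `Λ`. -/
def delaunaySum (w : Finset Plane → ℝ≥0∞) (Λ : Set Plane) (γ : Config) : ℝ≥0∞ :=
  ∑' T : Finset Plane, (delaunayTriangles γ Λ).indicator w T

/-- Emptiness of a disc is the vanishing of an integral over the points of the configuration, which
is measurable jointly in all data. -/
theorem Config.measurableSet_disjoint_disc {X : Type*} [MeasurableSpace X] {g : X → Config}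
    (hg : Measurable g) {o : X → Plane} (ho : Measurable o) {R : X → ℝ} (hR : Measurable R) :
    MeasurableSet {x | Disjoint (Metric.ball (o x) (R x)) (g x).carrier} := by
  have hs : MeasurableSet {y : X × Plane | dist y.2 (o y.1) < R y.1} :=
    measurableSet_lt (measurable_snd.dist (ho.comp measurable_fst)) (hR.comp measurable_fst)
  have hm := measurable_lintegral_pointMeasure hg
    ((measurable_const (a := (1 : ℝ≥0∞))).indicator hs)
  have heq : {x | Disjoint (Metric.ball (o x) (R x)) (g x).carrier} =
      {x | ∫⁻ p, {y : X × Plane | dist y.2 (o y.1) < R y.1}.indicator (fun _ => (1 : ℝ≥0∞)) (x, p)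
        ∂(g x).pointMeasure = 0} := by
    ext x
    simp only [Set.mem_ofPred_eq]
    rw [← pointMeasure_eq_zero_iff _ measurableSet_ball]
    have : (fun p => {y : X × Plane | dist y.2 (o y.1) < R y.1}.indicator
        (fun _ => (1 : ℝ≥0∞)) (x, p)) = (Metric.ball (o x) (R x)).indicator fun _ => 1 := by
      ext p; simp [Set.indicator]
    rw [this, lintegral_indicator measurableSet_ball]
    simp
  rw [heq]
  exact hm (measurableSet_singleton 0)

/-- The admissible pairs of centre and radius form an open set, a union over the points of `Λ`, so
nothing is required of `Λ`. -/
theorem measurableSet_ball_inter_nonempty {X : Type*} [MeasurableSpace X] {o : X → Plane}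
    (ho : Measurable o) {R : X → ℝ} (hR : Measurable R) (Λ : Set Plane) :
    MeasurableSet {x | (Metric.ball (o x) (R x) ∩ Λ).Nonempty} := by
  have hopen : IsOpen {y : Plane × ℝ | (Metric.ball y.1 y.2 ∩ Λ).Nonempty} := by
    have : {y : Plane × ℝ | (Metric.ball y.1 y.2 ∩ Λ).Nonempty} =
        ⋃ z ∈ Λ, {y : Plane × ℝ | dist z y.1 < y.2} := by
      ext y
      simp [Set.Nonempty, and_comm]
    rw [this]
    exact isOpen_biUnion fun z _ => isOpen_lt (by fun_prop) (by fun_prop)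
  exact (ho.prodMk hR) hopen.measurableSet

theorem isDelaunay_triple_iff {γ : Config} {a b c : Plane} :
    IsDelaunay γ {a, b, c} ↔ (a ∈ γ.carrier ∧ b ∈ γ.carrier ∧ c ∈ γ.carrier) ∧ det a b c ≠ 0 ∧
      Disjoint (Metric.ball (circumcenter a b c) (dist a (circumcenter a b c))) γ.carrier := by
  constructor
  · intro h
    have ht := h.isEmptyTriangle
    refine ⟨⟨ht.mem_a, ht.mem_b, ht.mem_c⟩, ht.det_ne, ?_⟩
    rw [← ht.circumdisc_eq]
    exact h.2.2.2
  · rintro ⟨⟨ha, hb, hc⟩, hd, hdisj⟩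
    have ht : IsEmptyTriangle γ a b c (circumcenter a b c) :=
      ⟨hd, ha, hb, hc, (dist_circumcenter hd).1, (dist_circumcenter hd).2, fun z hz =>
        not_lt.1 (Set.disjoint_right.1 hdisj hz)⟩
    exact ht.isDelaunay

theorem circumdisc_triple {a b c : Plane} (h : det a b c ≠ 0) :
    circumdisc {a, b, c} = Metric.ball (circumcenter a b c) (dist a (circumcenter a b c)) := by
  rw [circumdisc, circumradius, circumcircle_triple h]

/-- A sum over unordered triangles is one sixth of a threefold integral against the point measure.
Its integrand is `w'`, the expression of `w` through ordered vertices, restricted to the measurable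
set `S`. -/
theorem measurable_delaunaySum {w : Finset Plane → ℝ≥0∞} {w' : Plane → Plane → Plane → ℝ≥0∞}
    (hw' : Measurable fun x : Plane × Plane × Plane => w' x.1 x.2.1 x.2.2)
    (hw : ∀ a b c, det a b c ≠ 0 → w {a, b, c} = w' a b c) (Λ : Set Plane) :
    Measurable (delaunaySum w Λ) := by
  classical
  let S : Set (((Config × Plane) × Plane) × Plane) := {x | det x.1.1.2 x.1.2 x.2 ≠ 0 ∧
    Disjoint (Metric.ball (circumcenter x.1.1.2 x.1.2 x.2)
      (dist x.1.1.2 (circumcenter x.1.1.2 x.1.2 x.2))) x.1.1.1.carrier ∧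
    (Metric.ball (circumcenter x.1.1.2 x.1.2 x.2)
      (dist x.1.1.2 (circumcenter x.1.1.2 x.1.2 x.2)) ∩ Λ).Nonempty}
  have hγ : Measurable fun x : ((Config × Plane) × Plane) × Plane => x.1.1.1 := by fun_prop
  have ha : Measurable fun x : ((Config × Plane) × Plane) × Plane => x.1.1.2 := by fun_prop
  have hb : Measurable fun x : ((Config × Plane) × Plane) × Plane => x.1.2 := by fun_prop
  have hc : Measurable fun x : ((Config × Plane) × Plane) × Plane => x.2 := by fun_prop
  have ho := measurable_circumcenter ha hb hc
  have hR := ha.dist ho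
  have hS : MeasurableSet S :=
    ((measurable_det ha hb hc) (measurableSet_singleton 0)).compl.inter
      ((Config.measurableSet_disjoint_disc hγ ho hR).inter
        (measurableSet_ball_inter_nonempty ho hR Λ))
  let G : ((Config × Plane) × Plane) × Plane → ℝ≥0∞ := 
    S.indicator fun x => w' x.1.1.2 x.1.2 x.2
  have hG : Measurable G := (hw'.comp (ha.prodMk (hb.prodMk hc))).indicator hS
  have m1 := Config.measurable_lintegral_pointMeasure
    (X := (Config × Plane) × Plane) (g := fun x => x.1.1) (by fun_prop) hG
  have m2 := Config.measurable_lintegral_pointMeasure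
    (X := Config × Plane) (g := fun x => x.1) (by fun_prop) m1
  have m3 := Config.measurable_lintegral_pointMeasure
    (X := Config) (g := fun x => x) (by fun_prop) m2
  have key : ∀ γ : Config, ∫⁻ a, ∫⁻ b, ∫⁻ c, G (((γ, a), b), c) ∂γ.pointMeasure ∂γ.pointMeasure
      ∂γ.pointMeasure = 6 * delaunaySum w Λ γ := by
    intro γ
    rw [delaunaySum, ← tsum_triple]
    · rw [Config.lintegral_pointMeasure]
      refine tsum_congr fun a => ?_
      by_cases ha : a ∈ γ.carrier
      swap
      · rw [Set.indicator_of_notMem ha]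
        refine (ENNReal.tsum_eq_zero.2 fun b => ENNReal.tsum_eq_zero.2 fun c => ?_).symm
        exact Set.indicator_of_notMem (fun h => ha (isDelaunay_triple_iff.1 h.1).1.1) _
      rw [Set.indicator_of_mem ha, Config.lintegral_pointMeasure]
      refine tsum_congr fun b => ?_
      by_cases hb : b ∈ γ.carrier
      swap
      · rw [Set.indicator_of_notMem hb]
        refine (ENNReal.tsum_eq_zero.2 fun c => ?_).symm
        exact Set.indicator_of_notMem (fun h => hb (isDelaunay_triple_iff.1 h.1).1.2.1) _
      rw [Set.indicator_of_mem hb, Config.lintegral_pointMeasure]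
      refine tsum_congr fun c => ?_
      by_cases hc : c ∈ γ.carrier
      swap
      · rw [Set.indicator_of_notMem hc]
        exact (Set.indicator_of_notMem
          (fun h => hc (isDelaunay_triple_iff.1 h.1).1.2.2) _).symm
      rw [Set.indicator_of_mem hc]
      by_cases hmem : (((γ, a), b), c) ∈ S
      · have hd : det a b c ≠ 0 := hmem.1
        have : ({a, b, c} : Finset Plane) ∈ delaunayTriangles γ Λ := by
          refine ⟨isDelaunay_triple_iff.2 ⟨⟨ha, hb, hc⟩, hd, hmem.2.1⟩, ?_⟩
          rw [circumdisc_triple hd]; exact hmem.2.2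
        rw [Set.indicator_of_mem this, hw _ _ _ hd]
        exact Set.indicator_of_mem hmem _
      · have : ({a, b, c} : Finset Plane) ∉ delaunayTriangles γ Λ := by
          rintro ⟨h1, h2⟩
          obtain ⟨-, hd, h3⟩ := isDelaunay_triple_iff.1 h1
          rw [circumdisc_triple hd] at h2
          exact hmem ⟨hd, h3, h2⟩
        rw [Set.indicator_of_notMem this]
        exact Set.indicator_of_notMem hmem _
    · intro T hT
      exact (Set.mem_of_indicator_ne_zero hT).1.2.1
  have heq : delaunaySum w Λ = fun γ => 6⁻¹ * ∫⁻ a, ∫⁻ b, ∫⁻ c, G (((γ, a), b), c)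
      ∂γ.pointMeasure ∂γ.pointMeasure ∂γ.pointMeasure := by
    ext γ
    rw [key, ← mul_assoc, ENNReal.inv_mul_cancel (by norm_num) (by norm_num), one_mul]
  rw [heq]
  exact measurable_const.mul m3

/-! ### Measurability of the energy -/

theorem measurable_delaunaySum_perimeter (Λ : Set Plane) :
    Measurable (delaunaySum (fun T => ENNReal.ofReal (perimeter T)) Λ) := by
  refine measurable_delaunaySum
    (w' := fun a b c => ENNReal.ofReal (dist a b + dist b c + dist a c)) (by fun_prop) ?_ Λ
  intro a b c hd
  obtain ⟨h1, h2, h3⟩ := ne_of_det_ne_zero hd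
  rw [perimeter_triple h1 h2 h3]

theorem measurableSet_forall_admissible (r α : ℝ) (Λ : Set Plane) :
    MeasurableSet {γ | ∀ T ∈ delaunayTriangles γ Λ, IsAdmissible r α T} := by
  classical
  -- This sum counts the triangles that violate admissibility; the set in question is where it
  -- vanishes.
  have hm : Measurable (delaunaySum (fun T => if IsAdmissible r α T then 0 else 1) Λ) := by
    refine measurable_delaunaySum (w' := fun a b c =>
      if dist a (circumcenter a b c) < α ∧ r < dist a b ∧ r < dist b c ∧ r < dist a c
        then 0 else 1) ?_ ?_ Λ
    · have ho : Measurable fun x : Plane × Plane × Plane => circumcenter x.1 x.2.1 x.2.2 :=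
        measurable_circumcenter (by fun_prop) (by fun_prop) (by fun_prop)
      refine Measurable.ite ?_ measurable_const measurable_const
      refine (measurableSet_lt (measurable_fst.dist ho) measurable_const).inter ?_
      have h1 : Measurable fun x : Plane × Plane × Plane => dist x.1 x.2.1 := by fun_prop
      have h2 : Measurable fun x : Plane × Plane × Plane => dist x.2.1 x.2.2 := by fun_prop
      have h3 : Measurable fun x : Plane × Plane × Plane => dist x.1 x.2.2 := by fun_prop
      exact (measurableSet_lt measurable_const h1).inter
        ((measurableSet_lt measurable_const h2).inter (measurableSet_lt measurable_const h3))
    · intro a b c hd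
      obtain ⟨h1, h2, h3⟩ := ne_of_det_ne_zero hd
      refine if_congr ?_ rfl rfl
      rw [IsAdmissible, circumradius, circumcircle_triple hd,
        lt_minSide_iff (Finset.card_eq_three.2 ⟨a, b, c, h1, h2, h3, rfl⟩)]
      refine and_congr_right fun _ => ?_
      simp [h1, h2, h3, h1.symm, h2.symm, h3.symm, dist_comm b a, dist_comm c b, dist_comm c a]
      tauto
  have heq : {γ | ∀ T ∈ delaunayTriangles γ Λ, IsAdmissible r α T} =
      {γ | delaunaySum (fun T => if IsAdmissible r α T then 0 else 1) Λ γ = 0} := by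
    ext γ
    simp only [Set.mem_ofPred_eq, delaunaySum, ENNReal.tsum_eq_zero, Set.indicator_apply_eq_zero]
    refine forall_congr' fun T => forall_congr' fun _ => ?_
    by_cases h : IsAdmissible r α T <;> simp [h]
  rw [heq]
  exact hm (measurableSet_singleton 0)

theorem delaunaySum_toReal {r α : ℝ} {γ : Config} {Λ : Set Plane} (hΛ : Bornology.IsBounded Λ)
    (h : ∀ T ∈ delaunayTriangles γ Λ, IsAdmissible r α T) :
    (delaunaySum (fun T => ENNReal.ofReal (perimeter T)) Λ γ).toReal =
      ∑ᶠ T ∈ delaunayTriangles γ Λ, perimeter T := by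
  have hf := finite_delaunayTriangles hΛ h
  rw [finsum_mem_eq_finite_toFinset_sum _ hf, delaunaySum,
    tsum_eq_sum (s := hf.toFinset) (fun T hT => Set.indicator_of_notMem
      (fun h => hT (hf.mem_toFinset.2 h)) _), ENNReal.toReal_sum]
  · refine Finset.sum_congr rfl fun T hT => ?_
    rw [Set.indicator_of_mem (hf.mem_toFinset.1 hT), ENNReal.toReal_ofReal (perimeter_nonneg T)]
  · intro T hT
    rw [Set.indicator_of_mem (hf.mem_toFinset.1 hT)]
    exact ENNReal.ofReal_ne_top

theorem measurable_delaunayEnergy (r α θ : ℝ) {Λ : Set Plane} (hΛ : Bornology.IsBounded Λ) :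
    Measurable (delaunayEnergy r α θ Λ) := by
  classical
  have heq : delaunayEnergy r α θ Λ = fun γ =>
      if ∀ T ∈ delaunayTriangles γ Λ, IsAdmissible r α T then
        ((θ * (delaunaySum (fun T => ENNReal.ofReal (perimeter T)) Λ γ).toReal : ℝ) : EReal)
      else ⊤ := by
    ext γ
    split_ifs with h
    · rw [delaunaySum_toReal hΛ h, delaunayEnergy_eq hΛ h]
    · push Not at h
      obtain ⟨T, hT, hT'⟩ := h
      exact delaunayEnergy_eq_top hT hT'
  rw [heq]
  refine Measurable.ite (measurableSet_forall_admissible r α Λ) ?_ measurable_const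
  exact measurable_coe_real_ereal.comp
    (measurable_const.mul (measurable_delaunaySum_perimeter Λ).ennreal_toReal)

end

noncomputable section

open Plane ProbabilityTheory

/-! ### Gibbs measures -/

namespace Config

theorem count_glue (Λ : Set Plane) (γ' γ : Config) {A : Set Plane} (hA : IsBoundedBorel A) :
    (glue Λ γ' γ).count A = γ'.count (A ∩ Λ) + γ.count (A \ Λ) := by
  have h1 := γ'.locallyFinite (A ∩ Λ) (hA.1.subset Set.inter_subset_left)
  have h2 := γ.locallyFinite (A \ Λ) (hA.1.subset Set.sdiff_subset)
  rw [count, count, count, ← Set.ncard_union_eq _ h1 h2]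
  · congr 1
    ext z
    simp only [glue, Set.mem_inter_iff, Set.mem_union, Set.mem_sdiff]
    tauto
  · exact Set.disjoint_left.2 fun z hz hz' => hz'.2.2 hz.2.2

theorem measurable_glue {Λ : Set Plane} (hΛ : MeasurableSet Λ) :
    Measurable fun p : Config × Config => glue Λ p.1 p.2 := by
  refine measurable_of_count fun A hA => ?_
  simp_rw [count_glue Λ _ _ hA]
  exact ((measurable_count ⟨hA.1.subset Set.inter_subset_left, hA.2.inter hΛ⟩).comp
    measurable_fst).add ((measurable_count ⟨hA.1.subset Set.sdiff_subset, hA.2.diff hΛ⟩).comp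
    measurable_snd)

theorem measurable_addPoint (x : Plane) : Measurable fun γ : Config => γ.addPoint x := by
  refine measurable_of_count fun A hA => ?_
  by_cases hx : x ∈ A
  · have hb : IsBoundedBorel (A \ {x}) :=
      ⟨hA.1.subset Set.sdiff_subset, hA.2.diff (measurableSet_singleton x)⟩
    have : ∀ γ : Config, (γ.addPoint x).count A = γ.count (A \ {x}) + 1 := by
      intro γ
      rw [count, count, ← Set.ncard_insert_of_notMem (a := x) _ (γ.locallyFinite _ hb.1)]
      · congr 1
        ext z
        by_cases hz : z = x
        · simp [addPoint, hz, hx]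
        · simp [addPoint, hz]
      · simp
    simp_rw [this]
    exact (measurable_count hb).add measurable_const
  · have : ∀ γ : Config, (γ.addPoint x).count A = γ.count A := by
      intro γ
      rw [count, count, addPoint, Set.insert_inter_of_notMem hx]
    simp_rw [this]
    exact measurable_count hA

theorem measurableSet_disjoint {A : Set Plane} (hA : MeasurableSet A) :
    MeasurableSet {γ : Config | Disjoint A γ.carrier} := by
  simp_rw [← pointMeasure_eq_zero_iff _ hA]
  exact (Measure.measurable_coe hA).comp measurable_pointMeasure (measurableSet_singleton 0)

end Config

instance (Λ : Set Plane) : SFinite (poissonLaw Λ) := by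
  unfold poissonLaw; infer_instance

/-- One term of the Poisson series suffices: the tuples near `x` form a product of nonempty open
sets, which has positive Lebesgue measure. -/
theorem poissonLaw_lintegral_pos {Λ : Set Plane} (hΛ : IsOpen Λ) {F : Config → ℝ≥0∞}
    (hF : Measurable F) {n : ℕ} {x : Fin n → Plane} (hx : ∀ i, x i ∈ Λ) {η : ℝ} (hη : 0 < η)
    (h : ∀ y : Fin n → Plane, (∀ i, y i ∈ Metric.ball (x i) η ∩ Λ) → 0 < F (Config.ofTuple y)) :
    0 < ∫⁻ γ, F γ ∂poissonLaw Λ := by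
  rw [poissonLaw, lintegral_sum_measure]
  refine lt_of_lt_of_le ?_ (ENNReal.le_tsum n)
  rw [lintegral_smul_measure, lintegral_map hF (Config.measurable_ofTuple n)]
  refine ENNReal.mul_pos ?_ ?_
  · refine (ENNReal.div_pos ?_ (ENNReal.natCast_ne_top _)).ne'
    exact (ENNReal.ofReal_pos.2 (Real.exp_pos _)).ne'
  · refine ((lintegral_pos_iff_support (hF.comp (Config.measurable_ofTuple n))).2 ?_).ne'
    have hsub : Set.univ.pi (fun i => Metric.ball (x i) η ∩ Λ) ⊆
        Function.support (fun y => F (Config.ofTuple y)) := fun y hy =>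
      (h y fun i => hy i (Set.mem_univ i)).ne'
    refine lt_of_lt_of_le ?_ (measure_mono hsub)
    rw [Measure.pi_pi]
    refine (Finset.prod_ne_zero_iff.2 fun i _ => ?_).bot_lt
    have ho : IsOpen (Metric.ball (x i) η ∩ Λ) := Metric.isOpen_ball.inter hΛ
    rw [Measure.restrict_apply ho.measurableSet, Set.inter_assoc, Set.inter_self]
    exact (ho.measure_pos _ ⟨x i, Metric.mem_ball_self hη, hx i⟩).ne'

section
variable {r α θ : ℝ} {μ : Measure Config}

theorem measurable_exp_neg_delaunayEnergy (r α θ : ℝ) {Λ : Set Plane} (hΛ : IsBoundedBorel Λ) :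
    Measurable fun p : Config × Config =>
      EReal.exp (-delaunayEnergy r α θ Λ (Config.glue Λ p.1 p.2)) :=
  EReal.measurable_exp.comp (continuous_neg.measurable.comp
    ((measurable_delaunayEnergy r α θ hΛ.1).comp (Config.measurable_glue hΛ.2)))

theorem measurable_gibbsKernel (r α θ : ℝ) {Λ : Set Plane} (hΛ : IsBoundedBorel Λ)
    {f : Config → ℝ≥0∞} (hf : Measurable f) :
    Measurable (gibbsKernel (delaunayEnergy r α θ) Λ f) := by
  have h := measurable_exp_neg_delaunayEnergy r α θ hΛ
  refine Measurable.mul (Measurable.inv ?_) ?_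
  · exact h.lintegral_prod_left'
  · exact ((hf.comp (Config.measurable_glue hΛ.2)).mul h).lintegral_prod_left'

/-- A null set is not reached by resampling. -/
theorem IsStationaryGibbs.ae_lintegral_eq_zero (hμ : IsStationaryGibbs (delaunayEnergy r α θ) μ)
    {Λ : Set Plane} (hΛ : IsBoundedBorel Λ) {B : Set Config} (hB : MeasurableSet B)
    (h0 : μ B = 0) : ∀ᵐ γ ∂μ, ∫⁻ γ', B.indicator 1 (Config.glue Λ γ' γ) *
      EReal.exp (-delaunayEnergy r α θ Λ (Config.glue Λ γ' γ)) ∂poissonLaw Λ = 0 := by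
  have hf : Measurable (B.indicator (1 : Config → ℝ≥0∞)) := measurable_one.indicator hB
  have h1 := hμ.dlr Λ hΛ _ hf
  rw [lintegral_indicator_one hB, h0, eq_comm,
    lintegral_eq_zero_iff (measurable_gibbsKernel r α θ hΛ hf)] at h1
  filter_upwards [h1, hμ.partitionFunction_pos_lt_top Λ hΛ] with γ h2 h3
  rcases mul_eq_zero.1 h2 with h4 | h4
  -- The prefactor is nonzero because the partition function is finite.
  · exact absurd (ENNReal.inv_eq_zero.1 h4) h3.2.ne
  · exact h4

theorem EReal.exp_neg_pos_iff {x : EReal} : 0 < EReal.exp (-x) ↔ x < ⊤ := by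
  rw [EReal.zero_lt_exp_iff, bot_lt_iff_ne_bot, lt_top_iff_ne_top, Ne, Ne, EReal.neg_eq_bot_iff]

/-- An event that can be reached from almost every configuration has positive probability. -/
theorem IsStationaryGibbs.measure_pos (hμ : IsStationaryGibbs (delaunayEnergy r α θ) μ)
    {Λ : Set Plane} (hΛ : IsBoundedBorel Λ) (hΛo : IsOpen Λ) {B : Set Config}
    (hB : MeasurableSet B) {P : Config → Prop} (hP : ∃ᵐ γ ∂μ, P γ)
    (h : ∀ γ, P γ → ∃ (n : ℕ) (x : Fin n → Plane) (η : ℝ), 0 < η ∧ (∀ i, x i ∈ Λ) ∧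
      ∀ y : Fin n → Plane, (∀ i, y i ∈ Metric.ball (x i) η ∩ Λ) →
        Config.glue Λ (Config.ofTuple y) γ ∈ B ∧
        delaunayEnergy r α θ Λ (Config.glue Λ (Config.ofTuple y) γ) < ⊤) :
    0 < μ B := by
  rw [pos_iff_ne_zero]
  intro h0
  obtain ⟨γ, hγ, hzero⟩ := (hP.and_eventually (hμ.ae_lintegral_eq_zero hΛ hB h0)).exists
  obtain ⟨n, x, η, hη, hx, hy⟩ := h γ hγ
  have hmeas : Measurable fun γ' => B.indicator (1 : Config → ℝ≥0∞) (Config.glue Λ γ' γ) *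
      EReal.exp (-delaunayEnergy r α θ Λ (Config.glue Λ γ' γ)) := by
    have hg : Measurable fun γ' : Config => Config.glue Λ γ' γ :=
      (Config.measurable_glue hΛ.2).comp measurable_prodMk_right
    have h1 : Measurable fun γ' : Config => B.indicator (1 : Config → ℝ≥0∞) (Config.glue Λ γ' γ) :=
      Measurable.comp (measurable_one.indicator hB) hg
    have h2 : Measurable fun γ' : Config =>
        EReal.exp (-delaunayEnergy r α θ Λ (Config.glue Λ γ' γ)) :=
      EReal.measurable_exp.comp
        (continuous_neg.measurable.comp ((measurable_delaunayEnergy r α θ hΛ.1).comp hg))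
    exact h1.mul h2
  have hpos := poissonLaw_lintegral_pos hΛo hmeas hx hη fun y hyi => by
    obtain ⟨h1, h2⟩ := hy y hyi
    rw [Set.indicator_of_mem h1, Pi.one_apply, one_mul]
    exact EReal.exp_neg_pos_iff.2 h2
  exact hpos.ne' hzero

/-- In the DLR equation for the event of infinite energy the weight `exp (-⊤) = 0` kills the
integrand. Balls of integer radius suffice, since each circumcentre lies in one of them. -/
theorem IsStationaryGibbs.ae_mem_finiteEnergyConfigs
    (hμ : IsStationaryGibbs (delaunayEnergy r α θ) μ) :
    ∀ᵐ γ ∂μ, γ ∈ finiteEnergyConfigs (delaunayEnergy r α θ) := by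
  have hball : ∀ n : ℕ, ∀ᵐ γ ∂μ, delaunayEnergy r α θ (Metric.ball 0 n) γ < ⊤ := by
    intro n
    have hΛ := isBoundedBorel_ball 0 n
    have hB : MeasurableSet {γ | delaunayEnergy r α θ (Metric.ball 0 n) γ = ⊤} :=
      measurable_delaunayEnergy r α θ hΛ.1 (measurableSet_singleton ⊤)
    have h1 := hμ.dlr _ hΛ _ (measurable_one.indicator hB)
    rw [lintegral_indicator_one hB] at h1
    have h2 : ∀ γ, gibbsKernel (delaunayEnergy r α θ) (Metric.ball 0 n)
        ({γ | delaunayEnergy r α θ (Metric.ball 0 n) γ = ⊤}.indicator 1) γ = 0 := by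
      intro γ
      refine mul_eq_zero_of_right _ ?_
      refine (lintegral_congr fun γ' => ?_).trans lintegral_zero
      by_cases h : delaunayEnergy r α θ (Metric.ball 0 n) (Config.glue (Metric.ball 0 n) γ' γ) = ⊤
      · rw [h, EReal.neg_top, EReal.exp_bot, mul_zero]
      · rw [Set.indicator_of_notMem (by exact h), zero_mul]
    simp_rw [h2, lintegral_zero] at h1
    rw [ae_iff]
    convert h1 using 3
    ext γ
    simp
  filter_upwards [ae_all_iff.2 hball] with γ hγ
  refine mem_finiteEnergyConfigs_iff.2 fun T hT => ?_
  obtain ⟨n, hn⟩ := exists_nat_gt (dist (circumcircle T).center 0)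
  refine (delaunayEnergy_lt_top_iff Metric.isBounded_ball).1 (hγ n) T ⟨hT, ?_⟩
  exact ⟨_, Metric.mem_ball_self hT.circumradius_pos, hn⟩

/-! ### The points of a stationary configuration are spread over the plane -/

/-- A quadrant whose direction is given by the signs of `u` and `v`. -/
def quadrant (u v : ℤˣ) (N : ℤ) : Set Plane :=
  {z | (N : ℝ) < ((u : ℤ) : ℝ) * z 0 ∧ (N : ℝ) < ((v : ℤ) : ℝ) * z 1}

theorem measurableSet_quadrant (u v : ℤˣ) (N : ℤ) : MeasurableSet (quadrant u v N) := by
  have h0 := Plane.measurable_coord 0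
  have h1 := Plane.measurable_coord 1
  exact (measurableSet_lt measurable_const (h0.const_mul _)).inter
    (measurableSet_lt measurable_const (h1.const_mul _))

theorem Int.cast_units_mul_self (u : ℤˣ) : ((u : ℤ) : ℝ) * ((u : ℤ) : ℝ) = 1 := by
  exact_mod_cast Int.units_coe_mul_self u

/-- By stationarity all diagonal shifts of a quadrant are void with the same probability. As the
quadrant grows to the whole plane, these events decrease to the event of an empty configuration. -/
theorem measure_disjoint_quadrant [IsFiniteMeasure μ]
    (hμ : ∀ y : Plane, MeasurePreserving (Config.translate y) μ μ) (u v : ℤˣ) (N : ℤ) :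
    μ {γ | Disjoint (quadrant u v N) γ.carrier} = μ {γ | γ.carrier = ∅} := by
  have hshift : ∀ t : ℤ, μ {γ | Disjoint (quadrant u v (N - t)) γ.carrier} =
      μ {γ | Disjoint (quadrant u v N) γ.carrier} := by
    intro t
    set y : Plane := !₂[((u : ℤ) : ℝ) * t, ((v : ℤ) : ℝ) * t] with hy
    rw [← (hμ y).measure_preimage
      (Config.measurableSet_disjoint (measurableSet_quadrant u v N)).nullMeasurableSet]
    congr 1
    ext γ
    simp only [Set.mem_ofPred_eq, Set.mem_preimage, Set.disjoint_right, Config.mem_translate]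
    have hmem : ∀ z, z + y ∈ quadrant u v N ↔ z ∈ quadrant u v (N - t) := by
      intro z
      have e0 : ((u : ℤ) : ℝ) * ((z + y) 0) = ((u : ℤ) : ℝ) * z 0 + t := by
        simp only [hy, PiLp.add_apply, Matrix.cons_val_zero]
        linear_combination (t : ℝ) * Int.cast_units_mul_self u
      have e1 : ((v : ℤ) : ℝ) * ((z + y) 1) = ((v : ℤ) : ℝ) * z 1 + t := by
        simp only [hy, PiLp.add_apply, Matrix.cons_val_one, Matrix.cons_val_fin_one]
        linear_combination (t : ℝ) * Int.cast_units_mul_self v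
      simp only [quadrant, Set.mem_ofPred_eq, e0, e1, Int.cast_sub, sub_lt_iff_lt_add]
    constructor
    · intro h z hz hzq
      exact h hz ((hmem _).1 (by rwa [sub_add_cancel]))
    · intro h z hz hzq
      exact h (a := z + y) (by rwa [add_sub_cancel_right]) ((hmem z).2 hzq)
  have hempty : {γ : Config | γ.carrier = ∅} =
      ⋂ n : ℕ, {γ | Disjoint (quadrant u v (N - n)) γ.carrier} := by
    ext γ
    simp only [Set.mem_ofPred_eq, Set.mem_iInter]
    constructor
    · intro h n
      rw [h]; exact Set.disjoint_empty _
    · intro h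
      refine Set.eq_empty_of_forall_notMem fun z hz => ?_
      obtain ⟨n, hn⟩ := exists_nat_gt
        (max (N - ((u : ℤ) : ℝ) * z 0) (N - ((v : ℤ) : ℝ) * z 1))
      rw [max_lt_iff] at hn
      refine Set.disjoint_right.1 (h n) hz ⟨?_, ?_⟩ <;> push_cast <;> linarith [hn.1, hn.2]
  have hanti : Antitone fun n : ℕ => {γ : Config | Disjoint (quadrant u v (N - n)) γ.carrier} := by
    intro m n hmn γ hγ
    refine Set.disjoint_of_subset_left ?_ hγ
    intro z hz
    have : (m : ℝ) ≤ n := by exact_mod_cast hmn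
    refine ⟨?_, ?_⟩ <;> have h1 := hz.1 <;> have h2 := hz.2 <;> push_cast at * <;> linarith
  rw [hempty, hanti.measure_iInter
    (fun n => (Config.measurableSet_disjoint (measurableSet_quadrant u v _)).nullMeasurableSet)
    ⟨0, measure_ne_top μ _⟩]
  simp_rw [hshift, ciInf_const]

theorem measurableSet_carrier_eq_empty : MeasurableSet {γ : Config | γ.carrier = ∅} := by
  have := Config.measurableSet_disjoint (A := Set.univ) MeasurableSet.univ
  simpa using this

theorem ae_meets_quadrant [IsFiniteMeasure μ]
    (hμ : ∀ y : Plane, MeasurePreserving (Config.translate y) μ μ) :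
    ∀ᵐ γ ∂μ, γ.carrier.Nonempty → ∀ u v N, ∃ z ∈ γ.carrier, z ∈ quadrant u v N := by
  have h : ∀ u v N, ∀ᵐ γ ∂μ, γ.carrier.Nonempty → ∃ z ∈ γ.carrier, z ∈ quadrant u v N := by
    intro u v N
    rw [ae_iff]
    have hsub : {γ : Config | γ.carrier = ∅} ⊆ {γ | Disjoint (quadrant u v N) γ.carrier} := by
      intro γ hγ
      rw [Set.mem_ofPred_eq] at *
      rw [hγ]; exact Set.disjoint_empty _
    have h1 := measure_sdiff hsub measurableSet_carrier_eq_empty.nullMeasurableSet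
      (measure_ne_top μ _)
    rw [measure_disjoint_quadrant hμ, tsub_self] at h1
    convert h1 using 2
    ext γ
    simp only [Set.mem_ofPred_eq, Set.mem_sdiff, Set.disjoint_right]
    push Not
    rw [Set.nonempty_iff_ne_empty, and_comm]
  simp only [← ae_all_iff] at h
  filter_upwards [h] with γ hγ hne u v N
  exact hγ u v N hne

theorem exists_unit_mul_eq_abs (x : ℝ) : ∃ u : ℤˣ, ((u : ℤ) : ℝ) * |x| = x := by
  rcases le_total 0 x with h | h
  · exact ⟨1, by simp [abs_of_nonneg h]⟩
  · exact ⟨-1, by simp [abs_of_nonpos h]⟩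

/-- The quadrant with the signs of the coordinates of `e`, shifted beyond `p`, lies in the
half-plane. -/
theorem meetsHalfPlanes_of_quadrant {γ : Config}
    (h : ∀ u v N, ∃ z ∈ γ.carrier, z ∈ quadrant u v N) : MeetsHalfPlanes γ := by
  intro e p he
  obtain ⟨u, hu⟩ := exists_unit_mul_eq_abs (e 0)
  obtain ⟨v, hv⟩ := exists_unit_mul_eq_abs (e 1)
  obtain ⟨N, hN⟩ := exists_int_gt (max (((u : ℤ) : ℝ) * p 0) (((v : ℤ) : ℝ) * p 1))
  rw [max_lt_iff] at hN
  obtain ⟨z, hz, h0, h1⟩ := h u v N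
  refine ⟨z, hz, ?_⟩
  rw [inner_eq, PiLp.sub_apply, PiLp.sub_apply, ← hu, ← hv]
  have e0 : 0 < ((u : ℤ) : ℝ) * (z 0 - p 0) := by linarith [hN.1]
  have e1 : 0 < ((v : ℤ) : ℝ) * (z 1 - p 1) := by linarith [hN.2]
  have hne : 0 < |e 0| ∨ 0 < |e 1| := by
    by_contra! hcon
    exact he (ext_iff.2 ⟨abs_nonpos_iff.1 hcon.1, abs_nonpos_iff.1 hcon.2⟩)
  have k0 := mul_nonneg (abs_nonneg (e 0)) e0.le
  have k1 := mul_nonneg (abs_nonneg (e 1)) e1.le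
  rcases hne with hne | hne
  · have := mul_pos hne e0
    linarith
  · have := mul_pos hne e1
    linarith

/-- Were the empty configuration charged, resampling in the unit ball would produce single points
with positive probability, at finite energy because there are no triangles. But a single point
misses some quadrant, which stationarity forbids. -/
theorem IsStationaryGibbs.ae_nonempty (hμ : IsStationaryGibbs (delaunayEnergy r α θ) μ) :
    ∀ᵐ γ ∂μ, γ.carrier.Nonempty := by
  have := hμ.isProbabilityMeasure
  set B : Set Config := {γ | γ.pointMeasure Set.univ = 1} with hBdef
  have hB : MeasurableSet B :=
    (Measure.measurable_coe MeasurableSet.univ).comp Config.measurable_pointMeasure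
      (measurableSet_singleton 1)
  have hB0 : μ B = 0 := by
    rw [measure_eq_zero_iff_ae_notMem]
    filter_upwards [ae_meets_quadrant hμ.stationary] with γ hγ hγB
    rw [hBdef, Set.mem_ofPred_eq, Config.pointMeasure, Measure.restrict_apply MeasurableSet.univ,
      Set.univ_inter, Measure.count_apply (γ.countable_carrier.measurableSet)] at hγB
    rw [← ENat.toENNReal_one, ENat.toENNReal_inj, Set.encard_eq_one] at hγB
    obtain ⟨p, hp⟩ := hγB
    obtain ⟨N, hN⟩ := exists_int_gt (p 0)
    obtain ⟨z, hz, hzq, -⟩ := hγ (hp ▸ Set.singleton_nonempty p) 1 1 N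
    rw [hp] at hz
    rw [Set.mem_singleton_iff.1 hz] at hzq
    simp at hzq
    linarith
  by_contra hcon
  refine (hμ.measure_pos (isBoundedBorel_ball 0 1) Metric.isOpen_ball hB
    (P := fun γ => γ.carrier = ∅) ?_ ?_).ne' hB0
  · intro h
    refine hcon ?_
    filter_upwards [h] with γ hγ
    exact Set.nonempty_iff_ne_empty.2 hγ
  · intro γ hγ
    refine ⟨1, fun _ => 0, 1, one_pos, fun _ => Metric.mem_ball_self one_pos, fun y hy => ?_⟩
    have hc : (Config.glue (Metric.ball 0 1) (Config.ofTuple y) γ).carrier = {y 0} := by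
      ext z
      simp only [Config.glue, Config.ofTuple, hγ, Set.empty_sdiff, Set.union_empty,
        Set.mem_inter_iff, Set.mem_range, Set.mem_singleton_iff, Fin.exists_fin_one]
      constructor
      · rintro ⟨h, -⟩; exact h.symm
      · rintro rfl; exact ⟨rfl, (hy 0).2⟩
    constructor
    · rw [hBdef, Set.mem_ofPred_eq, Config.pointMeasure, Measure.restrict_apply MeasurableSet.univ,
        Set.univ_inter, hc, Measure.count_singleton]
    · refine (delaunayEnergy_lt_top_iff Metric.isBounded_ball).2 fun T hT => ?_
      obtain ⟨a, b, c, o, rfl, ht⟩ := hT.1.exists_triple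
      have ha := ht.mem_a
      have hb := ht.mem_b
      rw [hc, Set.mem_singleton_iff] at ha hb
      exact absurd (ha.trans hb.symm) (ne_of_det_ne_zero ht.det_ne).1

theorem IsStationaryGibbs.ae_meetsHalfPlanes (hμ : IsStationaryGibbs (delaunayEnergy r α θ) μ) :
    ∀ᵐ γ ∂μ, MeetsHalfPlanes γ := by
  have := hμ.isProbabilityMeasure
  filter_upwards [hμ.ae_nonempty, ae_meets_quadrant hμ.stationary] with γ h1 h2
  exact meetsHalfPlanes_of_quadrant (h2 h1)

end

/-! ### Integrability -/

theorem Config.addPoint_of_mem {γ : Config} {x : Plane} (hx : x ∈ γ.carrier) :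
    γ.addPoint x = γ := by
  ext1; exact Set.insert_eq_of_mem hx

/-- H4 does not exclude configurations containing the origin; on them both sides of
`weightedLocalEnergy_eq` vanish. -/
theorem localEnergy_eq_zero_of_mem {r α θ : ℝ} {γ : Config} {x : Plane} (hx : x ∈ γ.carrier) :
    localEnergy (delaunayEnergy r α θ) x γ = 0 := by
  unfold localEnergy
  split_ifs with h
  · obtain ⟨h1, -, h2⟩ := h.choose_spec
    rw [Config.addPoint_of_mem hx,
      delaunayEnergy_eq h1.1 ((delaunayEnergy_lt_top_iff h1.1).1 h2), ← EReal.coe_sub, sub_self,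
      EReal.coe_zero]
  · rfl

open Classical in
/-- A measurable version of the weighted local energy. -/
def weightedPerimeterVariation (r α t θ : ℝ) (γ : Config) : ℝ :=
  if ∀ T ∈ delaunayTriangles (γ.addPoint 0) (Metric.ball 0 1), IsAdmissible r α T then
    let F := (delaunaySum (fun T => ENNReal.ofReal (perimeter T)) (Metric.ball 0 1)
      (γ.addPoint 0)).toReal -
        (delaunaySum (fun T => ENNReal.ofReal (perimeter T)) (Metric.ball 0 1) γ).toReal
    θ * F * Real.exp (-(t * F))
  else 0

theorem measurable_weightedPerimeterVariation (r α t θ : ℝ) :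
    Measurable (weightedPerimeterVariation r α t θ) := by
  classical
  have hF : Measurable fun γ : Config =>
      (delaunaySum (fun T => ENNReal.ofReal (perimeter T)) (Metric.ball 0 1)
        (γ.addPoint 0)).toReal -
        (delaunaySum (fun T => ENNReal.ofReal (perimeter T)) (Metric.ball 0 1) γ).toReal :=
    (((measurable_delaunaySum_perimeter _).comp (Config.measurable_addPoint 0)).ennreal_toReal).sub
      (measurable_delaunaySum_perimeter _).ennreal_toReal
  refine Measurable.ite ?_ ?_ measurable_const
  · exact Config.measurable_addPoint 0 (measurableSet_forall_admissible r α _)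
  · exact (hF.const_mul θ).mul (Real.measurable_exp.comp (hF.const_mul t).neg)

/-- The local energy chooses its window, so measurability is obtained through this version with the
unit ball. An inadmissible insertion contributes `⊤ * 0 = 0` or its analogue for an infinite
exponent. -/
theorem weightedLocalEnergy_eq {r α t θ : ℝ} {γ : Config}
    (h : γ ∈ finiteEnergyConfigs (delaunayEnergy r α t)) :
    weightedLocalEnergy (delaunayEnergy r) α t θ γ =
      (weightedPerimeterVariation r α t θ γ : EReal) ∧
    (weightedPerimeterVariation r α t θ γ = 0 ∨
      (∀ T ∈ newTriangles γ 0, IsAdmissible r α T) ∧ weightedPerimeterVariation r α t θ γ =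
        θ * perimeterVariation γ 0 * Real.exp (-(t * perimeterVariation γ 0))) := by
  rw [mem_finiteEnergyConfigs_iff] at h
  have hb := isBoundedBorel_ball 0 1
  have hn := Metric.ball_mem_nhds (0 : Plane) one_pos
  have hadm : ∀ T ∈ delaunayTriangles γ (Metric.ball 0 1), IsAdmissible r α T :=
    fun T hT => h T hT.1
  by_cases h0 : (0 : Plane) ∈ γ.carrier
  · have hw : weightedPerimeterVariation r α t θ γ = 0 := by
      rw [weightedPerimeterVariation, Config.addPoint_of_mem h0, if_pos hadm]
      simp
    rw [hw, weightedLocalEnergy, localEnergy_eq_zero_of_mem h0]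
    simp
  have hfin : ∀ θ, delaunayEnergy r α θ (Metric.ball 0 1) γ < ⊤ := fun θ =>
    (delaunayEnergy_lt_top_iff hb.1).2 hadm
  by_cases hnew : ∀ T ∈ newTriangles γ 0, IsAdmissible r α T
  · have hadm' := forall_admissible_addPoint hn hadm hnew
    have hw : weightedPerimeterVariation r α t θ γ =
        θ * perimeterVariation γ 0 * Real.exp (-(t * perimeterVariation γ 0)) := by
      rw [weightedPerimeterVariation, if_pos hadm', delaunaySum_toReal hb.1 hadm',
        delaunaySum_toReal hb.1 hadm, finsum_addPoint_sub h0 hb.1 hn hadm hnew]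
    refine ⟨?_, Or.inr ⟨hnew, hw⟩⟩
    rw [hw, weightedLocalEnergy, localEnergy_of_admissible h0 hb hn (hfin _) hnew,
      localEnergy_of_admissible h0 hb hn (hfin _) hnew, ← EReal.coe_neg, EReal.exp_coe,
      EReal.coe_ennreal_ofReal, max_eq_left (Real.exp_pos _).le, ← EReal.coe_mul]
  · have hadm' : ¬ ∀ T ∈ delaunayTriangles (γ.addPoint 0) (Metric.ball 0 1),
        IsAdmissible r α T := fun h' => hnew fun T hT => h' T (newTriangles_subset hn hT)
    have hw : weightedPerimeterVariation r α t θ γ = 0 := by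
      rw [weightedPerimeterVariation, if_neg hadm']
    refine ⟨?_, Or.inl hw⟩
    rw [hw, weightedLocalEnergy, localEnergy_of_not_admissible (θ := t) h0 hb hn (hfin _) hnew,
      EReal.neg_top, EReal.exp_bot]
    simp

theorem assumptionH4_delaunayEnergy {r : ℝ} (hr : 0 < r) {Θ : Set ℝ} {a₀ t₀ : ℝ} (ha₀ : 0 ≤ a₀)
    {μ : Measure Config} (hμ : IsStationaryGibbs (delaunayEnergy r a₀ t₀) μ) :
    AssumptionH4 Θ (delaunayEnergy r) a₀ t₀ μ := by
  have := hμ.isProbabilityMeasure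
  intro θ _
  have hfin := hμ.ae_mem_finiteEnergyConfigs
  constructor
  · filter_upwards [hfin] with γ hγ
    rw [(weightedLocalEnergy_eq hγ).1]
    exact ⟨EReal.coe_ne_top _, EReal.coe_ne_bot _⟩
  · obtain ⟨C, hC, h⟩ := exists_perimeterVariation_le hr ha₀
    refine Integrable.of_bound (C := |θ| * C * Real.exp (|t₀| * C)) ?_ ?_
    · refine (measurable_weightedPerimeterVariation r a₀ t₀ θ).aestronglyMeasurable.congr ?_
      filter_upwards [hfin] with γ hγ
      rw [(weightedLocalEnergy_eq hγ).1, EReal.toReal_coe]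
    · filter_upwards [hfin] with γ hγ
      rw [(weightedLocalEnergy_eq hγ).1, EReal.toReal_coe, Real.norm_eq_abs]
      rcases (weightedLocalEnergy_eq (θ := θ) hγ).2 with h0 | ⟨hnew, h0⟩
      · rw [h0, abs_zero]; positivity
      · have hF := h γ 0 (mem_finiteEnergyConfigs_iff.1 hγ) hnew
        rw [h0, abs_mul, abs_mul, Real.abs_exp]
        have h1 : -(t₀ * perimeterVariation γ 0) ≤ |t₀| * C := by
          refine (neg_le_abs _).trans ?_
          rw [abs_mul]
          exact mul_le_mul_of_nonneg_left hF (abs_nonneg _)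
        exact mul_le_mul (mul_le_mul_of_nonneg_left hF (abs_nonneg _)) (Real.exp_le_exp.2 h1)
          (Real.exp_pos _).le (by positivity)

end

noncomputable section

open Plane ProbabilityTheory

/-! ### Isolated triples -/

/-- The cross product. -/
def Plane.cross (a b : Plane) : ℝ := a 0 * b 1 - a 1 * b 0

/-- Three points of `γ` that surround the origin, and such that all other points of `γ` lie
outside a disc around the origin and outside three further discs, each of which contains two of
the three points but not the origin. -/
structure IsIsolatedTriple (γ : Config) (p : Fin 3 → Plane) (ρ : ℝ) (c : Fin 3 → Plane)
    (σ : ℝ) : Prop where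
  mem : ∀ i, p i ∈ γ.carrier
  cross_pos : ∀ i, 0 < cross (p i) (p (i + 1))
  norm_lt : ∀ i, ‖p i‖ < ρ
  dist_lt : ∀ i, dist (p i) (c i) < σ
  dist_succ_lt : ∀ i, dist (p (i + 1)) (c i) < σ
  lt_norm : ∀ i, σ < ‖c i‖
  le_norm : ∀ v ∈ γ.carrier, (∀ i, v ≠ p i) → ρ ≤ ‖v‖
  le_dist : ∀ v ∈ γ.carrier, (∀ i, v ≠ p i) → ∀ i, σ ≤ dist v (c i)

/-- The plane is covered by the cones spanned by pairs of points surrounding the origin. -/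
theorem Plane.exists_mem_cone {p : Fin 3 → Plane} (h : ∀ i, 0 < cross (p i) (p (i + 1)))
    (v : Plane) : ∃ i, ∃ s t : ℝ, 0 ≤ s ∧ 0 ≤ t ∧ v = s • p i + t • p (i + 1) := by
  have key : ∃ i, 0 ≤ cross (p i) v ∧ cross (p (i + 1)) v ≤ 0 := by
    by_contra! hcon
    have h0 := h 0
    have h1 := h 1
    have h2 := h 2
    have k0 := hcon 0
    have k1 := hcon 1
    have k2 := hcon 2
    simp only [Fin.isValue, zero_add, Fin.reduceAdd] at h0 h1 h2 k0 k1 k2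
    -- The weights are positive, so the three numbers `cross (p i) v` cannot all have the same
    -- strict sign. Hence a cyclic change from nonnegative to nonpositive occurs.
    have hsum : cross (p 1) (p 2) * cross (p 0) v + cross (p 2) (p 0) * cross (p 1) v +
        cross (p 0) (p 1) * cross (p 2) v = 0 := by
      unfold cross; ring
    rcases le_or_gt 0 (cross (p 0) v) with g0 | g0
    · have g1 := k0 g0
      have g2 := k1 g1.le
      have := mul_nonneg h1.le g0
      have := mul_pos h2 g1
      have := mul_pos h0 g2
      linarith
    · have g2 : cross (p 2) v < 0 := by
        by_contra! hc
        exact absurd (k2 hc) (not_lt.2 g0.le)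
      have g1 : cross (p 1) v < 0 := by
        by_contra! hc
        exact absurd (k1 hc) (not_lt.2 g2.le)
      have := mul_neg_of_pos_of_neg h1 g0
      have := mul_neg_of_pos_of_neg h2 g1
      have := mul_neg_of_pos_of_neg h0 g2
      linarith
  obtain ⟨i, h1, h2⟩ := key
  have hi := h i
  refine ⟨i, -cross (p (i + 1)) v / cross (p i) (p (i + 1)), cross (p i) v / cross (p i) (p (i + 1)),
    div_nonneg (neg_nonneg.2 h2) hi.le, div_nonneg h1 hi.le, ext_iff.2 ⟨?_, ?_⟩⟩ <;>
  · simp only [PiLp.add_apply, PiLp.smul_apply, smul_eq_mul]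
    field_simp
    unfold cross
    ring

/-- If the disc with centre `o` contains the origin and `v`, but not `p` and `q`, while the disc
with centre `c` contains `p` and `q`, but not the origin and `v`, then a point `v` of the cone
spanned by `p` and `q` belongs to the triangle with vertices `0`, `p`, `q`. -/
theorem Plane.add_le_one_of_discs {p q v o c : Plane} {R σ s t : ℝ} (hs : 0 ≤ s) (ht : 0 ≤ t)
    (hv : v = s • p + t • q) (hσ : 0 ≤ σ) (h0 : ‖o‖ ≤ R) (hp : R ≤ dist p o) (hq : R ≤ dist q o)
    (hvo : dist v o ≤ R) (c0 : σ < ‖c‖) (cp : dist p c < σ) (cq : dist q c < σ)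
    (cv : σ ≤ dist v c) : s + t ≤ 1 := by
  have hR : 0 ≤ R := (norm_nonneg o).trans h0
  have e0 := pow_le_pow_left₀ (norm_nonneg o) h0 2
  have ep := pow_le_pow_left₀ hR hp 2
  have eq := pow_le_pow_left₀ hR hq 2
  have ev := pow_le_pow_left₀ dist_nonneg hvo 2
  have f0 := pow_lt_pow_left₀ c0 hσ two_ne_zero
  have fp := pow_lt_pow_left₀ cp dist_nonneg two_ne_zero
  have fq := pow_lt_pow_left₀ cq dist_nonneg two_ne_zero
  have fv := pow_le_pow_left₀ hσ cv 2
  subst hv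
  simp only [Plane.dist_sq, Plane.norm_sq, PiLp.add_apply, PiLp.smul_apply, smul_eq_mul] at *
  by_contra! hst
  -- The power with respect to the disc at `o` minus the power with respect to the disc at `c` is an
  -- affine function. It is negative at `0`, nonnegative at `p` and `q`, and nonpositive at `v`. If
  -- `s + t > 1`, writing `v` in terms of `0`, `p`, `q` makes it positive at `v`.
  have a0 : 0 < (c 0 ^ 2 + c 1 ^ 2 - σ ^ 2) - (o 0 ^ 2 + o 1 ^ 2 - R ^ 2) := by linarith
  have ap : 0 ≤ ((p 0 - o 0) ^ 2 + (p 1 - o 1) ^ 2 - R ^ 2) -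
      ((p 0 - c 0) ^ 2 + (p 1 - c 1) ^ 2 - σ ^ 2) := by linarith
  have aq : 0 ≤ ((q 0 - o 0) ^ 2 + (q 1 - o 1) ^ 2 - R ^ 2) -
      ((q 0 - c 0) ^ 2 + (q 1 - c 1) ^ 2 - σ ^ 2) := by linarith
  have m1 := mul_pos (sub_pos.2 hst) a0
  have m2 := mul_nonneg hs ap
  have m3 := mul_nonneg ht aq
  nlinarith

theorem Plane.sum_cross_smul (p : Fin 3 → Plane) (j : Fin 2) :
    cross (p 1) (p 2) * p 0 j + cross (p 2) (p 0) * p 1 j + cross (p 0) (p 1) * p 2 j = 0 := by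
  fin_cases j <;> simp [cross] <;> ring

namespace IsIsolatedTriple

variable {γ : Config} {p : Fin 3 → Plane} {ρ : ℝ} {c : Fin 3 → Plane} {σ : ℝ}

/-- A disc that contains the origin and none of the three points contains no point of `γ`. -/
theorem exists_eq_of_dist_le (h : IsIsolatedTriple γ p ρ c σ) {o v : Plane} {R : ℝ}
    (h0 : ‖o‖ ≤ R) (hp : ∀ i, R ≤ dist (p i) o) (hv : v ∈ γ.carrier) (hvo : dist v o ≤ R) :
    ∃ i, v = p i := by
  by_contra! hcon
  obtain ⟨i, s, t, hs, ht, hvst⟩ := exists_mem_cone h.cross_pos v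
  have hle := add_le_one_of_discs hs ht hvst (dist_nonneg.trans (h.dist_lt i).le) h0 (hp i)
    (hp (i + 1)) hvo (h.lt_norm i) (h.dist_lt i) (h.dist_succ_lt i) (h.le_dist v hv hcon i)
  -- As `s + t ≤ 1`, the point `v` lies in the triangle with vertices `0`, `p i`, `p (i + 1)`, all
  -- of whose points have norm below `ρ`.
  have h1 := h.le_norm v hv hcon
  have h2 : ‖v‖ ≤ s * ‖p i‖ + t * ‖p (i + 1)‖ := by
    rw [hvst]
    refine (norm_add_le _ _).trans ?_
    rw [norm_smul, norm_smul, Real.norm_of_nonneg hs, Real.norm_of_nonneg ht]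
  have hρ : 0 < ρ := (norm_nonneg _).trans_lt (h.norm_lt 0)
  have h3 := h.norm_lt i
  have h4 := h.norm_lt (i + 1)
  rcases hs.lt_or_eq with hs' | hs'
  · have := mul_lt_mul_of_pos_left h3 hs'
    have := mul_le_mul_of_nonneg_left h4.le ht
    have := mul_le_mul_of_nonneg_right hle hρ.le
    linarith
  · rw [← hs', zero_add] at hle
    rw [← hs', zero_mul, zero_add] at h2
    rcases ht.lt_or_eq with ht' | ht'
    · have := mul_lt_mul_of_pos_left h4 ht'
      have := mul_le_mul_of_nonneg_right hle hρ.le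
      linarith
    · rw [← ht'] at h2
      linarith

theorem ne_zero (h : IsIsolatedTriple γ p ρ c σ) (i : Fin 3) : p i ≠ 0 := by
  intro h0
  have := h.cross_pos i
  simp [cross, h0] at this

theorem ne (h : IsIsolatedTriple γ p ρ c σ) (i : Fin 3) : p i ≠ p (i + 1) := by
  intro h0
  have := h.cross_pos i
  rw [← h0] at this
  simp [cross, mul_comm] at this

theorem zero_notMem (h : IsIsolatedTriple γ p ρ c σ) : (0 : Plane) ∉ γ.carrier := by
  intro h0
  have := h.le_norm 0 h0 fun i => (h.ne_zero i).symm
  rw [norm_zero] at this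
  exact absurd ((norm_nonneg _).trans_lt (h.norm_lt 0)) (not_lt.2 this)

/-- The cross products are barycentric weights of the origin. Averaging the squared distances to `o`
with them shows that the squared radius minus `‖o‖ ^ 2` is the weighted mean of the `‖p i‖ ^ 2`. So
the origin lies inside the circumdisc, whose radius is at least the smallest `‖p i‖`. -/
theorem isEmptyTriangle (h : IsIsolatedTriple γ p ρ c σ) :
    ∃ o, IsEmptyTriangle γ (p 0) (p 1) (p 2) o ∧ ‖o‖ < dist (p 0) o ∧
      ∀ m : ℝ, 0 ≤ m → (∀ i, m ≤ ‖p i‖) → m ≤ dist (p 0) o := by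
  have h0 := h.cross_pos 0
  have h1 := h.cross_pos 1
  have h2 := h.cross_pos 2
  simp only [Fin.isValue, zero_add, Fin.reduceAdd] at h0 h1 h2
  have hdet : det (p 0) (p 1) (p 2) =
      cross (p 1) (p 2) + cross (p 2) (p 0) + cross (p 0) (p 1) := by
    unfold det cross; ring
  have hd : det (p 0) (p 1) (p 2) ≠ 0 := by rw [hdet]; positivity
  obtain ⟨k1, k2⟩ := dist_circumcenter hd
  set o := circumcenter (p 0) (p 1) (p 2) with ho
  have key : (cross (p 1) (p 2) + cross (p 2) (p 0) + cross (p 0) (p 1)) *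
      (dist (p 0) o ^ 2 - ‖o‖ ^ 2) = cross (p 1) (p 2) * ‖p 0‖ ^ 2 +
        cross (p 2) (p 0) * ‖p 1‖ ^ 2 + cross (p 0) (p 1) * ‖p 2‖ ^ 2 := by
    have e1 : dist (p 1) o ^ 2 = dist (p 0) o ^ 2 := by rw [k1]
    have e2 : dist (p 2) o ^ 2 = dist (p 0) o ^ 2 := by rw [k2]
    have s0 := sum_cross_smul p 0
    have s1 := sum_cross_smul p 1
    generalize cross (p 1) (p 2) = A at *
    generalize cross (p 2) (p 0) = B at *
    generalize cross (p 0) (p 1) = C at *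
    simp only [Plane.dist_sq, Plane.norm_sq] at *
    linear_combination (-B) * e1 + (-C) * e2 - 2 * o 0 * s0 - 2 * o 1 * s1
  have hmin : ∀ m : ℝ, 0 ≤ m → (∀ i, m ≤ ‖p i‖) → m ^ 2 ≤ dist (p 0) o ^ 2 - ‖o‖ ^ 2 := by
    intro m hm hmi
    have e0 := pow_le_pow_left₀ hm (hmi 0) 2
    have e1 := pow_le_pow_left₀ hm (hmi 1) 2
    have e2 := pow_le_pow_left₀ hm (hmi 2) 2
    refine le_of_mul_le_mul_left (a := cross (p 1) (p 2) + cross (p 2) (p 0) +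
      cross (p 0) (p 1)) ?_ (by positivity)
    rw [key]
    have := mul_le_mul_of_nonneg_left e0 h1.le
    have := mul_le_mul_of_nonneg_left e1 h2.le
    have := mul_le_mul_of_nonneg_left e2 h0.le
    linarith
  have hlt : ‖o‖ < dist (p 0) o := by
    rw [← sq_lt_sq₀ (norm_nonneg _) dist_nonneg, ← sub_pos]
    refine (mul_pos_iff_of_pos_left (a := cross (p 1) (p 2) + cross (p 2) (p 0) +
      cross (p 0) (p 1)) (by positivity)).1 ?_
    rw [key]
    have e0 := norm_pos_iff.2 (h.ne_zero 0)
    have e1 := norm_pos_iff.2 (h.ne_zero 1)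
    have e2 := norm_pos_iff.2 (h.ne_zero 2)
    positivity
  have hall : ∀ i, dist (p i) o = dist (p 0) o := by
    intro i; fin_cases i
    exacts [rfl, k1, k2]
  refine ⟨o, ⟨hd, h.mem 0, h.mem 1, h.mem 2, k1, k2, fun z hz => ?_⟩, hlt, fun m hm hmi => ?_⟩
  · by_contra! hz'
    obtain ⟨i, rfl⟩ := h.exists_eq_of_dist_le hlt.le (fun i => (hall i).ge) hz hz'.le
    rw [hall i] at hz'
    exact lt_irrefl _ hz'
  · rw [← sq_le_sq₀ hm dist_nonneg]
    have := hmin m hm hmi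
    have := sq_nonneg ‖o‖
    linarith

/-- The same barycentric relation puts the third point outside the circle through `0`, `p i`, `p (i
+ 1)`. A disc avoiding all three points but touching the origin avoids the rest of `γ`. -/
theorem isEmptyTriangle_addPoint (h : IsIsolatedTriple γ p ρ c σ) (i : Fin 3) :
    ∃ o, IsEmptyTriangle (γ.addPoint 0) 0 (p i) (p (i + 1)) o := by
  have h0 := h.cross_pos i
  have h1 := h.cross_pos (i + 1)
  have h2 := h.cross_pos (i + 2)
  have e2 : i + 1 + 1 = i + 2 := by fin_cases i <;> rfl
  have e3 : i + 2 + 1 = i := by fin_cases i <;> rfl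
  rw [e2] at h1
  rw [e3] at h2
  have hd : det 0 (p i) (p (i + 1)) ≠ 0 := by
    have : det 0 (p i) (p (i + 1)) = cross (p i) (p (i + 1)) := by simp [det, cross]
    rw [this]; exact h0.ne'
  obtain ⟨k1, k2⟩ := dist_circumcenter hd
  set o := circumcenter 0 (p i) (p (i + 1)) with ho
  have hthird : dist 0 o ≤ dist (p (i + 2)) o := by
    rw [← sq_le_sq₀ dist_nonneg dist_nonneg]
    have e1 : dist (p i) o ^ 2 = dist 0 o ^ 2 := by rw [k1]
    have e2 : dist (p (i + 1)) o ^ 2 = dist 0 o ^ 2 := by rw [k2]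
    have s0 : cross (p (i + 1)) (p (i + 2)) * p i 0 + cross (p (i + 2)) (p i) * p (i + 1) 0 +
        cross (p i) (p (i + 1)) * p (i + 2) 0 = 0 := by unfold cross; ring
    have s1 : cross (p (i + 1)) (p (i + 2)) * p i 1 + cross (p (i + 2)) (p i) * p (i + 1) 1 +
        cross (p i) (p (i + 1)) * p (i + 2) 1 = 0 := by unfold cross; ring
    generalize cross (p (i + 1)) (p (i + 2)) = A at *
    generalize cross (p (i + 2)) (p i) = B at *
    generalize cross (p i) (p (i + 1)) = C at *
    simp only [Plane.dist_sq, PiLp.zero_apply] at *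
    refine le_of_mul_le_mul_left (a := C) ?_ h0
    have m1 := mul_nonneg h1.le (add_nonneg (sq_nonneg (p i 0)) (sq_nonneg (p i 1)))
    have m2 := mul_nonneg h2.le (add_nonneg (sq_nonneg (p (i + 1) 0)) (sq_nonneg (p (i + 1) 1)))
    have m3 := mul_nonneg h0.le (add_nonneg (sq_nonneg (p (i + 2) 0)) (sq_nonneg (p (i + 2) 1)))
    have id1 : C * ((p (i + 2) 0 - o 0) ^ 2 + (p (i + 2) 1 - o 1) ^ 2) -
        C * ((0 - o 0) ^ 2 + (0 - o 1) ^ 2) = A * (p i 0 ^ 2 + p i 1 ^ 2) +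
          B * (p (i + 1) 0 ^ 2 + p (i + 1) 1 ^ 2) +
          C * (p (i + 2) 0 ^ 2 + p (i + 2) 1 ^ 2) := by
      linear_combination (-2 * o 0) * s0 + (-2 * o 1) * s1 - A * e1 - B * e2
    linarith
  have hall : ∀ j, dist 0 o ≤ dist (p j) o := by
    intro j
    have hcases : ∀ i j : Fin 3, j = i ∨ j = i + 1 ∨ j = i + 2 := by decide
    rcases hcases i j with rfl | rfl | rfl
    exacts [k1.ge, k2.ge, hthird]
  refine ⟨o, hd, Set.mem_insert _ _, Set.mem_insert_of_mem _ (h.mem _),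
    Set.mem_insert_of_mem _ (h.mem _), k1, k2, ?_⟩
  rintro z (rfl | hz)
  · exact le_rfl
  · by_contra! hz'
    obtain ⟨j, rfl⟩ := h.exists_eq_of_dist_le (by rw [dist_zero_left]) hall hz hz'.le
    exact absurd hz' (not_lt.2 (hall j))

theorem mem_of_mem_newTriangles (h : IsIsolatedTriple γ p ρ c σ) {T : Finset Plane}
    (hT : T ∈ newTriangles γ 0) {v : Plane} (hv : v ∈ T) : v = 0 ∨ ∃ i, v = p i := by
  have hv' := hT.1.1 hv
  rcases hv' with hv' | hv'
  · exact Or.inl hv'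
  obtain ⟨a, b, o, rfl, ht⟩ := hT.1.exists_triple_of_mem hT.2
  refine Or.inr (h.exists_eq_of_dist_le (o := o) (R := dist 0 o) (by rw [dist_zero_left])
    (fun i => ht.le_dist _ (Set.mem_insert_of_mem _ (h.mem i))) hv' ?_)
  simp only [Finset.mem_insert, Finset.mem_singleton] at hv
  rcases hv with rfl | rfl | rfl
  exacts [le_rfl, ht.dist_b.le, ht.dist_c.le]

theorem eq_of_mem_oldTriangles (h : IsIsolatedTriple γ p ρ c σ) {T : Finset Plane}
    (hT : T ∈ oldTriangles γ 0) : T = {p 0, p 1, p 2} := by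
  obtain ⟨a, b, d, o, rfl, ht⟩ := hT.1.exists_triple
  have h0 : ‖o‖ ≤ dist a o := by
    have := hT.2
    rw [ht.circumdisc_eq, Metric.mem_ball, dist_zero_left] at this
    exact this.le
  have hex : ∀ v ∈ ({a, b, d} : Finset Plane), v ∈ ({p 0, p 1, p 2} : Finset Plane) := by
    intro v hv
    obtain ⟨i, rfl⟩ := h.exists_eq_of_dist_le h0 (fun i => ht.le_dist _ (h.mem i)) (hT.1.1 hv) (by
      simp only [Finset.mem_insert, Finset.mem_singleton] at hv
      rcases hv with rfl | rfl | rfl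
      exacts [le_rfl, ht.dist_b.le, ht.dist_c.le])
    fin_cases i <;> simp
  refine Finset.eq_of_subset_of_card_le hex ?_
  rw [hT.1.2.1]
  exact Finset.card_le_three

/-- The insertion of the origin increases the total perimeter. -/
theorem perimeterVariation_pos (h : IsIsolatedTriple γ p ρ c σ) :
    0 < perimeterVariation γ 0 := by
  classical
  have n01 : p 0 ≠ p 1 := h.ne 0
  have n12 : p 1 ≠ p 2 := h.ne 1
  have n20 : p 2 ≠ p 0 := h.ne 2
  have z0 := h.ne_zero 0
  have z1 := h.ne_zero 1
  have z2 := h.ne_zero 2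
  have hold : ∑ᶠ T ∈ oldTriangles γ 0, perimeter T ≤ perimeter {p 0, p 1, p 2} := by
    rcases Set.subset_singleton_iff_eq.1
      (show oldTriangles γ 0 ⊆ {{p 0, p 1, p 2}} from fun T hT => h.eq_of_mem_oldTriangles hT)
      with he | he
    · rw [he, finsum_mem_empty]; exact perimeter_nonneg _
    · rw [he, finsum_mem_singleton]
  have hfin : (newTriangles γ 0).Finite := by
    refine (({0, p 0, p 1, p 2} : Finset Plane).powerset.finite_toSet).subset fun T hT => ?_
    simp only [Finset.coe_powerset, Set.mem_preimage, Set.mem_powerset_iff]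
    intro v hv
    rcases h.mem_of_mem_newTriangles hT hv with rfl | ⟨i, rfl⟩
    · simp
    · fin_cases i <;> simp
  have hmem : ∀ i, ({0, p i, p (i + 1)} : Finset Plane) ∈ newTriangles γ 0 := by
    intro i
    obtain ⟨o, ho⟩ := h.isEmptyTriangle_addPoint i
    exact ⟨ho.isDelaunay, by simp⟩
  have hinj : Function.Injective fun i : Fin 3 => ({0, p i, p (i + 1)} : Finset Plane) := by
    have aux : ∀ i j : Fin 3, i ≠ j → p (i + 2) ∈ ({0, p j, p (j + 1)} : Finset Plane) := by
      intro i j hij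
      have : i + 2 = j ∨ i + 2 = j + 1 := by revert i j; decide
      rcases this with h1 | h1 <;> rw [h1] <;> simp
    intro i j hij
    by_contra hne
    have h1 := aux i j hne
    have hij' : ({0, p i, p (i + 1)} : Finset Plane) = {0, p j, p (j + 1)} := hij
    rw [← hij'] at h1
    have e1 : p (i + 2) ≠ p i := by
      have := h.ne (i + 2)
      have e3 : i + 2 + 1 = i := by fin_cases i <;> rfl
      rwa [e3] at this
    have e2 : p (i + 2) ≠ p (i + 1) := by
      have := h.ne (i + 1)
      have e3 : i + 1 + 1 = i + 2 := by fin_cases i <;> rfl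
      rw [e3] at this
      exact this.symm
    simp [h.ne_zero, e1, e2] at h1
  -- Three distinct new triangles contain each old side once and each segment from the origin to `p
  -- i` twice, a gain of `2 * ∑ ‖p i‖`. A lower bound is enough, so they need not be shown to be
  -- all.
  have hnew : ∑ i : Fin 3, perimeter {0, p i, p (i + 1)} ≤
      ∑ᶠ T ∈ newTriangles γ 0, perimeter T := by
    rw [finsum_mem_eq_finite_toFinset_sum _ hfin,
      ← Finset.sum_image (f := perimeter) (g := fun i : Fin 3 => ({0, p i, p (i + 1)} :
        Finset Plane)) (fun i _ j _ hij => hinj hij)]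
    refine Finset.sum_le_sum_of_subset_of_nonneg ?_ fun T _ _ => perimeter_nonneg T
    intro T hT
    obtain ⟨i, -, rfl⟩ := Finset.mem_image.1 hT
    exact hfin.mem_toFinset.2 (hmem i)
  have hper : ∀ i, perimeter {0, p i, p (i + 1)} =
      ‖p i‖ + dist (p i) (p (i + 1)) + ‖p (i + 1)‖ := by
    intro i
    rw [perimeter_triple (h.ne_zero i).symm (h.ne_zero _).symm (h.ne i), dist_zero_left,
      dist_zero_left]
  rw [Fin.sum_univ_three, hper, hper, hper] at hnew
  simp only [Fin.isValue, zero_add, Fin.reduceAdd] at hnew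
  rw [perimeter_triple n01 n20.symm n12] at hold
  rw [dist_comm (p 2) (p 0)] at hnew
  have := norm_pos_iff.2 z0
  have := norm_nonneg (p 1)
  have := norm_nonneg (p 2)
  rw [perimeterVariation]
  linarith

end IsIsolatedTriple

end

noncomputable section

open Plane ProbabilityTheory

/-! ### Local modifications of configurations -/

theorem exists_maximal_separated {ρ : ℝ} (hρ : 0 < ρ) {Y : Set Plane} (hY : Bornology.IsBounded Y) :
    ∃ S : Finset Plane, ↑S ⊆ Y ∧ (∀ p ∈ S, ∀ q ∈ S, p ≠ q → ρ ≤ dist p q) ∧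
      ∀ z ∈ Y, ∃ s ∈ S, dist z s < ρ := by
  classical
  obtain ⟨A, hA⟩ := hY.subset_closedBall 0
  -- The packing bound asks for strict separation, hence `ρ / 2`.
  obtain ⟨M, hM⟩ := exists_card_le_of_separated (half_pos hρ) A
  set V : Set ℕ := {n | ∃ S : Finset Plane, (↑S ⊆ Y ∧ ∀ p ∈ S, ∀ q ∈ S, p ≠ q → ρ ≤ dist p q) ∧
    S.card = n} with hV
  have hbdd : BddAbove V := by
    refine ⟨M, ?_⟩
    rintro n ⟨S, ⟨h1, h2⟩, rfl⟩
    exact hM 0 S (fun p hp => hA (h1 hp)) fun p hp q hq hpq =>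
      (half_lt_self hρ).trans_le (h2 p hp q hq hpq)
  obtain ⟨S, ⟨h1, h2⟩, h3⟩ := Nat.sSup_mem (s := V) ⟨0, ∅, by simp, rfl⟩ hbdd
  refine ⟨S, h1, h2, fun z hz => ?_⟩
  by_contra! hcon
  have hzS : z ∉ S := fun h => by
    have := hcon z h
    rw [dist_self] at this
    linarith
  have hmem : S.card + 1 ∈ V := by
    refine ⟨insert z S, ⟨?_, ?_⟩, Finset.card_insert_of_notMem hzS⟩
    · rw [Finset.coe_insert]; exact Set.insert_subset hz h1
    · intro p hp q hq hpq
      rcases Finset.mem_insert.1 hp with rfl | hp' <;> rcases Finset.mem_insert.1 hq with rfl | hq'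
      · exact absurd rfl hpq
      · exact hcon q hq'
      · rw [dist_comm]; exact hcon p hp'
      · exact h2 p hp' q hq' hpq
  have := le_csSup hbdd hmem
  omega

/-- Inside a ball, a configuration can be replaced by one that contains prescribed points, without
creating large holes. -/
theorem exists_modified_config {γ : Config} {r ρ a L₀ : ℝ} (hρ : 0 < ρ) (hrρ : r < ρ)
    (hρa : ρ < a)
    (hsep : ∀ p ∈ γ.carrier, ∀ q ∈ γ.carrier, p ≠ q → r < dist p q)
    (hcov : ∀ c, ∃ z ∈ γ.carrier, dist z c < a)
    {Q U : Set Plane} (hQfin : Q.Finite) (hQ : Q ⊆ Metric.ball 0 L₀)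
    (hQsep : ∀ p ∈ Q, ∀ q ∈ Q, p ≠ q → ρ ≤ dist p q)
    (hU : U ⊆ Metric.ball 0 L₀) (hUcov : ∀ z ∈ U, ∃ q ∈ Q, dist q z < a) :
    ∃ N : Config, N.carrier \ Metric.ball 0 (L₀ + ρ + a + 1) =
        γ.carrier \ Metric.ball 0 (L₀ + ρ + a + 1) ∧
      Q ⊆ N.carrier ∧ N.carrier ∩ U ⊆ Q ∧
      (∀ p ∈ N.carrier, ∀ q ∈ N.carrier, p ≠ q → r < dist p q) ∧
      ∀ c, ∃ z ∈ N.carrier, dist z c < a := by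
  -- The gap between radii `L₀` and `L₀ + ρ` separates `Q` from the retained part of `γ`. Filler
  -- points from `Y` then close the holes. They range up to radius `L₀ + ρ + a`: beyond it, the
  -- point of `γ` within distance `a` lies outside the ball of radius `L₀ + ρ` and has been
  -- retained.
  set G : Set Plane := Q ∪ (γ.carrier \ Metric.ball 0 (L₀ + ρ)) with hG
  set Y : Set Plane := {z | z ∈ Metric.closedBall 0 (L₀ + ρ + a) ∧ z ∉ U ∧ ∀ g ∈ G, ρ ≤ dist z g}
    with hY
  obtain ⟨S, hSY, hSsep, hSmax⟩ := exists_maximal_separated hρ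
    (Metric.isBounded_closedBall.subset (show Y ⊆ Metric.closedBall 0 (L₀ + ρ + a) from
      fun z hz => hz.1))
  have hfin : ∀ Λ : Set Plane, Bornology.IsBounded Λ → ((G ∪ ↑S) ∩ Λ).Finite := by
    intro Λ hΛ
    refine ((hQfin.union (γ.locallyFinite Λ hΛ)).union S.finite_toSet).subset ?_
    rintro z ⟨(hz | hz) | hz, hzΛ⟩
    exacts [Or.inl (Or.inl hz), Or.inl (Or.inr ⟨hz.1, hzΛ⟩), Or.inr hz]
  have hlt : ∀ {x y : ℝ}, ρ ≤ x → r < x := fun h => hrρ.trans_le h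
  have hQγ : ∀ p ∈ Q, ∀ q ∈ γ.carrier \ Metric.ball 0 (L₀ + ρ), ρ ≤ dist p q := by
    intro p hp q hq
    have h1 := Metric.mem_ball.1 (hQ hp)
    have h2 : L₀ + ρ ≤ dist q 0 := not_lt.1 hq.2
    have h3 := dist_triangle_left q 0 p
    linarith
  refine ⟨⟨G ∪ ↑S, hfin⟩, ?_, fun z hz => Or.inl (Or.inl hz), ?_, ?_, ?_⟩
  · ext z
    simp only [Set.mem_sdiff, Metric.mem_ball, not_lt, Set.mem_union, Finset.mem_coe]
    refine and_congr_left fun hz => ⟨?_, fun h => Or.inl (Or.inr ⟨h, fun h' => ?_⟩)⟩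
    · rintro ((h | h) | h)
      · have := Metric.mem_ball.1 (hQ h)
        linarith
      · exact h.1
      · have := Metric.mem_closedBall.1 (hSY h).1
        linarith
    · have := Metric.mem_ball.1 h'
      linarith
  · rintro z ⟨(h | h) | h, hzU⟩
    · exact h
    · refine absurd (Metric.ball_subset_ball ?_ (hU hzU)) h.2
      linarith
    · exact absurd hzU (hSY h).2.1
  · have hGG : ∀ p ∈ G, ∀ q ∈ G, p ≠ q → r < dist p q := by
      rintro p (hp | hp) q (hq | hq) hpq
      · exact hrρ.trans_le (hQsep p hp q hq hpq)
      · exact hrρ.trans_le (hQγ p hp q hq)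
      · rw [dist_comm]; exact hrρ.trans_le (hQγ q hq p hp)
      · exact hsep p hp.1 q hq.1 hpq
    rintro p (hp | hp) q (hq | hq) hpq
    · exact hGG p hp q hq hpq
    · rw [dist_comm]; exact hrρ.trans_le ((hSY hq).2.2 p hp)
    · exact hrρ.trans_le ((hSY hp).2.2 q hq)
    · exact hrρ.trans_le (hSsep p hp q hq hpq)
  · intro c
    by_cases hc : dist c 0 ≤ L₀ + ρ + a
    · by_cases hcU : c ∈ U
      · obtain ⟨q, hq, hqc⟩ := hUcov c hcU
        exact ⟨q, Or.inl (Or.inl hq), hqc⟩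
      by_cases hcG : ∀ g ∈ G, ρ ≤ dist c g
      · obtain ⟨s, hs, hcs⟩ := hSmax c ⟨hc, hcU, hcG⟩
        exact ⟨s, Or.inr hs, by rw [dist_comm]; linarith⟩
      · push Not at hcG
        obtain ⟨g, hg, hcg⟩ := hcG
        exact ⟨g, Or.inl hg, by rw [dist_comm]; linarith⟩
    · obtain ⟨z, hz, hzc⟩ := hcov c
      refine ⟨z, Or.inl (Or.inr ⟨hz, fun h => hc ?_⟩), hzc⟩
      have h1 := Metric.mem_ball.1 h
      have h2 := dist_triangle_left c 0 z
      linarith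

theorem exists_cover_margin {N : Config} {a : ℝ} (hcov : ∀ c, ∃ z ∈ N.carrier, dist z c < a)
    (A : ℝ) : ∃ δ > 0, ∀ c ∈ Metric.closedBall (0 : Plane) A, ∃ z ∈ N.carrier, dist z c < a - δ := by
  have hne : N.carrier.Nonempty := by
    obtain ⟨z, hz, -⟩ := hcov 0
    exact ⟨z, hz⟩
  have hlt : ∀ c, Metric.infDist c N.carrier < a := by
    intro c
    obtain ⟨z, hz, hzc⟩ := hcov c
    rw [dist_comm] at hzc
    exact (Metric.infDist_le_dist_of_mem hz).trans_lt hzc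
  -- The distance to the configuration is continuous and attains its maximum on the compact ball.
  obtain ⟨m, hm, hmax⟩ : ∃ m < a, ∀ c ∈ Metric.closedBall (0 : Plane) A,
      Metric.infDist c N.carrier ≤ m := by
    rcases (Metric.closedBall (0 : Plane) A).eq_empty_or_nonempty with he | hn
    · exact ⟨a - 1, by linarith, by simp [he]⟩
    · obtain ⟨c, -, hc⟩ := (isCompact_closedBall (0 : Plane) A).exists_isMaxOn hn
        (Metric.continuous_infDist_pt N.carrier).continuousOn
      exact ⟨_, hlt c, fun c' hc' => hc hc'⟩
  refine ⟨(a - m) / 2, by linarith, fun c hc => ?_⟩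
  have h1 : Metric.infDist c N.carrier < a - (a - m) / 2 := by
    have := hmax c hc
    linarith
  obtain ⟨z, hz, hzc⟩ := (Metric.infDist_lt_iff hne).1 h1
  exact ⟨z, hz, by rwa [dist_comm]⟩

/-- Only finitely many pairs are involved. The margin is `2 * δ` because both points of a pair may
be moved by `δ`. -/
theorem exists_separation_margin {N : Config} {r : ℝ}
    (hsep : ∀ p ∈ N.carrier, ∀ q ∈ N.carrier, p ≠ q → r < dist p q) (A : ℝ) :
    ∃ δ > 0, ∀ p ∈ N.carrier ∩ Metric.ball 0 A, ∀ q ∈ N.carrier ∩ Metric.ball 0 A,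
      p ≠ q → r + 2 * δ < dist p q := by
  have hfin := N.locallyFinite (Metric.ball 0 A) Metric.isBounded_ball
  have h : ∀ᶠ δ : ℝ in 𝓝[>] 0, ∀ p ∈ N.carrier ∩ Metric.ball 0 A,
      ∀ q ∈ N.carrier ∩ Metric.ball 0 A, p ≠ q → r + 2 * δ < dist p q := by
    refine (eventually_all_finite hfin).2 fun p hp => (eventually_all_finite hfin).2 fun q hq => ?_
    by_cases hpq : p = q
    · simp [hpq]
    have ht : Tendsto (fun δ : ℝ => r + 2 * δ) (𝓝[>] 0) (𝓝 r) := by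
      have hc : Continuous fun δ : ℝ => r + 2 * δ := by fun_prop
      have := hc.tendsto 0
      simp only [mul_zero, add_zero] at this
      exact this.mono_left nhdsWithin_le_nhds
    filter_upwards [ht.eventually_lt_const (hsep p hp.1 q hq.1 hpq)] with δ hδ _
    exact hδ
  obtain ⟨δ, hδ, hδ0⟩ := (h.and self_mem_nhdsWithin).exists
  exact ⟨δ, hδ0, hδ⟩

/-- A disc that is larger than `a` and meets a ball contains a disc of radius `a` centred near that
ball. -/
theorem exists_closedBall_center {o w : Plane} {s a L : ℝ} (ha : 0 < a) (has : a ≤ s)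
    (hw : dist w o < s) (hwL : dist w 0 < L) :
    ∃ c ∈ Metric.closedBall (0 : Plane) (L + a), ∀ z, dist z c < a → dist z o < s := by
  have hs : 0 < s := ha.trans_le has
  -- The new centre divides the segment from `o` to `w` so that it is within `s - a` of `o`, which
  -- keeps the small disc inside, and within `a` of `w`.
  have h1 : dist (AffineMap.lineMap o w ((s - a) / s)) o ≤ s - a := by
    rw [dist_lineMap_left, Real.norm_of_nonneg (div_nonneg (by linarith) hs.le), dist_comm o w]
    rw [div_mul_eq_mul_div, div_le_iff₀ hs]
    exact mul_le_mul_of_nonneg_left hw.le (by linarith)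
  have h2 : dist (AffineMap.lineMap o w ((s - a) / s)) w ≤ a := by
    have he : 1 - (s - a) / s = a / s := by field_simp; ring
    rw [dist_lineMap_right, he, Real.norm_of_nonneg (by positivity), dist_comm o w,
      div_mul_eq_mul_div, div_le_iff₀ hs]
    exact mul_le_mul_of_nonneg_left hw.le ha.le
  refine ⟨AffineMap.lineMap o w ((s - a) / s), ?_, fun z hz => ?_⟩
  · rw [Metric.mem_closedBall]
    have := dist_triangle (AffineMap.lineMap o w ((s - a) / s)) w 0
    linarith
  · have := dist_triangle z (AffineMap.lineMap o w ((s - a) / s)) o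
    linarith

/-- Small displacements of the points in a ball preserve hard core conditions. -/
theorem exists_perturbation {N γ : Config} {r a L ε : ℝ} (hε : 0 < ε) (ha : 0 < a)
    (hout : N.carrier \ Metric.ball 0 L = γ.carrier \ Metric.ball 0 L)
    (hsep : ∀ p ∈ N.carrier, ∀ q ∈ N.carrier, p ≠ q → r < dist p q)
    (hcov : ∀ c, ∃ z ∈ N.carrier, dist z c < a) :
    ∃ (n : ℕ) (x : Fin n → Plane) (η : ℝ), 0 < η ∧ (∀ i, x i ∈ Metric.ball 0 L) ∧
      ∀ y : Fin n → Plane, (∀ i, y i ∈ Metric.ball (x i) η ∩ Metric.ball 0 L) →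
        (∀ A ∈ (Config.glue (Metric.ball 0 L) (Config.ofTuple y) γ).carrier,
          ∃ z ∈ N.carrier, dist A z < ε) ∧
        (∀ z ∈ N.carrier,
          ∃ A ∈ (Config.glue (Metric.ball 0 L) (Config.ofTuple y) γ).carrier, dist A z < ε) ∧
        (∀ A ∈ (Config.glue (Metric.ball 0 L) (Config.ofTuple y) γ).carrier,
          ∀ B ∈ (Config.glue (Metric.ball 0 L) (Config.ofTuple y) γ).carrier,
            A ≠ B → r < dist A B) ∧
        ∀ T ∈ delaunayTriangles (Config.glue (Metric.ball 0 L) (Config.ofTuple y) γ)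
          (Metric.ball 0 L), IsAdmissible r a T := by
  -- Moved points stay in the ball of radius `L`, so fixed points beyond `L + (r + 1)` cannot come
  -- too close to them; only a bounded region needs a margin.
  obtain ⟨δ₁, hδ₁, hsep'⟩ := exists_separation_margin hsep (L + (r + 1))
  obtain ⟨δ₂, hδ₂, hcov'⟩ := exists_cover_margin hcov (L + a)
  set η := min ε (min (min δ₁ δ₂) 1) with hη
  have hη0 : 0 < η := lt_min hε (lt_min (lt_min hδ₁ hδ₂) one_pos)
  have hηε : η ≤ ε := min_le_left _ _
  have hη1 : η ≤ δ₁ := (min_le_right _ _).trans ((min_le_left _ _).trans (min_le_left _ _))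
  have hη2 : η ≤ δ₂ := (min_le_right _ _).trans ((min_le_left _ _).trans (min_le_right _ _))
  have hfin := N.locallyFinite (Metric.ball 0 L) Metric.isBounded_ball
  set F := hfin.toFinset with hF
  set x : Fin F.card → Plane := fun i => (F.equivFin.symm i).1 with hx
  have hxmem : ∀ i, x i ∈ N.carrier ∩ Metric.ball 0 L := fun i =>
    hfin.mem_toFinset.1 (F.equivFin.symm i).2
  have hxinj : Function.Injective x := fun i j hij => F.equivFin.symm.injective (Subtype.ext hij)
  have hxsurj : ∀ z ∈ N.carrier, z ∈ Metric.ball 0 L → ∃ i, x i = z := fun z hz hzL =>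
    ⟨F.equivFin ⟨z, hfin.mem_toFinset.2 ⟨hz, hzL⟩⟩, by simp [hx]⟩
  refine ⟨F.card, x, η, hη0, fun i => (hxmem i).2, fun y hy => ?_⟩
  set N' := Config.glue (Metric.ball 0 L) (Config.ofTuple y) γ with hN'
  have hyx : ∀ i, dist (y i) (x i) < η := fun i => Metric.mem_ball.1 (hy i).1
  have hmem : ∀ A, A ∈ N'.carrier ↔ (∃ i, y i = A) ∨ (A ∈ N.carrier ∧ A ∉ Metric.ball 0 L) := by
    intro A
    have h1 : A ∈ γ.carrier \ Metric.ball 0 L ↔ A ∈ N.carrier \ Metric.ball 0 L := by rw [hout]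
    simp only [hN', Config.glue, Config.ofTuple, Set.mem_union, h1, Set.mem_inter_iff,
      Set.mem_range, Set.mem_sdiff]
    refine or_congr_left ⟨fun h => h.1, fun h => ⟨h, ?_⟩⟩
    obtain ⟨i, rfl⟩ := h
    exact (hy i).2
  have hback : ∀ z ∈ N.carrier, ∃ A ∈ N'.carrier, dist A z < η := by
    intro z hz
    by_cases hzL : z ∈ Metric.ball 0 L
    · obtain ⟨i, rfl⟩ := hxsurj z hz hzL
      exact ⟨y i, (hmem _).2 (Or.inl ⟨i, rfl⟩), hyx i⟩
    · exact ⟨z, (hmem _).2 (Or.inr ⟨hz, hzL⟩), by rwa [dist_self]⟩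
  have hmixed : ∀ i z, z ∈ N.carrier → z ∉ Metric.ball 0 L → r < dist (y i) z := by
    intro i z hz hzL
    by_cases hzL' : z ∈ Metric.ball 0 (L + (r + 1))
    · by_cases hxi : x i ∈ Metric.ball 0 (L + (r + 1))
      · have h1 := hsep' (x i) ⟨(hxmem i).1, hxi⟩ z ⟨hz, hzL'⟩ fun h => hzL (h ▸ (hxmem i).2)
        have h2 := dist_triangle_left (x i) z (y i)
        have h3 := hyx i
        linarith
      · have h1 : dist z 0 < L + (r + 1) := hzL'
        have h2 : dist (x i) 0 < L := (hxmem i).2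
        have h3 : L + (r + 1) ≤ dist (x i) 0 := not_lt.1 hxi
        have h4 := dist_nonneg (x := y i) (y := z)
        linarith
    · have h1 : dist (y i) 0 < L := (hy i).2
      have h2 : L + (r + 1) ≤ dist z 0 := not_lt.1 hzL'
      have h3 := dist_triangle_left z 0 (y i)
      linarith
  have hsepN' : ∀ A ∈ N'.carrier, ∀ B ∈ N'.carrier, A ≠ B → r < dist A B := by
    intro A hA B hB hAB
    rcases (hmem A).1 hA with ⟨i, rfl⟩ | ⟨hA1, hA2⟩ <;>
      rcases (hmem B).1 hB with ⟨j, rfl⟩ | ⟨hB1, hB2⟩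
    · have hij : x i ≠ x j := fun h => hAB (by rw [hxinj h])
      have h1 := hyx i
      have h2 := hyx j
      have h3 := dist_triangle4 (x i) (y i) (y j) (x j)
      rw [dist_comm (x i) (y i)] at h3
      by_cases hr : r + 1 < 0
      · exact (by linarith : r < 0).trans_le dist_nonneg
      · have hsub : Metric.ball (0 : Plane) L ⊆ Metric.ball 0 (L + (r + 1)) :=
          Metric.ball_subset_ball (by linarith)
        have h4 := hsep' (x i) ⟨(hxmem i).1, hsub (hxmem i).2⟩ (x j)
          ⟨(hxmem j).1, hsub (hxmem j).2⟩ hij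
        linarith
    · exact hmixed i B hB1 hB2
    · rw [dist_comm]; exact hmixed j A hA1 hA2
    · exact hsep A hA1 B hB1 hAB
  refine ⟨fun A hA => ?_, fun z hz => ?_, hsepN', fun T hT => ⟨?_, ?_⟩⟩
  · rcases (hmem A).1 hA with ⟨i, rfl⟩ | ⟨hA1, -⟩
    · exact ⟨x i, (hxmem i).1, (hyx i).trans_le hηε⟩
    · exact ⟨A, hA1, by rwa [dist_self]⟩
  · obtain ⟨A, hA, hAz⟩ := hback z hz
    exact ⟨A, hA, hAz.trans_le hηε⟩
  · obtain ⟨b, d, e, o, rfl, ht⟩ := hT.1.exists_triple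
    obtain ⟨w, hw, hwL⟩ := hT.2
    rw [ht.circumdisc_eq] at hw
    rw [ht.circumradius_eq]
    -- A disc of radius at least `a` meeting the window contains a disc of radius `a` centred in the
    -- region with a covering margin. That disc keeps a point even after displacement by `η ≤ δ₂`.
    by_contra! hcon
    obtain ⟨c, hc, hsub⟩ := exists_closedBall_center ha hcon hw hwL
    obtain ⟨z, hz, hzc⟩ := hcov' c hc
    obtain ⟨A, hA, hAz⟩ := hback z hz
    have h1 := dist_triangle A z c
    exact absurd (hsub A (by linarith)) (not_lt.2 (ht.le_dist A hA))
  · rw [lt_minSide_iff hT.1.2.1]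
    exact fun p hp q hq hpq => hsepN' p (hT.1.1 hp) q (hT.1.1 hq) hpq

end

noncomputable section

open Plane ProbabilityTheory

/-! ### A local event of positive probability -/

/-- The vertices of an equilateral triangle in the unit circle. -/
def triangleVertex : Fin 3 → Plane :=
  ![!₂[1, 0], !₂[-1 / 2, √3 / 2], !₂[-1 / 2, -√3 / 2]]

theorem sum_triangleVertex : ∀ i j k : Fin 3, i ≠ j → i ≠ k → j ≠ k →
    triangleVertex i + triangleVertex j + triangleVertex k = 0 := by
  have h : triangleVertex 0 + triangleVertex 1 + triangleVertex 2 = 0 := by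
    rw [ext_iff]; simp [triangleVertex]; norm_num; ring
  have hsum : ∀ i j k : Fin 3, i ≠ j → i ≠ k → j ≠ k →
      (Finset.univ : Finset (Fin 3)) = {i, j, k} := by decide
  intro i j k hij hik hjk
  rw [← Fin.sum_univ_three (f := triangleVertex), hsum i j k hij hik hjk,
    Finset.sum_insert (by simp [hij, hik]), Finset.sum_pair hjk, ← add_assoc] at h
  exact h

theorem norm_triangleVertex (i : Fin 3) : ‖triangleVertex i‖ = 1 := by
  have h3 : √3 ^ 2 = 3 := Real.sq_sqrt (by norm_num)
  rw [← sq_eq_sq₀ (norm_nonneg _) zero_le_one, Plane.norm_sq]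
  fin_cases i <;> simp [triangleVertex] <;> nlinarith

theorem dist_smul_triangleVertex_sq {i j : Fin 3} (hij : i ≠ j) (s t : ℝ) :
    dist (s • triangleVertex i) (t • triangleVertex j) ^ 2 = s ^ 2 + t ^ 2 + s * t := by
  have h3 : √3 ^ 2 = 3 := Real.sq_sqrt (by norm_num)
  rw [Plane.dist_sq]
  fin_cases i <;> fin_cases j <;> first | exact absurd rfl hij | skip
  all_goals
    simp [triangleVertex]
    ring_nf
    rw [h3]
    ring

theorem dist_smul_triangleVertex_self (i : Fin 3) (s t : ℝ) :
    dist (s • triangleVertex i) (t • triangleVertex i) = |s - t| := by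
  rw [dist_eq_norm, ← sub_smul, norm_smul, norm_triangleVertex, mul_one, Real.norm_eq_abs]

theorem cross_triangleVertex (i : Fin 3) : cross (triangleVertex i) (triangleVertex (i + 1)) = √3 / 2 := by
  fin_cases i <;> simp [triangleVertex, cross] <;> ring

/-- Some vertex `u` makes an angle of at most 60° with `w`, so `2 * ⟪w, u⟫ ≥ ‖w‖`. Then `‖w - ρ • u‖
^ 2 ≤ ‖w‖ ^ 2 - ρ * ‖w‖ + ρ ^ 2 ≤ ρ ^ 2`. -/
theorem exists_norm_sub_smul_triangleVertex_le {ρ : ℝ} {w : Plane} (hw : ‖w‖ ≤ ρ) :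
    ∃ i, ‖w - ρ • triangleVertex i‖ ≤ ρ := by
  have hρ : 0 ≤ ρ := (norm_nonneg w).trans hw
  have h3 : √3 ^ 2 = 3 := Real.sq_sqrt (by norm_num)
  have h30 : 0 ≤ √3 := Real.sqrt_nonneg 3
  have hn := Plane.norm_sq w
  have hn0 := norm_nonneg w
  have key : ∃ i, ‖w‖ ≤ 2 * (w 0 * triangleVertex i 0 + w 1 * triangleVertex i 1) := by
    by_cases h0 : ‖w‖ ≤ 2 * w 0
    · exact ⟨0, by simpa [triangleVertex] using h0⟩
    · push Not at h0
      have habs : -‖w‖ ≤ w 0 := by nlinarith [sq_nonneg (w 1)]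
      have hsq : ‖w‖ + w 0 ≤ √3 * |w 1| := by
        refine abs_le_of_sq_le_sq' ?_ (by positivity) |>.2
        rw [mul_pow, h3, sq_abs]
        nlinarith [mul_nonneg (by linarith : 0 ≤ ‖w‖ + w 0) (by linarith : 0 ≤ ‖w‖ - 2 * w 0)]
      rcases le_total 0 (w 1) with h1 | h1
      · refine ⟨1, ?_⟩
        rw [abs_of_nonneg h1] at hsq
        simp [triangleVertex]
        linarith
      · refine ⟨2, ?_⟩
        rw [abs_of_nonpos h1] at hsq
        simp [triangleVertex]
        linarith
  obtain ⟨i, hi⟩ := key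
  refine ⟨i, ?_⟩
  rw [← sq_le_sq₀ (norm_nonneg _) hρ, Plane.norm_sq]
  have hu := Plane.norm_sq (triangleVertex i)
  rw [norm_triangleVertex] at hu
  simp only [PiLp.sub_apply, PiLp.smul_apply, smul_eq_mul]
  have e1 := mul_le_mul_of_nonneg_left hi hρ
  have e2 := mul_le_mul_of_nonneg_right hw hn0
  nlinarith

theorem exists_norm_sub_smul_triangleVertex_le_add {ρ κ : ℝ} (hρ : 0 < ρ) (hκ : 0 ≤ κ) {w : Plane}
    (hw : ‖w‖ ≤ ρ + κ) : ∃ i, ‖w - ρ • triangleVertex i‖ ≤ ρ + κ := by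
  have h0 : 0 < ρ + κ := by linarith
  have hw' : ‖(ρ / (ρ + κ)) • w‖ ≤ ρ := by
    rw [norm_smul, Real.norm_of_nonneg (by positivity), div_mul_eq_mul_div, div_le_iff₀ h0]
    exact mul_le_mul_of_nonneg_left hw hρ.le
  have hd : ‖w - (ρ / (ρ + κ)) • w‖ ≤ κ := by
    have he : w - (ρ / (ρ + κ)) • w = (κ / (ρ + κ)) • w := by
      nth_rewrite 1 [← one_smul ℝ w]
      rw [← sub_smul]
      congr 1
      field_simp
      ring
    rw [he, norm_smul, Real.norm_of_nonneg (by positivity), div_mul_eq_mul_div, div_le_iff₀ h0]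
    exact mul_le_mul_of_nonneg_left hw hκ
  obtain ⟨i, hi⟩ := exists_norm_sub_smul_triangleVertex_le hw'
  refine ⟨i, ?_⟩
  have := norm_add_le ((ρ / (ρ + κ)) • w - ρ • triangleVertex i) (w - (ρ / (ρ + κ)) • w)
  rw [show (ρ / (ρ + κ)) • w - ρ • triangleVertex i + (w - (ρ / (ρ + κ)) • w) = w - ρ • triangleVertex i by abel] at this
  linarith

/-- The centres of the discs that separate the insertion from the remaining points. -/
def outerCenter (ρ κ : ℝ) (i : Fin 3) : Plane := (-(ρ + κ)) • triangleVertex (i + 2)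

/-- A neighbourhood of the origin, enlarged by `ε`. -/
def clearedRegion (ρ κ ε : ℝ) : Set Plane :=
  Metric.ball 0 (ρ + κ / 4 + ε) ∪ ⋃ i, Metric.ball (outerCenter ρ κ i) (ρ + 3 / 4 * κ + ε)

/-- The configurations with exactly one point near each vertex of an equilateral triangle and no
further points around it. -/
def isolatedTriangleEvent (ρ κ ε : ℝ) : Set Config :=
  {γ | (∀ i, γ.count (Metric.ball (ρ • triangleVertex i) ε) = 1) ∧
    γ.count (clearedRegion ρ κ 0 \ ⋃ i, Metric.ball (ρ • triangleVertex i) ε) = 0}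

theorem isBoundedBorel_clearedRegion (ρ κ ε : ℝ) : IsBoundedBorel (clearedRegion ρ κ ε) := by
  refine ⟨Metric.isBounded_ball.union ?_, measurableSet_ball.union ?_⟩
  · exact (Bornology.isBounded_iUnion).2 fun _ => Metric.isBounded_ball
  · exact MeasurableSet.iUnion fun _ => measurableSet_ball

theorem isBoundedBorel_clearedRegion_diff (ρ κ ε : ℝ) :
    IsBoundedBorel (clearedRegion ρ κ 0 \ ⋃ i, Metric.ball (ρ • triangleVertex i) ε) :=
  ⟨(isBoundedBorel_clearedRegion ρ κ 0).1.subset Set.sdiff_subset,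
    (isBoundedBorel_clearedRegion ρ κ 0).2.diff (MeasurableSet.iUnion fun _ => measurableSet_ball)⟩

theorem measurableSet_isolatedTriangleEvent (ρ κ ε : ℝ) :
    MeasurableSet (isolatedTriangleEvent ρ κ ε) := by
  refine MeasurableSet.inter ?_
    (Config.measurable_count (isBoundedBorel_clearedRegion_diff ρ κ ε) (measurableSet_singleton 0))
  have : {γ : Config | ∀ i, γ.count (Metric.ball (ρ • triangleVertex i) ε) = 1} =
      ⋂ i, {γ : Config | γ.count (Metric.ball (ρ • triangleVertex i) ε) = 1} := by ext; simp
  change MeasurableSet {γ : Config | ∀ i, γ.count (Metric.ball (ρ • triangleVertex i) ε) = 1}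
  rw [this]
  exact MeasurableSet.iInter fun i =>
    Config.measurable_count (isBoundedBorel_ball _ _) (measurableSet_singleton 1)

theorem Plane.abs_cross_le (a b : Plane) : |cross a b| ≤ ‖a‖ * ‖b‖ := by
  refine abs_le_of_sq_le_sq ?_ (by positivity)
  rw [mul_pow, Plane.norm_sq, Plane.norm_sq, cross]
  nlinarith [sq_nonneg (a 0 * b 0 + a 1 * b 1)]

section
variable {ρ κ ε : ℝ}

/-- The outer centres are the reflections of the origin in the sides, pushed outward by `κ`. Their
squared distance to the two adjacent vertices is `ρ ^ 2 + ρ * κ + κ ^ 2`, below `(ρ + 3 / 4 * κ) ^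
2` with room for `ε`, while the origin is at the larger distance `ρ + κ`. -/
theorem isIsolatedTriple_of_mem_event (hρ : 0 < ρ) (hκ : 0 < κ) (hκρ : κ ≤ ρ / 16)
    (hεκ : ε ≤ κ / 16) {γ : Config} (hγ : γ ∈ isolatedTriangleEvent ρ κ ε) :
    ∃ p : Fin 3 → Plane, (∀ i, ρ - ε < ‖p i‖) ∧
      IsIsolatedTriple γ p (ρ + κ / 4) (outerCenter ρ κ) (ρ + 3 / 4 * κ) := by
  obtain ⟨h1, h0⟩ := hγ
  have hex : ∀ i, ∃ p, γ.carrier ∩ Metric.ball (ρ • triangleVertex i) ε = {p} := fun i =>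
    Set.ncard_eq_one.1 (h1 i)
  choose p hp using hex
  have hpmem : ∀ i, p i ∈ γ.carrier ∩ Metric.ball (ρ • triangleVertex i) ε := fun i => by rw [hp i]; rfl
  have hpd : ∀ i, dist (p i) (ρ • triangleVertex i) < ε := fun i => (hpmem i).2
  have hempty : γ.carrier ∩ (clearedRegion ρ κ 0 \ ⋃ i, Metric.ball (ρ • triangleVertex i) ε) = ∅ :=
    (Set.ncard_eq_zero (γ.locallyFinite _ (isBoundedBorel_clearedRegion_diff ρ κ ε).1)).1 h0
  have hnorm : ∀ i, ‖ρ • triangleVertex i‖ = ρ := fun i => by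
    rw [norm_smul, norm_triangleVertex, mul_one, Real.norm_of_nonneg hρ.le]
  have hout : ∀ v ∈ γ.carrier, (∀ i, v ≠ p i) → v ∉ clearedRegion ρ κ 0 := by
    intro v hv hvp hvV
    have : v ∈ γ.carrier ∩ (clearedRegion ρ κ 0 \ ⋃ i, Metric.ball (ρ • triangleVertex i) ε) := by
      refine ⟨hv, hvV, fun hball => ?_⟩
      obtain ⟨i, hi⟩ := Set.mem_iUnion.1 hball
      have hmem : v ∈ γ.carrier ∩ Metric.ball (ρ • triangleVertex i) ε := ⟨hv, hi⟩
      rw [hp i] at hmem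
      exact hvp i hmem
    rw [hempty] at this
    exact this
  have hε : 0 < ε := dist_nonneg.trans_lt (hpd 0)
  have hcenter : ∀ i j : Fin 3, j ≠ i + 2 →
      dist (ρ • triangleVertex j) (outerCenter ρ κ i) < ρ + 3 / 4 * κ - ε := by
    intro i j hij
    rw [← sq_lt_sq₀ dist_nonneg (by linarith), outerCenter, dist_smul_triangleVertex_sq hij]
    nlinarith [mul_pos hρ hκ, mul_nonneg hκ.le (by linarith : (0 : ℝ) ≤ ρ / 16 - κ),
      mul_nonneg hκ.le (by linarith : (0 : ℝ) ≤ κ / 16 - ε),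
      mul_nonneg hρ.le (by linarith : (0 : ℝ) ≤ κ / 16 - ε), sq_nonneg ε]
  refine ⟨p, fun i => ?_, fun i => (hpmem i).1, fun i => ?_, fun i => ?_, fun i => ?_, fun i => ?_,
    fun i => ?_, fun v hv hvp => ?_, fun v hv hvp i => ?_⟩
  · have h2 := hpd i
    have h3 := dist_triangle_left (ρ • triangleVertex i) 0 (p i)
    rw [dist_zero_right, dist_zero_right, hnorm] at h3
    linarith
  · set d : Plane := p i - ρ • triangleVertex i with hd
    set d' : Plane := p (i + 1) - ρ • triangleVertex (i + 1) with hd'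
    have hdn : ‖d‖ < ε := by rw [hd, ← dist_eq_norm]; exact hpd i
    have hdn' : ‖d'‖ < ε := by rw [hd', ← dist_eq_norm]; exact hpd (i + 1)
    have hexp : cross (p i) (p (i + 1)) = ρ ^ 2 * cross (triangleVertex i) (triangleVertex (i + 1)) +
        ρ * cross (triangleVertex i) d' + ρ * cross d (triangleVertex (i + 1)) + cross d d' := by
      have e1 : p i = ρ • triangleVertex i + d := by rw [hd]; abel
      have e2 : p (i + 1) = ρ • triangleVertex (i + 1) + d' := by rw [hd']; abel
      rw [e1, e2]
      simp only [cross, PiLp.add_apply, PiLp.smul_apply, smul_eq_mul]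
      ring
    have b1 := (abs_le.1 (abs_cross_le (triangleVertex i) d')).1
    have b2 := (abs_le.1 (abs_cross_le d (triangleVertex (i + 1)))).1
    have b3 := (abs_le.1 (abs_cross_le d d')).1
    rw [norm_triangleVertex] at b1 b2
    have b4 : ‖d‖ * ‖d'‖ ≤ ε * ε :=
      mul_le_mul hdn.le hdn'.le (norm_nonneg _) hε.le
    have h3 : (1 : ℝ) ≤ √3 := Real.one_le_sqrt.2 (by norm_num)
    have c1 := mul_le_mul_of_nonneg_left (show -ε ≤ cross (triangleVertex i) d' by linarith) hρ.le
    have c2 := mul_le_mul_of_nonneg_left (show -ε ≤ cross d (triangleVertex (i + 1)) by linarith) hρ.le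
    have c3 := mul_le_mul_of_nonneg_left h3 (sq_nonneg ρ)
    rw [hexp, cross_triangleVertex]
    have hερ : ε ≤ ρ / 256 := by linarith
    nlinarith [mul_le_mul_of_nonneg_left hερ hρ.le, mul_le_mul_of_nonneg_left hερ hε.le,
      mul_pos hρ hρ]
  · have h2 := hpd i
    have h3 := dist_triangle (p i) (ρ • triangleVertex i) 0
    rw [dist_zero_right, dist_zero_right, hnorm] at h3
    linarith
  · have h2 := hpd i
    have h3 := hcenter i i ((by decide : ∀ i : Fin 3, i ≠ i + 2) i)
    have h4 := dist_triangle (p i) (ρ • triangleVertex i) (outerCenter ρ κ i)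
    linarith
  · have h2 := hpd (i + 1)
    have h3 := hcenter i (i + 1) ((by decide : ∀ i : Fin 3, i + 1 ≠ i + 2) i)
    have h4 := dist_triangle (p (i + 1)) (ρ • triangleVertex (i + 1)) (outerCenter ρ κ i)
    linarith
  · rw [outerCenter, norm_smul, norm_triangleVertex, norm_neg, Real.norm_of_nonneg (by linarith)]
    linarith
  · have h2 := hout v hv hvp
    by_contra! hlt
    refine h2 (Or.inl ?_)
    rw [mem_ball_zero_iff, add_zero]
    exact hlt
  · have h2 := hout v hv hvp
    by_contra! hlt
    refine h2 (Or.inr (Set.mem_iUnion.2 ⟨i, ?_⟩))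
    rw [Metric.mem_ball, add_zero]
    exact hlt

/-- The vertices of a triangle and the vertices of the three adjacent triangles. -/
def seedPoints (ρ κ : ℝ) : Set Plane :=
  Set.range (fun i => ρ • triangleVertex i) ∪ Set.range fun i => (-(2 * ρ + 11 / 4 * κ)) • triangleVertex i

theorem le_dist_seedPoints (hρ : 0 < ρ) (hκ : 0 < κ) :
    ∀ p ∈ seedPoints ρ κ, ∀ q ∈ seedPoints ρ κ, p ≠ q → ρ ≤ dist p q := by
  have key : ∀ s t : ℝ, (s = ρ ∨ s = -(2 * ρ + 11 / 4 * κ)) →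
      (t = ρ ∨ t = -(2 * ρ + 11 / 4 * κ)) → ∀ i j, s • triangleVertex i ≠ t • triangleVertex j →
        ρ ≤ dist (s • triangleVertex i) (t • triangleVertex j) := by
    intro s t hs ht i j hne
    by_cases hij : i = j
    · subst hij
      rw [dist_smul_triangleVertex_self]
      rcases hs with rfl | rfl <;> rcases ht with rfl | rfl
      · exact absurd rfl hne
      · rw [le_abs]; left; linarith
      · rw [le_abs]; right; linarith
      · exact absurd rfl hne
    · rw [← sq_le_sq₀ hρ.le dist_nonneg, dist_smul_triangleVertex_sq hij]
      rcases hs with rfl | rfl <;> rcases ht with rfl | rfl <;> nlinarith [mul_pos hρ hκ]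
  rintro p (⟨i, rfl⟩ | ⟨i, rfl⟩) q (⟨j, rfl⟩ | ⟨j, rfl⟩) hpq
  · exact key _ _ (Or.inl rfl) (Or.inl rfl) i j hpq
  · exact key _ _ (Or.inl rfl) (Or.inr rfl) i j hpq
  · exact key _ _ (Or.inr rfl) (Or.inl rfl) i j hpq
  · exact key _ _ (Or.inr rfl) (Or.inr rfl) i j hpq

theorem clearedRegion_subset_ball (hκ : 0 < κ) (hκρ : κ ≤ ρ / 16) (hεκ : ε ≤ κ / 16) :
    clearedRegion ρ κ ε ⊆ Metric.ball 0 (5 * ρ) := by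
  refine Set.union_subset (Metric.ball_subset_ball (by linarith)) (Set.iUnion_subset fun i => ?_)
  refine Metric.ball_subset_ball' ?_
  rw [dist_zero_right, outerCenter, norm_smul, norm_triangleVertex, norm_neg,
    Real.norm_of_nonneg (by linarith)]
  linarith

theorem seedPoints_subset_ball (hκ : 0 < κ) (hκρ : κ ≤ ρ / 16) :
    seedPoints ρ κ ⊆ Metric.ball 0 (5 * ρ) := by
  rintro z (⟨i, rfl⟩ | ⟨i, rfl⟩) <;>
    rw [mem_ball_zero_iff, norm_smul, norm_triangleVertex]
  · rw [Real.norm_of_nonneg (by linarith)]; linarith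
  · rw [norm_neg, Real.norm_of_nonneg (by linarith)]; linarith

/-- Discs of radius `ρ + κ` around the vertices cover the central disc. The same covering, reflected
and placed at an outer centre, has its discs centred within `κ` of two vertices and within `7 / 4 *
κ` of the outer seed. The total `ρ + 11 / 4 * κ` is below `a` because `4 * κ ≤ a - ρ`. -/
theorem exists_seedPoint_near {a : ℝ} (hρ : 0 < ρ) (hκ : 0 < κ) (hκa : κ ≤ (a - ρ) / 4)
    (hεκ : ε ≤ κ / 16) {z : Plane} (hz : z ∈ clearedRegion ρ κ ε) :
    ∃ q ∈ seedPoints ρ κ, dist q z < a := by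
  rcases hz with hz | hz
  · rw [mem_ball_zero_iff] at hz
    obtain ⟨i, hi⟩ := exists_norm_sub_smul_triangleVertex_le_add hρ hκ.le
      (show ‖z‖ ≤ ρ + κ by linarith)
    refine ⟨_, Or.inl ⟨i, rfl⟩, ?_⟩
    rw [dist_comm, dist_eq_norm]
    linarith
  · obtain ⟨i, hi⟩ := Set.mem_iUnion.1 hz
    set k := i + 2 with hk
    rw [Metric.mem_ball, dist_eq_norm, outerCenter, ← hk] at hi
    set w := z - (-(ρ + κ)) • triangleVertex k with hw
    obtain ⟨j, hj⟩ := exists_norm_sub_smul_triangleVertex_le_add hρ hκ.le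
      (show ‖-w‖ ≤ ρ + κ by rw [norm_neg]; linarith)
    have hj' : ‖w + ρ • triangleVertex j‖ ≤ ρ + κ := by
      rwa [← norm_neg, neg_add']
    have hvk : ∀ t : ℝ, ‖t • triangleVertex k‖ = |t| := fun t => by
      rw [norm_smul, norm_triangleVertex, mul_one, Real.norm_eq_abs]
    by_cases hjk : j = k
    · rw [hjk] at hj'
      refine ⟨_, Or.inr ⟨k, rfl⟩, ?_⟩
      have he : z - (-(2 * ρ + 11 / 4 * κ)) • triangleVertex k =
          (w + ρ • triangleVertex k) + (7 / 4 * κ) • triangleVertex k := by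
        rw [hw]; module
      rw [dist_comm, dist_eq_norm, he]
      refine (norm_add_le _ _).trans_lt ?_
      rw [hvk, abs_of_pos (by linarith)]
      linarith
    · have hthird : ∀ j k : Fin 3, j ≠ k → ∃ l, l ≠ j ∧ l ≠ k := by decide
      obtain ⟨l, hlj, hlk⟩ := hthird j k hjk
      refine ⟨_, Or.inl ⟨l, rfl⟩, ?_⟩
      have hsum := sum_triangleVertex l j k hlj hlk hjk
      have he : z - ρ • triangleVertex l = (w + ρ • triangleVertex j) + (-κ) • triangleVertex k := by
        have : triangleVertex l = -(triangleVertex j + triangleVertex k) := by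
          rw [eq_neg_iff_add_eq_zero, ← add_assoc]; exact hsum
        rw [hw, this]; module
      rw [dist_comm, dist_eq_norm, he]
      refine (norm_add_le _ _).trans_lt ?_
      rw [hvk, abs_neg, abs_of_pos hκ]
      linarith

theorem outerSeed_notMem_clearedRegion (hρ : 0 < ρ) (hκ : 0 < κ) (hε : 0 < ε) (hεκ : ε ≤ κ / 16)
    (i : Fin 3) : (-(2 * ρ + 11 / 4 * κ)) • triangleVertex i ∉ clearedRegion ρ κ ε := by
  rintro (h | h)
  · rw [mem_ball_zero_iff, norm_smul, norm_triangleVertex, norm_neg,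
      Real.norm_of_nonneg (by linarith)] at h
    linarith
  · obtain ⟨j, hj⟩ := Set.mem_iUnion.1 h
    rw [Metric.mem_ball, outerCenter] at hj
    by_cases hij : i = j + 2
    -- The shift `11 / 4 * κ` leaves distance `ρ + 7 / 4 * κ` to the nearest centre, outside the
    -- enlarged disc.
    · rw [hij, dist_smul_triangleVertex_self] at hj
      have := neg_le_abs (-(2 * ρ + 11 / 4 * κ) - -(ρ + κ))
      linarith
    · rw [← sq_lt_sq₀ dist_nonneg (by linarith), dist_smul_triangleVertex_sq hij] at hj
      nlinarith [mul_pos hρ hκ, mul_pos hρ hε, mul_pos hκ hε]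

/-- Each small ball receives the displaced vertex, and no second point since `2 * ε ≤ r`. A point in
the cleared region comes from a point of `N` in the region enlarged by `ε`, hence from a seed, and
outer seeds are not there. -/
theorem mem_isolatedTriangleEvent (hρ : 0 < ρ) (hκ : 0 < κ) (hε : 0 < ε)
    (hεκ : ε ≤ κ / 16) {r : ℝ} (hεr : 2 * ε ≤ r) {N N' : Config}
    (hseed : seedPoints ρ κ ⊆ N.carrier) (hclear : N.carrier ∩ clearedRegion ρ κ ε ⊆ seedPoints ρ κ)
    (h1 : ∀ A ∈ N'.carrier, ∃ z ∈ N.carrier, dist A z < ε)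
    (h2 : ∀ z ∈ N.carrier, ∃ A ∈ N'.carrier, dist A z < ε)
    (h3 : ∀ A ∈ N'.carrier, ∀ B ∈ N'.carrier, A ≠ B → r < dist A B) :
    N' ∈ isolatedTriangleEvent ρ κ ε := by
  constructor
  · intro i
    obtain ⟨A, hA, hAi⟩ := h2 _ (hseed (Or.inl ⟨i, rfl⟩))
    refine Set.ncard_eq_one.2 ⟨A, Set.eq_singleton_iff_unique_mem.2 ⟨⟨hA, hAi⟩, ?_⟩⟩
    rintro B ⟨hB, hBi⟩
    by_contra hBA
    have h4 := h3 B hB A hA hBA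
    have h5 := dist_triangle_right B A (ρ • triangleVertex i)
    have h6 := Metric.mem_ball.1 hBi
    linarith
  · unfold Config.count
    rw [Set.ncard_eq_zero (N'.locallyFinite _ (isBoundedBorel_clearedRegion_diff ρ κ ε).1)]
    refine Set.eq_empty_of_forall_notMem ?_
    rintro A ⟨hA, hAV, hAball⟩
    obtain ⟨z, hz, hAz⟩ := h1 A hA
    have hzU : z ∈ clearedRegion ρ κ ε := by
      rcases hAV with h | h
      · left
        rw [Metric.mem_ball] at h ⊢
        have := dist_triangle_left z 0 A
        linarith
      · right
        obtain ⟨i, hi⟩ := Set.mem_iUnion.1 h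
        refine Set.mem_iUnion.2 ⟨i, ?_⟩
        rw [Metric.mem_ball] at hi ⊢
        have := dist_triangle_left z (outerCenter ρ κ i) A
        linarith
    rcases hclear ⟨hz, hzU⟩ with ⟨i, rfl⟩ | ⟨i, rfl⟩
    · exact hAball (Set.mem_iUnion.2 ⟨i, hAz⟩)
    · exact outerSeed_notMem_clearedRegion hρ hκ hε hεκ i hzU

end

/-! ### Positive probability of isolated triples, S3 and H5. -/

theorem IsStationaryGibbs.ae_separated {r α θ : ℝ} {μ : Measure Config}
    (hμ : IsStationaryGibbs (delaunayEnergy r α θ) μ) :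
    ∀ᵐ γ ∂μ, ∀ p ∈ γ.carrier, ∀ q ∈ γ.carrier, p ≠ q → r < dist p q := by
  filter_upwards [hμ.ae_mem_finiteEnergyConfigs, hμ.ae_meetsHalfPlanes] with γ h1 h2 p hp q hq hpq
  exact lt_dist_of_delaunay (fun T hT => (mem_finiteEnergyConfigs_iff.1 h1 T hT).2)
    h2.exists_det_ne_zero hp hq hpq

theorem IsStationaryGibbs.ae_exists_dist_lt {r α θ : ℝ} (hα : 0 < α) {μ : Measure Config}
    (hμ : IsStationaryGibbs (delaunayEnergy r α θ) μ) :
    ∀ᵐ γ ∂μ, ∀ c, ∃ z ∈ γ.carrier, dist z c < α := by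
  filter_upwards [hμ.ae_mem_finiteEnergyConfigs, hμ.ae_meetsHalfPlanes] with γ h1 h2 c
  exact exists_dist_lt_of_circumradius_lt hα h2
    (fun T hT => (mem_finiteEnergyConfigs_iff.1 h1 T hT).1) c

/-- With positive probability, the origin is surrounded by three isolated points at a distance
that is close to the largest possible one. -/
theorem exists_isolatedTriple_event {r a m : ℝ} (hr : 0 < r) (hra : r < a) (hma : m < a) :
    ∃ B : Set Config, (∀ θ μ, IsStationaryGibbs (delaunayEnergy r a θ) μ → 0 < μ B) ∧
      ∀ γ ∈ B, ∃ (p : Fin 3 → Plane) (ρ : ℝ) (c : Fin 3 → Plane) (σ : ℝ),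
        (∀ i, m < ‖p i‖ ∧ r < ‖p i‖) ∧ IsIsolatedTriple γ p ρ c σ := by
  have ha : 0 < a := hr.trans hra
  obtain ⟨ρ, hρ1, hρa⟩ := exists_between (max_lt hma hra)
  obtain ⟨hmρ, hrρ⟩ := max_lt_iff.1 hρ1
  have hρ : 0 < ρ := hr.trans hrρ
  set κ := min (ρ / 16) ((a - ρ) / 4) with hκdef
  have hκ : 0 < κ := lt_min (by linarith) (by linarith)
  have hκρ : κ ≤ ρ / 16 := min_le_left _ _
  have hκa : κ ≤ (a - ρ) / 4 := min_le_right _ _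
  -- The bound `r / 2` makes the point near each vertex unique, and `ρ - max m r` keeps its norm,
  -- which exceeds `ρ - ε`, above both `m` and `r`.
  set ε := min (κ / 16) (min (r / 2) (ρ - max m r)) with hεdef
  have hε : 0 < ε := lt_min (by linarith) (lt_min (by linarith) (by linarith))
  have hεκ : ε ≤ κ / 16 := min_le_left _ _
  have hεr : ε ≤ r / 2 := (min_le_right _ _).trans (min_le_left _ _)
  have hερ : ε ≤ ρ - max m r := (min_le_right _ _).trans (min_le_right _ _)
  refine ⟨isolatedTriangleEvent ρ κ ε, fun θ μ hμ => ?_, fun γ hγ => ?_⟩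
  · have := hμ.isProbabilityMeasure
    refine hμ.measure_pos (isBoundedBorel_ball 0 (5 * ρ + ρ + a + 1)) Metric.isOpen_ball
      (measurableSet_isolatedTriangleEvent ρ κ ε)
      (hμ.ae_separated.and (hμ.ae_exists_dist_lt ha)).frequently ?_
    rintro γ ⟨hsep, hcov⟩
    obtain ⟨N, hN1, hN2, hN3, hN4, hN5⟩ := exists_modified_config hρ hrρ hρa hsep hcov
      ((Set.finite_range _).union (Set.finite_range _)) (seedPoints_subset_ball hκ hκρ)
      (le_dist_seedPoints hρ hκ) (clearedRegion_subset_ball hκ hκρ hεκ)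
      fun z hz => exists_seedPoint_near hρ hκ hκa hεκ hz
    obtain ⟨n, x, η, hη, hx, hy⟩ := exists_perturbation hε ha hN1 hN4 hN5
    refine ⟨n, x, η, hη, hx, fun y hyi => ?_⟩
    obtain ⟨k1, k2, k3, k4⟩ := hy y hyi
    exact ⟨mem_isolatedTriangleEvent hρ hκ hε hεκ (by linarith) hN2 hN3 k1 k2 k3,
      (delaunayEnergy_lt_top_iff Metric.isBounded_ball).2 k4⟩
  · obtain ⟨p, hp, ht⟩ := isIsolatedTriple_of_mem_event hρ hκ hκρ hεκ hγ
    refine ⟨p, _, _, _, fun i => ?_, ht⟩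
    have h1 := hp i
    have h2 := le_max_left m r
    have h3 := le_max_right m r
    constructor <;> linarith

/-- With `m = α` the isolated triple is a Delaunay triangle of radius at least `α` whose disc
contains the origin, so any radius of the window would do. -/
theorem assumptionS3_delaunayEnergy {r a₀ t₀ : ℝ} (hr : 0 < r) (hra : r < a₀) :
    AssumptionS3 (delaunayEnergy r) a₀ t₀ := by
  intro α hα hαa
  obtain ⟨B, hB, hBp⟩ := exists_isolatedTriple_event hr hra hαa
  refine ⟨1, one_pos, fun μ hμ => (hB t₀ μ hμ).trans_le (measure_mono fun γ hγ => ?_)⟩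
  obtain ⟨p, ρ, c, σ, hp, ht⟩ := hBp γ hγ
  obtain ⟨o, ho, ho0, hle⟩ := ht.isEmptyTriangle
  refine delaunayEnergy_eq_top (T := {p 0, p 1, p 2}) ⟨ho.isDelaunay, 0, ?_, ?_⟩ fun hadm => ?_
  · rw [ho.circumdisc_eq, Metric.mem_ball, dist_zero_left]; exact ho0
  · exact Metric.mem_ball_self one_pos
  · have h1 := hadm.1
    rw [ho.circumradius_eq] at h1
    have h2 := hle α hα fun i => (hp i).1.le
    linarith

/-- On the event with `m = r` the insertion is admissible: every disc of radius `a₀` contains a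
point of `γ`, and the sides join the origin and the triple. The two local energies are then `t₀` and
`θ` times the same positive number. -/
theorem assumptionH5_delaunayEnergy {r a₀ t₀ : ℝ} (hr : 0 < r) (hra : r < a₀) {Θ : Set ℝ}
    {μ : Measure Config} (hμ : IsStationaryGibbs (delaunayEnergy r a₀ t₀) μ) :
    AssumptionH5 Θ (delaunayEnergy r) a₀ t₀ μ := by
  intro θ _ hθ
  obtain ⟨B, hB, hBp⟩ := exists_isolatedTriple_event hr hra hra
  refine (hB t₀ μ hμ).trans_le (measure_mono_ae ?_)
  filter_upwards [hμ.ae_mem_finiteEnergyConfigs, hμ.ae_separated,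
    hμ.ae_exists_dist_lt (hr.trans hra)] with γ hfin hsep hcov hγB
  obtain ⟨p, ρ, c, σ, hp, ht⟩ := hBp γ hγB
  have h0 := ht.zero_notMem
  have hnew : ∀ T ∈ newTriangles γ 0, IsAdmissible r a₀ T := by
    intro T hT
    constructor
    · obtain ⟨b, d, o, rfl, hT'⟩ := hT.1.exists_triple_of_mem hT.2
      rw [hT'.circumradius_eq]
      obtain ⟨z, hz, hzo⟩ := hcov o
      exact (hT'.le_dist z (Set.mem_insert_of_mem _ hz)).trans_lt hzo
    · rw [lt_minSide_iff hT.1.2.1]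
      intro v hv w hw hvw
      rcases ht.mem_of_mem_newTriangles hT hv with rfl | ⟨i, rfl⟩ <;>
        rcases ht.mem_of_mem_newTriangles hT hw with rfl | ⟨j, rfl⟩
      · exact absurd rfl hvw
      · rw [dist_zero_left]; exact (hp j).1
      · rw [dist_zero_right]; exact (hp i).1
      · exact hsep _ (ht.mem i) _ (ht.mem j) hvw
  refine ⟨hfin, h0, ?_⟩
  have hE : ∀ θ, delaunayEnergy r a₀ θ (Metric.ball 0 1) γ < ⊤ := fun θ =>
    (delaunayEnergy_lt_top_iff Metric.isBounded_ball).2 fun T hT =>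
      mem_finiteEnergyConfigs_iff.1 hfin T hT.1
  have hn := Metric.ball_mem_nhds (0 : Plane) one_pos
  rw [localEnergy_of_admissible h0 (isBoundedBorel_ball 0 1) hn (hE _) hnew,
    localEnergy_of_admissible h0 (isBoundedBorel_ball 0 1) hn (hE _) hnew, Ne,
    EReal.coe_eq_coe_iff]
  exact fun h => hθ (mul_right_cancel₀ ht.perimeterVariation_pos.ne' h).symm

end

theorem proposition5 (r : ℝ) (hr : 0 < r)
    (K : Set ℝ) (hK : IsCompact K) (hKpos : K ⊆ Set.Ioi 0) (hKr : ∀ α ∈ K, r < α)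
    (Θ : Set ℝ) (hΘ_open : IsOpen Θ) (hΘ_bdd : Bornology.IsBounded Θ) :
    AssumptionS1 Θ (delaunayEnergy r) ∧
    AssumptionS2 Θ (delaunayEnergy r) ∧
    AssumptionS4 Θ (delaunayEnergy r) ∧
    AssumptionH2 Θ (delaunayEnergy r) ∧
    AssumptionH3 K Θ (delaunayEnergy r) ∧
    ∀ a₀ ∈ K, ∀ t₀ ∈ Θ,
      AssumptionS3 (delaunayEnergy r) a₀ t₀ ∧
      ∀ μ : Measure Config, IsStationaryGibbs (delaunayEnergy r a₀ t₀) μ →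
        AssumptionH4 Θ (delaunayEnergy r) a₀ t₀ μ ∧
        AssumptionH5 Θ (delaunayEnergy r) a₀ t₀ μ ∧
        AssumptionH6' Θ (delaunayEnergy r) a₀ t₀ μ := by
  refine ⟨assumptionS1_delaunayEnergy r Θ, assumptionS2_delaunayEnergy r Θ,
    assumptionS4_delaunayEnergy r Θ, assumptionH2_delaunayEnergy r Θ,
    assumptionH3_delaunayEnergy hr hK hΘ_bdd, fun a₀ ha₀ t₀ _ => ?_⟩
  have hpos : 0 ≤ a₀ := (hKpos ha₀).le
  refine ⟨assumptionS3_delaunayEnergy hr (hKr a₀ ha₀), fun μ hμ => ?_⟩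
  have := hμ.isProbabilityMeasure
  exact ⟨assumptionH4_delaunayEnergy hr hpos hμ, assumptionH5_delaunayEnergy hr (hKr a₀ ha₀) hμ,
    assumptionH6'_delaunayEnergy hr hpos μ⟩
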